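/- **The game and the notation.** Let $b$ be a non-negative integer. In the biased Maker–Breaker Hamilton cycle game on the complete graph with vertex set $V$, $|V|=n$, Breaker starts; in each round Breaker chooses at most $b$ edges that nobody has chosen, and then Maker chooses one edge. Let $B$ and $M$ be the graphs of the edges chosen so far by Breaker and by Maker, and let $d_B,d_M$ be the degrees in them. Whenever Maker chooses an edge, she chooses it *from* one of its endpoints. Call a vertex $v$ *troublesome* if $d_B(v)>n/\sqrt{\ln n}$. Let $d'_M(v)$ be the number of edges that Maker has chosen from $v$, let $d^+_M(v)$ be the number of those that were chosen after $v$ became troublesome, and let $\partial(v)=d_B(v)-b\,d_M^+(v)$ be the *danger* of $v$. **Maker's strategy.** Before the game Maker fixes an arbitrary set $S_0\subseteq V$ with $|S_0|=\lceil 2000n/\sqrt{\ln n}\,\rceil$. She maintains a set $S\supseteq S_0$, initially $S_0$, and a family $\mathcal F$ of disjoint paths partitioning $V\setminus S$, initially consisting of singletons. When a vertex $w$ is *moved to $S$*, it is added to $S$ and the path $Q\in\mathcal F$ containing $w$ is replaced by the components of $Q-w$. After every turn of Breaker, all troublesome vertices outside $S$ are moved to $S$; then Maker plays as follows. Choices for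 which no rule is given are arbitrary. A *random choice from $v$* means that she picks $w^*$ uniformly at random from $\{w\in S_0\setminus\{v\}: vw\notin B\}$ and chooses $vw^*$ from $v$ (if $vw^*$ is already hers, it counts as chosen from $v$ once more). *Both phases, Case 2: some troublesome $v$ has $d_M^+(v)<10$.* Among these vertices she takes one of maximum danger, chooses from it an edge $vw$ with $w\in V\setminus S$ and $vw\notin M\cup B$, and moves $w$ to $S$. *Both phases, Case 1: every troublesome $v$ has $d_M^+(v)\ge10$.* If some $v\in S$ has $d'_M(v)<10$, she makes a random choice from such a $v$. If there is no such $v$, then she proceeds according to the phase. - *Phase 1.* If there are distinct paths $Q,Q'\in\mathcal F$ with endpoints $u$ of $Q$ and $v$ of $Q'$ such that $d_M(u),d_M(v)\le1$ and $uv\notin B$, she chooses such an edge $uv$ and replaces $Q,Q'$ by their concatenation through $uv$. Otherwise Phase 2 starts, and she makes her move in this round by the rules of Phase 2. - *Phase 2.* At the start of the phase let $P$ be a longest path in $M$ that contains a vertex of $S$; in each later round of the phase, $P$ is first replaced by a longest path in $M$ that contains all vertices of the previous $P$. If some endpoint $v$ of a path of $\mathcal F$ has $d'_M(v)<10$, she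 makes a random choice from such a $v$. Otherwise, if $M$ contains a cycle with vertex set $V(P)$, Phase 2 ends. If it contains none, she chooses an edge $uv\notin B$, where $u\neq v$ are vertices of $S_0$ that are the endpoints of a path in $M$ with vertex set $V(P)$. **Theorem 3.** There is a constant $C>0$ such that for every $\varepsilon>0$ there is an $N$ such that the following holds for all $n\ge N$, all integers $b\ge 0$ with $b\le \frac{n}{\ln n}-\frac{Cn}{(\ln n)^{3/2}}$, every choice of $S_0$, every strategy of Breaker, and every way of making the arbitrary choices in Maker's strategy (both may depend on the whole history of the game). With probability at least $1-\varepsilon$ over Maker's random choices, at every step of Phase 1 and of Phase 2 Maker can choose the edge that the strategy prescribes. That is: whenever she is to make a random choice from $v$, the set $\{w\in S_0\setminus\{v\}: vw\notin B\}$ is not empty; whenever she is in Case 2, there is a $w\in V\setminus S$ with $vw\notin M\cup B$; and whenever, in Phase 2, she is to choose an edge $uv$ for a path $P$ without a cycle on $V(P)$, such an edge exists. -/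

import Mathlib

/-!
The biased Maker-Breaker game on the edges of the complete graph with vertex set `Fin n`, and
the randomised two-phase strategy of Maker for building a Hamilton cycle.
-/

namespace MakerBreaker

/-- The stage Maker's strategy is in: one of its two phases, regularly ended, or `failed`, which
means that an edge prescribed by the strategy was not there to be chosen. -/
inductive Phase
  | one
  | two
  | ended
  | failed

/-- A position of the game, with the data maintained by Maker's strategy. -/
structure State (n : ℕ) where
  /-- the current stage of the strategy -/
  phase : Phase
  /-- the graph of the edges chosen by Breaker -/
  B : SimpleGraph (Fin n)
  /-- the graph of the edges chosen by Maker -/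
  M : SimpleGraph (Fin n)
  /-- the current set `S_i` -/
  S : Finset (Fin n)
  /-- the current family of disjoint paths that partition `V - S_i`, given by the graph of all
  their edges: the paths are its connected components on `V - S_i` -/
  F : SimpleGraph (Fin n)
  /-- `d'_M v`: the number of edges Maker has chosen from `v` -/
  out : Fin n → ℕ
  /-- `d⁺_M v`: the number of edges Maker has chosen from `v` after `v` became troublesome -/
  outT : Fin n → ℕ
  /-- in the second phase, the vertex set of the current path `P_i` -/
  P : Finset (Fin n)

/-- The degree of a vertex in a graph. -/
noncomputable def deg {n : ℕ} (G : SimpleGraph (Fin n)) (v : Fin n) : ℕ :=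
  (G.neighborSet v).ncard

/-- The graph `G` after deleting all edges that meet `T`. -/
def isolate {n : ℕ} (G : SimpleGraph (Fin n)) (T : Finset (Fin n)) : SimpleGraph (Fin n) where
  Adj x y := G.Adj x y ∧ x ∉ T ∧ y ∉ T
  symm := ⟨fun _ _ h => ⟨h.1.symm, h.2.2, h.2.1⟩⟩
  loopless := ⟨fun _ h => h.1.ne rfl⟩

/-- `G` contains a path with endpoints `u` and `v` and vertex set `X`. -/
def HasPathOn {n : ℕ} (G : SimpleGraph (Fin n)) (X : Finset (Fin n)) (u v : Fin n) : Prop :=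
  ∃ p : G.Walk u v, p.IsPath ∧ ∀ x, x ∈ p.support ↔ x ∈ X

/-- `X` is the vertex set of a path in `G`. -/
def IsPathSet {n : ℕ} (G : SimpleGraph (Fin n)) (X : Finset (Fin n)) : Prop :=
  ∃ u v, HasPathOn G X u v

/-- `G` contains a cycle with vertex set `X`. -/
def HasCycleOn {n : ℕ} (G : SimpleGraph (Fin n)) (X : Finset (Fin n)) : Prop :=
  ∃ (u : Fin n) (p : G.Walk u u), p.IsCycle ∧ ∀ x, x ∈ p.support ↔ x ∈ X

/-- `X` is the vertex set of a longest path among the paths in `G` whose vertex set has the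
property `Q`. -/
def IsLongestPathSet {n : ℕ} (G : SimpleGraph (Fin n)) (Q : Finset (Fin n) → Prop)
    (X : Finset (Fin n)) : Prop :=
  IsPathSet G X ∧ Q X ∧ ∀ Y, IsPathSet G Y → Q Y → Y.card ≤ X.card

namespace State

variable {n : ℕ}

/-- The position before the game starts: all paths of the family are singletons. -/
def init (S₀ : Finset (Fin n)) : State n where
  phase := Phase.one
  B := ⊥
  M := ⊥
  S := S₀
  F := ⊥
  out := 0
  outT := 0
  P := ∅

/-- A vertex is troublesome if its degree in Breaker's graph exceeds `n / √(ln n)`. -/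
def Troublesome (s : State n) (v : Fin n) : Prop :=
  (n : ℝ) / √(Real.log n) < (deg s.B v : ℝ)

/-- The danger `d_B v - b d⁺_M v`. -/
noncomputable def danger (b : ℕ) (s : State n) (v : Fin n) : ℤ :=
  (deg s.B v : ℤ) - (b : ℤ) * (s.outT v : ℤ)

open Classical in
/-- Maker chooses the edge `vw` from `v`. -/
noncomputable def addArc (s : State n) (v w : Fin n) : State n :=
  { s with
    M := s.M ⊔ SimpleGraph.edge v w
    out := Function.update s.out v (s.out v + 1)
    outT := if s.Troublesome v then Function.update s.outT v (s.outT v + 1) else s.outT }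

/-- The vertices of `T` are added to `S_i`, and every path of the family that meets `T` is
replaced by the components that remain of it. -/
def moveToS (s : State n) (T : Finset (Fin n)) : State n :=
  { s with S := s.S ∪ T, F := isolate s.F T }

open Classical in
/-- The update after Breaker has chosen the edges of `E`: every troublesome vertex is put
into `S_i`. -/
noncomputable def afterBreaker (s : State n) (E : SimpleGraph (Fin n)) : State n :=
  let s' : State n := { s with B := s.B ⊔ E }
  s'.moveToS (Finset.univ.filter fun v => v ∉ s.S ∧ s'.Troublesome v)

/-- A troublesome vertex from which fewer than ten edges were chosen since it is troublesome. -/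
def Needy (s : State n) (v : Fin n) : Prop :=
  s.Troublesome v ∧ s.outT v < 10

/-- No vertex is needy, and ten edges were chosen from every vertex of `S_i`. -/
def Settled (s : State n) : Prop :=
  (∀ v, ¬ s.Needy v) ∧ ∀ v ∈ s.S, 10 ≤ s.out v

/-- `v` is an endpoint of a path of the family (the only vertex of a singleton path is one). -/
def IsEndpoint (s : State n) (v : Fin n) : Prop :=
  v ∉ s.S ∧ deg s.F v ≤ 1

/-- There are two distinct paths of the family that are `uv`-available. -/
def Available (s : State n) (u v : Fin n) : Prop :=
  s.IsEndpoint u ∧ s.IsEndpoint v ∧ ¬ s.F.Reachable u v ∧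
    deg s.M u ≤ 1 ∧ deg s.M v ≤ 1 ∧ ¬ s.B.Adj u v

/-- There is a path on `V(P_i)` in Maker's graph whose two endpoints `u` and `v` lie in `S₀`,
where the edge `uv` is not chosen by Breaker. -/
def Booster (S₀ : Finset (Fin n)) (s : State n) (u v : Fin n) : Prop :=
  u ∈ S₀ ∧ v ∈ S₀ ∧ u ≠ v ∧ HasPathOn s.M s.P u v ∧ ¬ s.B.Adj u v

open Classical in
/-- The vertices `w` of `S₀` such that the edge `vw` is not chosen by Breaker. -/
noncomputable def options (S₀ : Finset (Fin n)) (s : State n) (v : Fin n) : Finset (Fin n) :=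
  S₀.filter fun w => w ≠ v ∧ ¬ s.B.Adj v w

/-- The position in which Maker cannot choose the edge she wants. -/
def fail (s : State n) : State n := { s with phase := Phase.failed }

open Classical in
/-- Maker chooses an edge from `v` to a uniform random element of `options S₀ s v`. -/
noncomputable def randomMove (S₀ : Finset (Fin n)) (s : State n) (v : Fin n) : PMF (State n) :=
  if h : (s.options S₀ v).Nonempty then
    (PMF.uniformOfFinset (s.options S₀ v) h).map (s.addArc v)
  else PMF.pure s.fail

end State

open State

/-- `MakerMove b S₀ s μ`: in the position `s`, reached after a turn of Breaker, the strategy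
allows Maker a move after which the position has the law `μ`. The strategy leaves several choices
open, so that there may be more than one such `μ`. -/
inductive MakerMove {n : ℕ} (b : ℕ) (S₀ : Finset (Fin n)) : State n → PMF (State n) → Prop
  /-- Either phase, Case 2: `v` is a needy vertex of maximum danger. -/
  | needy (s : State n) (v w : Fin n) (hv : s.Needy v)
      (hmax : ∀ x, s.Needy x → s.danger b x ≤ s.danger b v)
      (hw : w ∉ s.S ∧ w ≠ v ∧ ¬ s.M.Adj v w ∧ ¬ s.B.Adj v w) :
      MakerMove b S₀ s (PMF.pure ((s.addArc v w).moveToS {w}))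
  /-- Either phase, Case 2, but no edge can be chosen. -/
  | needyFail (s : State n) (v : Fin n) (hv : s.Needy v)
      (hmax : ∀ x, s.Needy x → s.danger b x ≤ s.danger b v)
      (hw : ∀ w, ¬ (w ∉ s.S ∧ w ≠ v ∧ ¬ s.M.Adj v w ∧ ¬ s.B.Adj v w)) :
      MakerMove b S₀ s (PMF.pure s.fail)
  /-- Either phase, Case 1, for a vertex of `S_i` with fewer than ten chosen edges. -/
  | random (s : State n) (v : Fin n) (hs : ∀ x, ¬ s.Needy x) (hv : v ∈ s.S)
      (hout : s.out v < 10) : MakerMove b S₀ s (s.randomMove S₀ v)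
  /-- First phase, Case 1: two available paths are joined. -/
  | join (s : State n) (u v : Fin n) (hp : s.phase = Phase.one) (hs : s.Settled)
      (huv : s.Available u v) :
      MakerMove b S₀ s
        (PMF.pure { s.addArc u v with F := s.F ⊔ SimpleGraph.edge u v })
  /-- First phase, Case 1, no two paths are available: the second phase starts, with a longest path
  that meets `S_i`, and Maker makes her first move in it. -/
  | toPhaseTwo (s : State n) (X : Finset (Fin n)) (μ : PMF (State n))
      (hp : s.phase = Phase.one) (hs : s.Settled) (huv : ∀ u v, ¬ s.Available u v)
      (hX : IsLongestPathSet s.M (fun Y => ∃ x ∈ Y, x ∈ s.S) X)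
      (hμ : MakerMove b S₀ { s with phase := Phase.two, P := X } μ) :
      MakerMove b S₀ s μ
  /-- Second phase, Case 1, for an endpoint of a path with fewer than ten chosen edges. -/
  | randomEndpoint (s : State n) (v : Fin n) (hp : s.phase = Phase.two) (hs : s.Settled)
      (hv : s.IsEndpoint v) (hout : s.out v < 10) : MakerMove b S₀ s (s.randomMove S₀ v)
  /-- Second phase, Case 1: there is no cycle on `V(P_i)`, and Maker closes one. -/
  | boost (s : State n) (u v : Fin n) (hp : s.phase = Phase.two) (hs : s.Settled)
      (he : ∀ x, s.IsEndpoint x → 10 ≤ s.out x) (hc : ¬ HasCycleOn s.M s.P)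
      (huv : s.Booster S₀ u v) : MakerMove b S₀ s (PMF.pure (s.addArc u v))
  /-- Second phase, Case 1: there is no cycle on `V(P_i)`, but no edge that closes one can be
  chosen. -/
  | boostFail (s : State n) (hp : s.phase = Phase.two) (hs : s.Settled)
      (he : ∀ x, s.IsEndpoint x → 10 ≤ s.out x) (hc : ¬ HasCycleOn s.M s.P)
      (huv : ∀ u v, ¬ s.Booster S₀ u v) : MakerMove b S₀ s (PMF.pure s.fail)
  /-- Second phase, Case 1: there is a cycle on `V(P_i)`, and the second phase ends. -/
  | finish (s : State n) (hp : s.phase = Phase.two) (hs : s.Settled)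
      (he : ∀ x, s.IsEndpoint x → 10 ≤ s.out x) (hc : HasCycleOn s.M s.P) :
      MakerMove b S₀ s (PMF.pure { s with phase := Phase.ended })

/-- `Round b S₀ s μ`: from the position `s`, a turn of Breaker (at most `b` edges that nobody has
chosen) and then a move of Maker by her strategy can lead to a position with the law `μ`. In the
second phase, `P_i` is first replaced by a longest path that contains its vertices. -/
inductive Round {n : ℕ} (b : ℕ) (S₀ : Finset (Fin n)) : State n → PMF (State n) → Prop
  | phaseOne (s : State n) (E : SimpleGraph (Fin n)) (μ : PMF (State n))
      (hp : s.phase = Phase.one) (hE : Disjoint E (s.B ⊔ s.M)) (hb : E.edgeSet.ncard ≤ b)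
      (hμ : MakerMove b S₀ (s.afterBreaker E) μ) : Round b S₀ s μ
  | phaseTwo (s : State n) (E : SimpleGraph (Fin n)) (X : Finset (Fin n)) (μ : PMF (State n))
      (hp : s.phase = Phase.two) (hE : Disjoint E (s.B ⊔ s.M)) (hb : E.edgeSet.ncard ≤ b)
      (hX : IsLongestPathSet s.M (fun Y => s.P ⊆ Y) X)
      (hμ : MakerMove b S₀ { s.afterBreaker E with P := X } μ) : Round b S₀ s μ
  | over (s : State n) (hp : s.phase = Phase.ended ∨ s.phase = Phase.failed) :
      Round b S₀ s (PMF.pure s)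

/-- The law of the history of the game (most recent position first) after `k` rounds that start
from `S₀`, when the law of the next position after the history `h` is `σ h`. -/
noncomputable def historyLaw {n : ℕ} (S₀ : Finset (Fin n)) (σ : List (State n) → PMF (State n)) :
    ℕ → PMF (List (State n))
  | 0 => PMF.pure [State.init S₀]
  | k + 1 => (historyLaw S₀ σ k).bind fun h => (σ h).map fun s => s :: h

/-- `σ` describes a game with bias `b` in which Maker follows her strategy: after every history
that can occur, Breaker makes a turn and Maker makes a move of her strategy. Both the turn of
Breaker and the choices that Maker's strategy leaves open may depend on the whole history. -/
def IsPlay {n : ℕ} (b : ℕ) (S₀ : Finset (Fin n)) (σ : List (State n) → PMF (State n)) : Prop :=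
  ∀ k s h, s :: h ∈ (historyLaw S₀ σ k).support → Round b S₀ s (σ (s :: h))

end MakerBreaker

/-!
The probability of failure is bounded by a supermartingale, a function of the position alone. Write
`μ = n / √(ln n)`, so that `b n ≤ μ²`.

*Few rounds.* There are at most `n` rounds in which paths are joined. There are at most `n`
boosters, since a booster closes a cycle on `V(P)`, and `P` has to grow before the next one is
chosen. All other choices are made from *active* vertices: those of `S` and, in the second phase,
the endpoints of the paths of the family. Each vertex accounts for at most ten choices of each
kind, and there are only `O(μ)` active vertices. Indeed, by double counting, after `k` rounds there
are at most `2 μ k / n` troublesome vertices; each of them accounts for at most eleven vertices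
moved to `S`, itself included, and each vertex moved creates at most two endpoints. At the end of
the first phase the endpoints essentially form a clique of Breaker, so that there are at most `μ +
2` of them, as they are not troublesome. The inequality for `k` that results gives `k + 1 ≤ 2.1 n`
(`Count.le`), hence at most `4.2 μ` troublesome and `2140 μ` active vertices, whereas `|S₀| ≥ 2000
μ`.

*Case 2 never fails* (`Mid.exists_needy_move`). For a set `T` of needy vertices, consider the
number of Breaker's edges that meet `T` less `b` for every choice from a troublesome vertex of `T`.
Since an edge inside `T` counts once, a turn of Breaker adds at most `b`. When Maker chooses from a
needy vertex `v ∉ T` of maximum danger, the bound for `insert v T` gives one for `T`, because the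
danger of `v` is at least the average danger in `T`. So a bound in terms of the size of `T`
persists (`dangerBound`), with a harmonic sum that makes the danger of a needy vertex, and hence
its degree in Breaker's graph, at most `b ln n + O(μ) ≤ n - 9000 μ`.

*Boosters* (`Mid.exists_booster`). As vertices that are not active have only their two neighbours
on a path of the family, rotations of `P` with pivots in `S` produce active ends only. Let `R` be
the set of ends; by Pósa's lemma the neighbours in `S` of `R` lie in a set of at most `3 |R|`
vertices. The troublesome vertices of `R` have ten neighbours each in `S \ S₀`, all different. So
the set `W` of the other vertices of `R` has at most `3 |W|` neighbours in `S₀`. If this is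
impossible for `|W| ≤ 0.08 |S₀|`, then `R` contains at least `20 μ` vertices of `S₀`; rotating both
ends, one finds endpoints in `S₀` that Breaker has not joined.

*Small sets expand.* Every vertex of `W` makes at least eight random choices, each of which lies in
a fixed set `X ⊆ S₀` of `3 |W|` vertices with probability at most `q = 3 |W| / (0.999 |S₀|)`. There
may be far too many sets `W ⊆ V`, but only those of active vertices matter. As these are selected
adaptively, the union bound over `W` is replaced by a generating function: the product over the
active vertices of `1 + t a`, where `a` bounds the conditional probability that all neighbours in
`S₀` of the vertex will lie in `X`, normalised by a factor for the number of active vertices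
(`pot`). This is a supermartingale, and so is the sum over all sizes `|W|` and sets `X` (`total`).
It is small at the start (`exists_total_init_le`) and at least `1` if some `W` does not expand
(`expands_of_total_lt_one`). Until it reaches `1`, the deterministic arguments above apply.
-/

namespace MakerBreaker

open State
open scoped ENNReal

/-! ### Expectations under probability mass functions -/

/-- The expectation of a function with values in `[0, ∞]` under a probability mass function. -/
noncomputable def expect {α : Type*} (p : PMF α) (g : α → ℝ≥0∞) : ℝ≥0∞ := ∑' a, p a * g a

theorem expect_pure {α : Type*} (a : α) (g : α → ℝ≥0∞) : expect (PMF.pure a) g = g a := by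
  unfold expect
  rw [tsum_eq_single a]
  · simp
  · intro b hb
    simp [PMF.pure_apply, hb]

theorem expect_bind {α β : Type*} (p : PMF α) (f : α → PMF β) (g : β → ℝ≥0∞) :
    expect (p.bind f) g = expect p fun a => expect (f a) g := by
  simp only [expect, PMF.bind_apply, ← ENNReal.tsum_mul_right, ← ENNReal.tsum_mul_left]
  rw [ENNReal.tsum_comm]
  simp only [mul_assoc]

theorem expect_map {α β : Type*} (p : PMF α) (f : α → β) (g : β → ℝ≥0∞) :
    expect (p.map f) g = expect p (g ∘ f) := by
  unfold PMF.map
  rw [expect_bind]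
  congr 1
  funext a
  simp [expect_pure]

theorem expect_mono {α : Type*} (p : PMF α) {g g' : α → ℝ≥0∞} (h : ∀ a ∈ p.support, g a ≤ g' a) :
    expect p g ≤ expect p g' := by
  refine ENNReal.tsum_le_tsum fun a => ?_
  by_cases ha : a ∈ p.support
  · gcongr
    exact h a ha
  · rw [PMF.mem_support_iff, not_not] at ha
    simp [ha]

theorem expect_const {α : Type*} (p : PMF α) (c : ℝ≥0∞) : expect p (fun _ => c) = c := by
  simp [expect, ENNReal.tsum_mul_right, p.tsum_coe]

theorem expect_uniformOfFinset {α : Type*} (t : Finset α) (ht : t.Nonempty) (g : α → ℝ≥0∞) :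
    expect (PMF.uniformOfFinset t ht) g = (t.card : ℝ≥0∞)⁻¹ * ∑ a ∈ t, g a := by
  unfold expect
  rw [tsum_eq_sum (s := t)]
  · rw [Finset.mul_sum]
    refine Finset.sum_congr rfl fun a ha => ?_
    rw [PMF.uniformOfFinset_apply_of_mem _ ha]
  · intro b hb
    rw [PMF.uniformOfFinset_apply_of_notMem _ hb, zero_mul]

/-! ### Rotations of longest paths -/

section Rotation

variable {V : Type*}

/-- `l` is the list of vertices of a path of `G`. -/
def IsPathList (G : SimpleGraph V) (l : List V) : Prop := l.Nodup ∧ l.IsChain G.Adj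

/-- `Rot G S l₀ l`: the path `l` arises from the path `l₀` by rotations with pivots in `S`. The
end of the path that moves is the head of the list. -/
inductive Rot (G : SimpleGraph V) (S : Set V) (l₀ : List V) : List V → Prop
  | refl : Rot G S l₀ l₀
  | step (v x : V) (q p : List V) (h : Rot G S l₀ (v :: q ++ x :: p)) (hx : x ∈ S)
      (hvx : G.Adj v x) : Rot G S l₀ ((v :: q).reverse ++ x :: p)

/-- The vertices that rotations bring to the head of the path. -/
def rotEnds (G : SimpleGraph V) (S : Set V) (l₀ : List V) : Set V :=
  {v | ∃ l, Rot G S l₀ (v :: l)}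

/-- `x` and `y` are consecutive in the list `l`, in one of the two orders. -/
def Consec [DecidableEq V] (l : List V) (x y : V) : Prop :=
  x ∈ l ∧ y ∈ l ∧ (l.idxOf x + 1 = l.idxOf y ∨ l.idxOf y + 1 = l.idxOf x)

/-- The ends that rotations produce, and their neighbours on the original path. -/
def rotHull [DecidableEq V] (G : SimpleGraph V) (S : Set V) (l₀ : List V) : Set V :=
  {x | x ∈ rotEnds G S l₀ ∨ ∃ y ∈ rotEnds G S l₀, Consec l₀ x y}

theorem Consec.symm [DecidableEq V] {l : List V} {x y : V} (h : Consec l x y) : Consec l y x :=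
  ⟨h.2.1, h.1, h.2.2.symm⟩

theorem isChain_consec [DecidableEq V] {l : List V} (hl : l.Nodup) : l.IsChain (Consec l) := by
  rw [List.isChain_iff_getElem]
  intro i hi
  refine ⟨List.getElem_mem _, List.getElem_mem _, Or.inl ?_⟩
  rw [hl.idxOf_getElem, hl.idxOf_getElem]

theorem Rot.perm {G : SimpleGraph V} {S : Set V} {l₀ l : List V} (h : Rot G S l₀ l) :
    l.Perm l₀ := by
  induction h with
  | refl => exact List.Perm.refl _
  | step v x q p h hx hvx ih => exact ((List.reverse_perm _).append_right _).trans ih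

theorem Rot.isChain {G : SimpleGraph V} {S : Set V} {l₀ l : List V}
    (h₀ : l₀.IsChain G.Adj) (h : Rot G S l₀ l) : l.IsChain G.Adj := by
  induction h with
  | refl => exact h₀
  | step v x q p h hx hvx ih =>
    rw [List.isChain_append] at ih ⊢
    refine ⟨?_, ih.2.1, ?_⟩
    · rw [List.isChain_reverse]
      exact ih.1.imp fun _ _ hab => hab.symm
    · intro a ha b hb
      simp only [List.getLast?_reverse, List.head?_cons, Option.mem_def, Option.some.injEq] at ha hb
      subst ha hb
      exact hvx

theorem Rot.getLast? {G : SimpleGraph V} {S : Set V} {l₀ l : List V} (h : Rot G S l₀ l) :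
    l.getLast? = l₀.getLast? := by
  induction h with
  | refl => rfl
  | step v x q p h hx hvx ih =>
    rw [← ih, List.getLast?_append_cons, List.getLast?_append_cons]

theorem Rot.isPathList {G : SimpleGraph V} {S : Set V} {l₀ l : List V}
    (h₀ : IsPathList G l₀) (h : Rot G S l₀ l) : IsPathList G l :=
  ⟨h.perm.nodup_iff.2 h₀.1, h.isChain h₀.2⟩

/-- The head after a rotation of `v :: q ++ x :: p` is the vertex `y` before the pivot `x`. -/
theorem exists_head_reverse (v : V) (q : List V) :
    ∃ y r, (v :: q).reverse = y :: r ∧ (v :: q).getLast? = some y := by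
  obtain ⟨y, r, h⟩ := List.exists_cons_of_ne_nil (l := (v :: q).reverse) (by simp)
  refine ⟨y, r, h, ?_⟩
  rw [← List.head?_reverse, h]
  rfl

/-- A pair of vertices that becomes consecutive by rotations lies in the hull: the pivot of a
rotation is in the hull, since the edge that is dropped there joins it to the new end. -/
theorem Rot.isChain_hull [DecidableEq V] {G : SimpleGraph V} {S : Set V} {l₀ l : List V}
    (h₀ : l₀.Nodup) (h : Rot G S l₀ l) :
    l.IsChain fun x y => Consec l₀ x y ∨ (x ∈ rotHull G S l₀ ∧ y ∈ rotHull G S l₀) := by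
  induction h with
  | refl => exact (isChain_consec h₀).imp fun _ _ h => Or.inl h
  | step v x q p h hx hvx ih =>
    obtain ⟨y, r, hy, hlast⟩ := exists_head_reverse v q
    have hyR : y ∈ rotEnds G S l₀ := ⟨r ++ x :: p, by
      have := Rot.step v x q p h hx hvx
      rwa [hy] at this⟩
    have hvR : v ∈ rotEnds G S l₀ := ⟨_, h⟩
    rw [List.isChain_append] at ih ⊢
    have hxH : x ∈ rotHull G S l₀ := by
      rcases ih.2.2 y hlast x (by simp) with h1 | h1
      · exact Or.inr ⟨y, hyR, h1.symm⟩
      · exact h1.2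
    refine ⟨?_, ih.2.1, ?_⟩
    · rw [List.isChain_reverse]
      exact ih.1.imp fun _ _ hab => hab.imp Consec.symm And.symm
    · intro a ha b hb
      simp only [List.getLast?_reverse, List.head?_cons, Option.mem_def, Option.some.injEq] at ha hb
      subst ha hb
      exact Or.inr ⟨Or.inl hvR, hxH⟩

/-- Pósa's lemma: the neighbours in `S` of the ends that rotations produce lie on the hull, if they
lie on the path. -/
theorem mem_rotHull_of_adj [DecidableEq V] {G : SimpleGraph V} {S : Set V} {l₀ : List V}
    (h₀ : l₀.Nodup) {v x : V} (hv : v ∈ rotEnds G S l₀) (hx : x ∈ S) (hvx : G.Adj v x)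
    (hxl : x ∈ l₀) :
    x ∈ rotHull G S l₀ := by
  obtain ⟨l, hl⟩ := hv
  have hx' : x ∈ v :: l := hl.perm.mem_iff.2 hxl
  have hx'' : x ∈ l := by
    rcases List.mem_cons.1 hx' with h | h
    · exact absurd h.symm hvx.ne
    · exact h
  obtain ⟨q, p, rfl⟩ := List.append_of_mem hx''
  obtain ⟨y, r, hy, hlast⟩ := exists_head_reverse v q
  have hyR : y ∈ rotEnds G S l₀ := ⟨r ++ x :: p, by
    have := Rot.step v x q p hl hx hvx
    rwa [hy] at this⟩
  have hc := hl.isChain_hull h₀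
  rw [← List.cons_append, List.isChain_append] at hc
  rcases hc.2.2 y hlast x (by simp) with h1 | h1
  · exact Or.inr ⟨y, hyR, h1.symm⟩
  · exact h1.2

/-- Every end produced by rotations other than the original one is adjacent to a pivot. -/
theorem rotEnds_induction {G : SimpleGraph V} {S : Set V} {l₀ : List V} (h₀ : l₀.IsChain G.Adj)
    {P : V → Prop} (hhead : ∀ v ∈ l₀.head?, P v)
    (hstep : ∀ x ∈ S, ∀ y, G.Adj x y → P y) {v : V} (hv : v ∈ rotEnds G S l₀) : P v := by
  obtain ⟨l, hl⟩ := hv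
  generalize hm : v :: l = m at hl
  cases hl with
  | refl => exact hhead v (by simp [← hm])
  | step u x q p h hx hux =>
    obtain ⟨y, r, hy, hlast⟩ := exists_head_reverse u q
    rw [hy, List.cons_append, List.cons.injEq] at hm
    obtain ⟨rfl, -⟩ := hm
    have hc := h.isChain h₀
    rw [List.isChain_append] at hc
    exact hstep x hx v (hc.2.2 v hlast x (by simp)).symm

/-- The hull has at most three times as many vertices as there are ends. -/
theorem card_rotHull_le [Fintype V] [DecidableEq V] (G : SimpleGraph V) (S : Set V) (l₀ : List V) :
    (rotHull G S l₀).ncard ≤ 3 * (rotEnds G S l₀).ncard := by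
  classical
  set R := rotEnds G S l₀
  have key : ∀ f : V → V → Prop, (∀ x x' y, f x y → f x' y → x = x') →
      {x | ∃ y ∈ R, f x y}.ncard ≤ R.ncard := by
    intro f hf
    have hch : ∀ x ∈ {x | ∃ y ∈ R, f x y}, ∃ y ∈ R, f x y := fun x hx => hx
    choose! g hg using hch
    refine Set.ncard_le_ncard_of_injOn g (fun x hx => (hg x hx).1) ?_ (Set.toFinite _)
    intro x hx x' hx' h
    exact hf x x' _ (hg x hx).2 (h ▸ (hg x' hx').2)
  have h1 := key (fun x y => x ∈ l₀ ∧ l₀.idxOf x + 1 = l₀.idxOf y) (by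
    intro x x' y h h'
    exact (List.idxOf_inj h.1).1 (by omega))
  have h2 := key (fun x y => x ∈ l₀ ∧ l₀.idxOf y + 1 = l₀.idxOf x) (by
    intro x x' y h h'
    exact (List.idxOf_inj h.1).1 (by omega))
  have hsub : rotHull G S l₀ ⊆ R ∪ ({x | ∃ y ∈ R, x ∈ l₀ ∧ l₀.idxOf x + 1 = l₀.idxOf y} ∪
      {x | ∃ y ∈ R, x ∈ l₀ ∧ l₀.idxOf y + 1 = l₀.idxOf x}) := by
    rintro x (hx | ⟨y, hy, hc⟩)
    · exact Or.inl hx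
    · rcases hc.2.2 with h | h
      · exact Or.inr (Or.inl ⟨y, hy, hc.1, h⟩)
      · exact Or.inr (Or.inr ⟨y, hy, hc.1, h⟩)
  have h3 := Set.ncard_le_ncard hsub (Set.toFinite _)
  have h4 := Set.ncard_union_le R ({x | ∃ y ∈ R, x ∈ l₀ ∧ l₀.idxOf x + 1 = l₀.idxOf y} ∪
      {x | ∃ y ∈ R, x ∈ l₀ ∧ l₀.idxOf y + 1 = l₀.idxOf x})
  have h5 := Set.ncard_union_le {x | ∃ y ∈ R, x ∈ l₀ ∧ l₀.idxOf x + 1 = l₀.idxOf y}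
      {x | ∃ y ∈ R, x ∈ l₀ ∧ l₀.idxOf y + 1 = l₀.idxOf x}
  omega

end Rotation

/-! ### Paths as lists of vertices -/

theorem IsPathList.reverse {V : Type*} {G : SimpleGraph V} {l : List V} (h : IsPathList G l) :
    IsPathList G l.reverse := by
  refine ⟨List.nodup_reverse.2 h.1, ?_⟩
  rw [List.isChain_reverse]
  exact h.2.imp fun _ _ hab => hab.symm

theorem hasPathOn_iff {n : ℕ} {G : SimpleGraph (Fin n)} {X : Finset (Fin n)} {u v : Fin n} :
    HasPathOn G X u v ↔ ∃ l, IsPathList G l ∧ l.head? = some u ∧ l.getLast? = some v ∧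
      ∀ x, x ∈ l ↔ x ∈ X := by
  constructor
  · rintro ⟨p, hp, hX⟩
    refine ⟨p.support, ⟨hp.support_nodup, p.isChain_adj_support⟩, ?_, ?_, hX⟩
    · rw [List.head?_eq_some_head p.support_ne_nil, p.head_support]
    · rw [List.getLast?_eq_some_getLast p.support_ne_nil, p.getLast_support]
  · rintro ⟨l, hl, hu, hv, hX⟩
    have hne : l ≠ [] := by
      rintro rfl
      simp at hu
    have hu' : l.head hne = u := by
      rw [List.head?_eq_some_head hne] at hu
      exact Option.some.inj hu
    have hv' : l.getLast hne = v := by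
      rw [List.getLast?_eq_some_getLast hne] at hv
      exact Option.some.inj hv
    subst hu' hv'
    refine ⟨SimpleGraph.Walk.ofSupport l hne hl.2, ?_, ?_⟩
    · rw [SimpleGraph.Walk.isPath_def, SimpleGraph.Walk.support_ofSupport]
      exact hl.1
    · intro x
      rw [SimpleGraph.Walk.support_ofSupport]
      exact hX x

theorem isPathSet_iff {n : ℕ} {G : SimpleGraph (Fin n)} {X : Finset (Fin n)} :
    IsPathSet G X ↔ ∃ l, IsPathList G l ∧ l ≠ [] ∧ ∀ x, x ∈ l ↔ x ∈ X := by
  constructor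
  · rintro ⟨u, v, h⟩
    obtain ⟨l, hl, hu, -, hX⟩ := hasPathOn_iff.1 h
    refine ⟨l, hl, ?_, hX⟩
    rintro rfl
    simp at hu
  · rintro ⟨l, hl, hne, hX⟩
    exact ⟨l.head hne, l.getLast hne, hasPathOn_iff.2
      ⟨l, hl, List.head?_eq_some_head hne, List.getLast?_eq_some_getLast hne, hX⟩⟩

theorem hasCycleOn_of_hasPathOn {n : ℕ} {G : SimpleGraph (Fin n)} {X : Finset (Fin n)}
    {u v : Fin n} (h : HasPathOn G X u v) (huv : G.Adj u v) (hX : 3 ≤ X.card) :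
    HasCycleOn G X := by
  obtain ⟨p, hp, hpX⟩ := h
  refine ⟨v, SimpleGraph.Walk.cons huv.symm p, ?_, ?_⟩
  · rw [SimpleGraph.Walk.cons_isCycle_iff]
    refine ⟨hp, fun he => ?_⟩
    have hlen : p.length = 1 := hp.length_eq_one_of_mem_edges (Sym2.eq_swap ▸ he)
    have h1 : p.support.length = 2 := by rw [SimpleGraph.Walk.length_support, hlen]
    have h2 : X ⊆ p.support.toFinset := fun x hx => List.mem_toFinset.2 ((hpX x).2 hx)
    have h3 := Finset.card_le_card h2
    have h4 := p.support.toFinset_card_le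
    omega
  · intro x
    rw [SimpleGraph.Walk.support_cons, List.mem_cons, hpX]
    refine ⟨?_, Or.inr⟩
    rintro (rfl | h)
    · exact (hpX x).1 p.end_mem_support
    · exact h

/-! ### Degrees and numbers of edges -/

section Degree

variable {n : ℕ}

open Classical in
theorem deg_eq_degree (G : SimpleGraph (Fin n)) (v : Fin n) : deg G v = G.degree v := by
  unfold deg
  rw [Set.ncard_eq_toFinset_card', ← SimpleGraph.card_neighborSet_eq_degree, Set.toFinset_card]

theorem deg_mono {G H : SimpleGraph (Fin n)} (h : G ≤ H) (v : Fin n) : deg G v ≤ deg H v :=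
  Set.ncard_le_ncard (fun _ hx => h hx) (Set.toFinite _)

theorem deg_sup_le (G H : SimpleGraph (Fin n)) (v : Fin n) :
    deg (G ⊔ H) v ≤ deg G v + deg H v := by
  unfold deg
  rw [SimpleGraph.neighborSet_sup]
  exact Set.ncard_union_le _ _

theorem deg_bot (v : Fin n) : deg (⊥ : SimpleGraph (Fin n)) v = 0 := by
  simp [deg]

theorem deg_edge_le (u v x : Fin n) : deg (SimpleGraph.edge u v) x ≤ 1 := by
  unfold deg
  rw [Set.ncard_le_one (Set.toFinite _)]
  intro a ha b hb
  simp only [SimpleGraph.mem_neighborSet, SimpleGraph.edge_adj] at ha hb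
  grind

theorem deg_edge_eq_zero {u v x : Fin n} (hu : x ≠ u) (hv : x ≠ v) :
    deg (SimpleGraph.edge u v) x = 0 := by
  unfold deg
  rw [Set.ncard_eq_zero (Set.toFinite _), Set.eq_empty_iff_forall_notMem]
  intro a ha
  simp only [SimpleGraph.mem_neighborSet, SimpleGraph.edge_adj] at ha
  grind

theorem deg_sup_edge_self {G : SimpleGraph (Fin n)} {u v : Fin n} (huv : u ≠ v)
    (h : ¬ G.Adj u v) : deg (G ⊔ SimpleGraph.edge u v) u = deg G u + 1 := by
  unfold deg
  have : (G ⊔ SimpleGraph.edge u v).neighborSet u = insert v (G.neighborSet u) := by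
    ext a
    simp only [SimpleGraph.mem_neighborSet, SimpleGraph.sup_adj, SimpleGraph.edge_adj,
      Set.mem_insert_iff]
    grind
  rw [this, Set.ncard_insert_of_notMem (by simpa using h) (Set.toFinite _)]

theorem sum_deg_eq (G : SimpleGraph (Fin n)) : ∑ v, deg G v = 2 * G.edgeSet.ncard := by
  classical
  simp only [deg_eq_degree]
  rw [G.sum_degrees_eq_twice_card_edges, Set.ncard_eq_toFinset_card']
  rfl

/-- The number of edges that meet a set of vertices. -/
noncomputable def meet (G : SimpleGraph (Fin n)) (J : Finset (Fin n)) : ℕ :=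
  {e ∈ G.edgeSet | ∃ x ∈ J, x ∈ e}.ncard

theorem meet_empty (G : SimpleGraph (Fin n)) : meet G ∅ = 0 := by
  simp [meet]

theorem ncard_incidence (G : SimpleGraph (Fin n)) (v : Fin n) :
    {e ∈ G.edgeSet | v ∈ e}.ncard = deg G v := by
  classical
  rw [deg_eq_degree, ← G.card_incidenceSet_eq_degree, ← Nat.card_eq_fintype_card,
    Nat.card_coe_set_eq]
  rfl

theorem meet_singleton (G : SimpleGraph (Fin n)) (v : Fin n) : meet G {v} = deg G v := by
  rw [← ncard_incidence]
  simp [meet]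

theorem meet_union_le (G : SimpleGraph (Fin n)) (I J : Finset (Fin n)) :
    meet G (I ∪ J) ≤ meet G I + ∑ x ∈ J, deg G x := by
  classical
  induction J using Finset.induction_on with
  | empty => simp
  | insert v J hv ih =>
    rw [Finset.sum_insert hv]
    have h : {e ∈ G.edgeSet | ∃ x ∈ I ∪ insert v J, x ∈ e} ⊆
        {e ∈ G.edgeSet | ∃ x ∈ I ∪ J, x ∈ e} ∪ {e ∈ G.edgeSet | v ∈ e} := by
      rintro e ⟨he, x, hx, hxe⟩
      by_cases hxv : x = v
      · exact Or.inr ⟨he, hxv ▸ hxe⟩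
      · refine Or.inl ⟨he, x, ?_, hxe⟩
        simp only [Finset.mem_union, Finset.mem_insert] at hx ⊢
        tauto
    have h1 := (Set.ncard_le_ncard h (Set.toFinite _)).trans (Set.ncard_union_le _ _)
    rw [ncard_incidence] at h1
    unfold meet at ih ⊢
    omega

theorem meet_le_sum (G : SimpleGraph (Fin n)) (J : Finset (Fin n)) :
    meet G J ≤ ∑ x ∈ J, deg G x := by
  simpa [meet_empty] using meet_union_le G ∅ J

/-- A vertex `v` outside `J` has at most `J.card` edges to `J`. -/
theorem meet_add_deg_le (G : SimpleGraph (Fin n)) (J : Finset (Fin n)) {v : Fin n} (hv : v ∉ J) :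
    meet G J + deg G v ≤ meet G (insert v J) + J.card := by
  classical
  have h : {e ∈ G.edgeSet | ∃ x ∈ J, x ∈ e} ∪ {e ∈ G.edgeSet | v ∈ e} ⊆
      {e ∈ G.edgeSet | ∃ x ∈ insert v J, x ∈ e} := by
    rintro e (⟨he, x, hx, hxe⟩ | ⟨he, hve⟩)
    · exact ⟨he, x, Finset.mem_insert_of_mem hx, hxe⟩
    · exact ⟨he, v, Finset.mem_insert_self _ _, hve⟩
  have hI : {e ∈ G.edgeSet | ∃ x ∈ J, x ∈ e} ∩ {e ∈ G.edgeSet | v ∈ e} ⊆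
      (J.image fun x => s(v, x) : Finset (Sym2 (Fin n))) := by
    rintro e ⟨⟨he, x, hx, hxe⟩, -, hve⟩
    have hne : v ≠ x := fun h => hv (h ▸ hx)
    rw [Finset.coe_image]
    exact ⟨x, hx, ((Sym2.mem_and_mem_iff hne).1 ⟨hve, hxe⟩).symm⟩
  have h1 := Set.ncard_le_ncard h (Set.toFinite _)
  have h2 := Set.ncard_le_ncard hI (Set.toFinite _)
  rw [Set.ncard_coe_finset] at h2
  have h3 := h2.trans Finset.card_image_le
  have h4 := Set.ncard_union_add_ncard_inter {e ∈ G.edgeSet | ∃ x ∈ J, x ∈ e}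
    {e ∈ G.edgeSet | v ∈ e} (Set.toFinite _) (Set.toFinite _)
  rw [ncard_incidence] at h4
  unfold meet
  omega

theorem meet_sup_le (G E : SimpleGraph (Fin n)) (J : Finset (Fin n)) :
    meet (G ⊔ E) J ≤ meet G J + E.edgeSet.ncard := by
  have h : {e ∈ (G ⊔ E).edgeSet | ∃ x ∈ J, x ∈ e} ⊆
      {e ∈ G.edgeSet | ∃ x ∈ J, x ∈ e} ∪ E.edgeSet := by
    rintro e ⟨he, x, hx, hxe⟩
    rw [SimpleGraph.edgeSet_sup] at he
    rcases he with he | he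
    · exact Or.inl ⟨he, x, hx, hxe⟩
    · exact Or.inr he
  exact (Set.ncard_le_ncard h (Set.toFinite _)).trans (Set.ncard_union_le _ _)

/-- In a graph of maximum degree two, a component has at most two vertices of degree at most one:
a connected graph on `k` vertices has at least `k - 1` edges. -/
theorem card_reachable_ends_le {F : SimpleGraph (Fin n)} (hF : ∀ v, deg F v ≤ 2) (u : Fin n) :
    {v | F.Reachable u v ∧ deg F v ≤ 1}.ncard ≤ 2 := by
  classical
  set c := F.connectedComponentMk u
  have hconn : c.toSimpleGraph.Connected := c.connected_toSimpleGraph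
  have h1 := hconn.card_vert_le_card_edgeSet_add_one
  have h2 := c.toSimpleGraph.sum_degrees_eq_twice_card_edges
  have h3 : ∀ x : c, c.toSimpleGraph.degree x ≤ deg F x := by
    intro x
    rw [deg_eq_degree, ← SimpleGraph.card_neighborFinset_eq_degree,
      ← SimpleGraph.card_neighborFinset_eq_degree]
    refine Finset.card_le_card_of_injOn (fun y => (y : Fin n)) ?_ Subtype.val_injective.injOn
    intro y hy
    simp only [Finset.mem_coe, SimpleGraph.mem_neighborFinset] at hy ⊢
    exact hy
  have h4 : ∀ x : c, c.toSimpleGraph.degree x + (if deg F x ≤ 1 then 1 else 0) ≤ 2 := by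
    intro x
    have := h3 x
    have := hF x
    split_ifs <;> omega
  have h5 := Finset.sum_le_sum fun (x : c) (_ : x ∈ Finset.univ) => h4 x
  rw [Finset.sum_add_distrib, h2, Finset.sum_const, Finset.card_univ] at h5
  have h6 : {v | F.Reachable u v ∧ deg F v ≤ 1}.ncard ≤
      ∑ x : c, (if deg F x ≤ 1 then 1 else 0) := by
    rw [← Finset.card_filter]
    have : {v | F.Reachable u v ∧ deg F v ≤ 1} ⊆
        ((Finset.univ.filter fun x : c => deg F x ≤ 1).image Subtype.val : Finset (Fin n)) := by
      rintro v ⟨hv, hd⟩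
      simp only [Finset.coe_image, Finset.coe_filter, Finset.mem_univ, true_and, Set.mem_image,
        Set.mem_ofPred_eq, Subtype.exists, exists_and_right, exists_eq_right]
      exact ⟨(SimpleGraph.ConnectedComponent.eq.2 hv.symm : F.connectedComponentMk v = c), hd⟩
    refine (Set.ncard_le_ncard this (Set.toFinite _)).trans ?_
    rw [Set.ncard_coe_finset]
    exact Finset.card_image_le
  rw [Nat.card_eq_fintype_card, Nat.card_eq_fintype_card, ← SimpleGraph.edgeFinset_card] at h1
  simp only [smul_eq_mul] at h5
  have h7 : c.toSimpleGraph.edgeFinset.card = (SimpleGraph.edgeFinset c.toSimpleGraph).card := rfl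
  omega

end Degree

/-! ### The danger of needy vertices -/

section Danger

variable {n : ℕ}

/-- The bound on the number of Breaker's edges that meet a set of `j` needy vertices, less `b` for
every edge chosen from these vertices, if there are at most `K` needy vertices. -/
noncomputable def dangerBound (μ b K : ℝ) (k j : ℕ) : ℝ :=
  j * (μ + b + K + (K - j) + b * ∑ i ∈ Finset.Ico j k, 1 / ((i : ℝ) + 1))

/-- The number of Breaker's edges that meet `J`, less `b` for every edge that Maker has chosen from
a troublesome vertex of `J`. -/
noncomputable def excess (b : ℕ) (s : State n) (J : Finset (Fin n)) : ℝ :=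
  meet s.B J - b * ∑ x ∈ J, (s.outT x : ℝ)

theorem dangerBound_step {μ b : ℝ} {K j : ℕ} (hj : j < K) :
    (j : ℝ) * ((dangerBound μ b K K (j + 1) + b + j) / (j + 1)) ≤ dangerBound μ b K K j := by
  unfold dangerBound
  rw [Finset.sum_eq_sum_Ico_succ_bot hj]
  generalize ∑ i ∈ Finset.Ico (j + 1) K, 1 / ((i : ℝ) + 1) = t
  push_cast
  refine mul_le_mul_of_nonneg_left ?_ j.cast_nonneg
  rw [div_le_iff₀ (by positivity)]
  have : 1 / ((j : ℝ) + 1) * (j + 1) = 1 := one_div_mul_cancel (by positivity)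
  linear_combination -b * this

theorem dangerBound_add_le_succ {μ b : ℝ} (hb : 0 ≤ b) {K j : ℕ} (hj : j < K) :
    dangerBound μ b K K j + μ ≤ dangerBound μ b K K (j + 1) := by
  unfold dangerBound
  rw [Finset.sum_eq_sum_Ico_succ_bot hj]
  have hS : 0 ≤ ∑ i ∈ Finset.Ico (j + 1) K, 1 / ((i : ℝ) + 1) :=
    Finset.sum_nonneg fun i _ => by positivity
  generalize ∑ i ∈ Finset.Ico (j + 1) K, 1 / ((i : ℝ) + 1) = t at hS
  push_cast
  have h1 : (j : ℝ) * (1 / ((j : ℝ) + 1)) ≤ 1 := by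
    rw [mul_one_div, div_le_one (by positivity)]
    linarith
  have hj' : (j : ℝ) + 1 ≤ K := by exact_mod_cast hj
  have h2 : b * (j * (1 / ((j : ℝ) + 1))) ≤ b := by nlinarith
  have h3 : 0 ≤ b * t := mul_nonneg hb hS
  nlinarith

theorem dangerBound_add_mul_le {μ b : ℝ} (hb : 0 ≤ b) {K i j : ℕ} (hij : i ≤ j) (hj : j ≤ K) :
    dangerBound μ b K K i + ((j : ℝ) - i) * μ ≤ dangerBound μ b K K j := by
  induction j, hij using Nat.le_induction with
  | base => simp
  | succ j hij ih =>
    have h1 := ih (by omega)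
    have h2 := dangerBound_add_le_succ (μ := μ) hb (show j < K by omega)
    push_cast
    linarith

/-- A turn of Breaker adds at most `b` edges, and a vertex that becomes needy was not troublesome
before. -/
theorem excess_le_of_breaker {b K : ℕ} {s s' : State n} {E : SimpleGraph (Fin n)}
    (hB : s'.B = s.B ⊔ E) (hE : E.edgeSet.ncard ≤ b) (hT : s'.outT = s.outT)
    (h : ∀ J : Finset (Fin n), (∀ x ∈ J, s.Needy x) →
      excess b s J ≤ dangerBound (n / √(Real.log n)) b K K J.card)
    {J : Finset (Fin n)} (hJ : ∀ x ∈ J, s'.Needy x) (hJK : J.card ≤ K) :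
    excess b s' J ≤ dangerBound (n / √(Real.log n)) b K K J.card + b := by
  classical
  set J₁ := J.filter fun x => s.Needy x
  set J₂ := J.filter fun x => ¬ s.Needy x
  have hU : J₁ ∪ J₂ = J := Finset.filter_union_filter_not_eq _ _
  have hcard : J₁.card + J₂.card = J.card := Finset.card_filter_add_card_filter_not _
  have h1 := h J₁ fun x hx => (Finset.mem_filter.1 hx).2
  have h2 : (∑ x ∈ J₂, (deg s.B x : ℝ)) ≤ J₂.card * (n / √(Real.log n)) := by
    rw [← nsmul_eq_mul]
    refine Finset.sum_le_card_nsmul _ _ _ fun x hx => ?_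
    obtain ⟨hxJ, hx⟩ := Finset.mem_filter.1 hx
    have hx' := hJ x hxJ
    by_contra hlt
    rw [not_le] at hlt
    exact hx ⟨hlt, hT ▸ hx'.2⟩
  have h3 := meet_union_le s.B J₁ J₂
  rw [hU] at h3
  have h4 := meet_sup_le s.B E J
  rw [← hB] at h4
  have h5 : (meet s'.B J : ℝ) ≤ meet s.B J₁ + ∑ x ∈ J₂, (deg s.B x : ℝ) + b := by
    have : meet s'.B J ≤ meet s.B J₁ + ∑ x ∈ J₂, deg s.B x + b := by omega
    exact_mod_cast this
  have h6 := dangerBound_add_mul_le (μ := n / √(Real.log n)) (b := b) (by positivity)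
    (show J₁.card ≤ J.card by omega) hJK
  have h7 : ((J.card : ℝ) - J₁.card) = J₂.card := by
    rw [← hcard]
    push_cast
    ring
  rw [h7] at h6
  have h8 : ∑ x ∈ J₁, (s.outT x : ℝ) ≤ ∑ x ∈ J, (s.outT x : ℝ) :=
    Finset.sum_le_sum_of_subset_of_nonneg (Finset.filter_subset _ _) fun _ _ _ => by positivity
  have h9 : (b : ℝ) * ∑ x ∈ J₁, (s.outT x : ℝ) ≤ b * ∑ x ∈ J, (s.outT x : ℝ) := by gcongr
  unfold excess at h1 ⊢
  rw [hT]
  linarith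

/-- If Maker chooses an edge from a needy vertex `v` of maximum danger, the bounds are restored: for
a set `J` that does not contain `v`, compare with the set `insert v J`, where the danger of `v`
is at least the average danger in `J`. -/
theorem excess_le_of_maker {b K : ℕ} {s s' : State n} {v : Fin n} (hv : s.Needy v)
    (hmax : ∀ x, s.Needy x → s.danger b x ≤ s.danger b v) (hB : s'.B = s.B)
    (hT : s'.outT = Function.update s.outT v (s.outT v + 1))
    (hK : {x | s.Needy x}.ncard ≤ K)
    (h : ∀ J : Finset (Fin n), (∀ x ∈ J, s.Needy x) →
      excess b s J ≤ dangerBound (n / √(Real.log n)) b K K J.card + b)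
    {J : Finset (Fin n)} (hJ : ∀ x ∈ J, s'.Needy x) :
    excess b s' J ≤ dangerBound (n / √(Real.log n)) b K K J.card := by
  classical
  have hJ' : ∀ x ∈ J, s.Needy x := by
    intro x hx
    obtain ⟨h1, h2⟩ := hJ x hx
    refine ⟨by simpa only [Troublesome, hB] using h1, ?_⟩
    rw [hT, Function.update_apply] at h2
    split_ifs at h2 with hxv
    · subst hxv
      omega
    · exact h2
  by_cases hvJ : v ∈ J
  · have h1 := h J hJ'
    have h2 : ∑ x ∈ J, (s'.outT x : ℝ) = ∑ x ∈ J, (s.outT x : ℝ) + 1 := by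
      rw [← Finset.add_sum_erase J _ hvJ, ← Finset.add_sum_erase J (fun x => (s.outT x : ℝ)) hvJ,
        hT]
      rw [Finset.sum_congr rfl fun x hx => by
        rw [Function.update_of_ne (Finset.ne_of_mem_erase hx)]]
      simp
      ring
    unfold excess at h1 ⊢
    rw [h2, hB]
    linarith
  · rcases J.eq_empty_or_nonempty with rfl | hne
    · simp [excess, meet_empty, dangerBound]
    have hsame : excess b s' J = excess b s J := by
      unfold excess
      rw [hB, hT]
      congr 2
      refine Finset.sum_congr rfl fun x hx => ?_
      rw [Function.update_of_ne]
      rintro rfl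
      exact hvJ hx
    rw [hsame]
    have hins : ∀ x ∈ insert v J, s.Needy x := by
      intro x hx
      rcases Finset.mem_insert.1 hx with rfl | hx
      · exact hv
      · exact hJ' x hx
    have h1 := h (insert v J) hins
    rw [Finset.card_insert_of_notMem hvJ] at h1
    have hjK : J.card < K := by
      have : ((insert v J : Finset (Fin n)) : Set (Fin n)) ⊆ {x | s.Needy x} := fun x hx =>
        hins x hx
      have := Set.ncard_le_ncard this (Set.toFinite _)
      rw [Set.ncard_coe_finset, Finset.card_insert_of_notMem hvJ] at this
      omega
    have h2 : (meet s.B J : ℝ) + deg s.B v ≤ meet s.B (insert v J) + J.card := by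
      exact_mod_cast meet_add_deg_le s.B J hvJ
    set D : ℝ := (deg s.B v : ℝ) - b * s.outT v
    have h3 : excess b s J + D - J.card ≤ excess b s (insert v J) := by
      unfold excess
      rw [Finset.sum_insert hvJ]
      simp only [D]
      linarith
    have h4 : excess b s J ≤ J.card * D := by
      have h5 : ∀ x ∈ J, (deg s.B x : ℝ) - b * s.outT x ≤ D := by
        intro x hx
        have := hmax x (hJ' x hx)
        unfold State.danger at this
        simp only [D]
        exact_mod_cast this
      have h6 := Finset.sum_le_card_nsmul _ _ _ h5
      rw [nsmul_eq_mul, Finset.sum_sub_distrib, ← Finset.mul_sum] at h6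
      have h7 : (meet s.B J : ℝ) ≤ ∑ x ∈ J, (deg s.B x : ℝ) := by
        exact_mod_cast meet_le_sum s.B J
      unfold excess
      linarith
    refine le_trans ?_ (dangerBound_step hjK)
    have hj : (0 : ℝ) < J.card := by exact_mod_cast hne.card_pos
    rw [← mul_div_assoc, le_div_iff₀ (by positivity)]
    nlinarith

/-- The resulting bound for a single vertex. -/
theorem dangerBound_one_le {μ b : ℝ} (hb : 0 ≤ b) {K n : ℕ} (hK : K ≤ n) (hK1 : 1 ≤ K) :
    dangerBound μ b K K 1 ≤ μ + b + 2 * K + b * Real.log n := by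
  unfold dangerBound
  have h1 := harmonic_le_one_add_log K
  have h2 : ((harmonic K : ℚ) : ℝ) = 1 + ∑ i ∈ Finset.Ico 1 K, 1 / ((i : ℝ) + 1) := by
    unfold harmonic
    rw [Finset.range_eq_Ico, Finset.sum_eq_sum_Ico_succ_bot (by omega)]
    push_cast
    simp
  have h3 : Real.log K ≤ Real.log n := Real.log_le_log (by positivity) (by exact_mod_cast hK)
  have h4 : ∑ i ∈ Finset.Ico 1 K, 1 / ((i : ℝ) + 1) ≤ Real.log n := by linarith
  have h5 := mul_le_mul_of_nonneg_left h4 hb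
  push_cast
  linarith

end Danger

/-! ### The structure of positions -/

section Shape

variable {n : ℕ}

open Classical in
/-- The vertices from which the strategy makes random choices: those of `S_i` and, after the first
phase, the endpoints of the paths of the family. -/
noncomputable def State.active (s : State n) : Finset (Fin n) :=
  Finset.univ.filter fun v => v ∈ s.S ∨ (s.phase ≠ Phase.one ∧ s.IsEndpoint v)

theorem State.mem_active {s : State n} {v : Fin n} :
    v ∈ s.active ↔ v ∈ s.S ∨ (s.phase ≠ Phase.one ∧ s.IsEndpoint v) := by
  simp [State.active]

/-- The structure of the positions in the first and second phase. Here `J` is the graph of the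
edges by which paths have been joined in the first phase, and `f w = some v` means that `w` has
been moved to `S_i` when Maker chose the edge `vw` from the needy vertex `v`. -/
structure Shape (S₀ : Finset (Fin n)) (J : SimpleGraph (Fin n)) (f : Fin n → Option (Fin n))
    (s : State n) : Prop where
  sub_S : S₀ ⊆ s.S
  mem_S : ∀ v, s.Troublesome v → v ∈ s.S
  outT_le : ∀ v, s.outT v ≤ s.out v
  J_le : J ≤ s.M
  notMem_of_J : ∀ x y, J.Adj x y → x ∉ S₀
  deg_J : ∀ v, deg J v ≤ 2
  F_eq : s.F = isolate J s.S
  J_of_notMem_active : ∀ x, x ∉ s.active → ∀ y, s.M.Adj x y → J.Adj x y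
  J_of_notMem_S : ∀ x y, x ∉ s.S → y ∉ s.S → s.M.Adj x y → J.Adj x y
  out_le : ∀ x, x ∉ s.active → s.out x ≤ deg J x
  owner : ∀ w v, f w = some v → w ∈ s.S ∧ w ∉ S₀ ∧ s.M.Adj v w ∧ s.Troublesome v
  card_owned : ∀ v, {w | f w = some v}.ncard = min (s.outT v) 10
  cover : ∀ v ∈ s.S, v ∈ S₀ ∨ s.Troublesome v ∨ f v ≠ none
  ends : s.phase ≠ Phase.one →
    ({v | v ∉ s.S ∧ deg J v ≤ 1}.ncard : ℝ) ≤ n / √(Real.log n) + 2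

theorem isolate_isolate (G : SimpleGraph (Fin n)) (S T : Finset (Fin n)) :
    isolate (isolate G S) T = isolate G (S ∪ T) := by
  ext x y
  simp only [isolate, Finset.mem_union]
  tauto

theorem isolate_le (G : SimpleGraph (Fin n)) (S : Finset (Fin n)) : isolate G S ≤ G :=
  fun _ _ h => h.1

theorem active_subset_moveToS (s : State n) (T : Finset (Fin n)) :
    s.active ⊆ (s.moveToS T).active := by
  intro v hv
  rw [State.mem_active] at hv ⊢
  by_cases hT : v ∈ (s.moveToS T).S
  · exact Or.inl hT
  · right
    rcases hv with hv | ⟨hp, hv⟩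
    · exact absurd (Finset.mem_union_left _ hv) hT
    · exact ⟨hp, hT, (deg_mono (isolate_le _ _) v).trans hv.2⟩

theorem active_subset_afterBreaker (s : State n) (E : SimpleGraph (Fin n)) :
    s.active ⊆ (s.afterBreaker E).active := by
  unfold State.afterBreaker
  exact active_subset_moveToS { s with B := s.B ⊔ E } _

theorem State.Troublesome.mono {s s' : State n} (h : s.B ≤ s'.B) {v : Fin n}
    (hv : s.Troublesome v) : s'.Troublesome v := by
  unfold State.Troublesome at hv ⊢
  exact hv.trans_le (by exact_mod_cast deg_mono h v)

theorem afterBreaker_S_subset (s : State n) (E : SimpleGraph (Fin n)) :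
    s.S ⊆ (s.afterBreaker E).S := Finset.subset_union_left

theorem Shape.afterBreaker {S₀ : Finset (Fin n)} {J : SimpleGraph (Fin n)}
    {f : Fin n → Option (Fin n)} {s : State n} (h : Shape S₀ J f s) (E : SimpleGraph (Fin n))
    (X : Finset (Fin n)) : Shape S₀ J f { s.afterBreaker E with P := X } := by
  classical
  have hS : s.S ⊆ (s.afterBreaker E).S := afterBreaker_S_subset s E
  have hact : s.active ⊆ ({ s.afterBreaker E with P := X } : State n).active :=
    active_subset_afterBreaker s E
  have htr : ∀ v, s.Troublesome v → ({ s.afterBreaker E with P := X } : State n).Troublesome v :=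
    fun v hv => Troublesome.mono (s := s) (s' := { s.afterBreaker E with P := X })
      (show s.B ≤ s.B ⊔ E from le_sup_left) hv
  refine ⟨h.sub_S.trans hS, ?_, h.outT_le, h.J_le, h.notMem_of_J, h.deg_J, ?_, ?_, ?_, ?_, ?_,
    h.card_owned, ?_, ?_⟩
  · intro v hv
    by_cases hvS : v ∈ s.S
    · exact hS hvS
    · exact Finset.mem_union_right _ (Finset.mem_filter.2 ⟨Finset.mem_univ _, hvS, hv⟩)
  · change isolate s.F _ = isolate J (s.S ∪ _)
    rw [h.F_eq, isolate_isolate]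
  · exact fun x hx => h.J_of_notMem_active x fun hx' => hx (hact hx')
  · exact fun x y hx hy => h.J_of_notMem_S x y (fun h => hx (hS h)) (fun h => hy (hS h))
  · exact fun x hx => h.out_le x fun hx' => hx (hact hx')
  · intro w v hf
    obtain ⟨h1, h2, h3, h4⟩ := h.owner w v hf
    exact ⟨hS h1, h2, h3, htr v h4⟩
  · intro v hv
    rcases Finset.mem_union.1 hv with hv | hv
    · rcases h.cover v hv with h1 | h1 | h1
      · exact Or.inl h1
      · exact Or.inr (Or.inl (htr v h1))
      · exact Or.inr (Or.inr h1)
    · exact Or.inr (Or.inl (Finset.mem_filter.1 hv).2.2)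
  · intro hp
    refine le_trans ?_ (h.ends hp)
    exact Nat.cast_le.2
      (Set.ncard_le_ncard (fun v hv => ⟨fun h => hv.1 (hS h), hv.2⟩) (Set.toFinite _))

theorem outT_addArc (s : State n) (v w : Fin n) : (s.addArc v w).outT =
    Function.update s.outT v (s.outT v + 1) ∨ ¬ s.Troublesome v ∧ (s.addArc v w).outT = s.outT := by
  unfold State.addArc
  by_cases h : s.Troublesome v <;> simp [h]

theorem le_outT_addArc (s : State n) (v w x : Fin n) : s.outT x ≤ (s.addArc v w).outT x := by
  rcases outT_addArc s v w with h | ⟨-, h⟩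
  · rw [h, Function.update_apply]
    split_ifs with hx
    · rw [hx]
      omega
    · exact le_rfl
  · rw [h]

theorem le_out_addArc (s : State n) (v w x : Fin n) : s.out x ≤ (s.addArc v w).out x := by
  change s.out x ≤ Function.update s.out v (s.out v + 1) x
  rw [Function.update_apply]
  split_ifs with hx
  · rw [hx]
    omega
  · exact le_rfl

theorem outT_le_out_addArc {s : State n} (h : ∀ x, s.outT x ≤ s.out x) (v w x : Fin n) :
    (s.addArc v w).outT x ≤ (s.addArc v w).out x := by
  change _ ≤ Function.update s.out v (s.out v + 1) x
  have hx := h x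
  rcases outT_addArc s v w with h | ⟨-, h⟩
  · rw [h, Function.update_apply, Function.update_apply]
    split_ifs with hxv
    · subst hxv
      omega
    · exact hx
  · rw [h, Function.update_apply]
    split_ifs with hxv
    · subst hxv
      omega
    · exact hx

/-- An edge to `S₀` is chosen from an active vertex which is not needy: this covers the random
choices and the boosters. -/
theorem Shape.addArc {S₀ : Finset (Fin n)} {J : SimpleGraph (Fin n)}
    {f : Fin n → Option (Fin n)} {s : State n} (h : Shape S₀ J f s) {v w : Fin n}
    (hv : v ∈ s.active) (hw : w ∈ S₀) (hT : ¬ s.Needy v) :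
    Shape S₀ J f (s.addArc v w) := by
  have hwS : w ∈ s.S := h.sub_S hw
  have hwa : w ∈ s.active := State.mem_active.2 (Or.inl hwS)
  refine ⟨h.sub_S, h.mem_S, outT_le_out_addArc h.outT_le v w, h.J_le.trans le_sup_left,
    h.notMem_of_J, h.deg_J, h.F_eq, ?_, ?_, ?_, ?_, ?_, h.cover, h.ends⟩
  · intro x hx y hxy
    rcases hxy with hxy | hxy
    · exact h.J_of_notMem_active x hx y hxy
    · rw [SimpleGraph.edge_adj] at hxy
      rcases hxy.1 with ⟨rfl, rfl⟩ | ⟨rfl, rfl⟩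
      · exact absurd hv hx
      · exact absurd hwa hx
  · intro x y hx hy hxy
    rcases hxy with hxy | hxy
    · exact h.J_of_notMem_S x y hx hy hxy
    · rw [SimpleGraph.edge_adj] at hxy
      rcases hxy.1 with ⟨rfl, rfl⟩ | ⟨rfl, rfl⟩
      · exact absurd hwS hy
      · exact absurd hwS hx
  · intro x hx
    change Function.update s.out v (s.out v + 1) x ≤ deg J x
    rw [Function.update_of_ne]
    · exact h.out_le x hx
    · rintro rfl
      exact hx hv
  · intro w' v' hf
    obtain ⟨h1, h2, h3, h4⟩ := h.owner w' v' hf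
    exact ⟨h1, h2, Or.inl h3, h4⟩
  · intro x
    rw [h.card_owned x]
    rcases outT_addArc s v w with h1 | ⟨-, h1⟩
    · by_cases htr : s.Troublesome v
      · rw [h1, Function.update_apply]
        split_ifs with hxv
        · subst hxv
          have : 10 ≤ s.outT x := by
            by_contra hlt
            exact hT ⟨htr, by omega⟩
          omega
        · rfl
      · simp [State.addArc, htr]
    · rw [h1]

/-- An edge is chosen from a needy vertex. -/
theorem Shape.needy {S₀ : Finset (Fin n)} {J : SimpleGraph (Fin n)}
    {f : Fin n → Option (Fin n)} {s : State n} (h : Shape S₀ J f s) {v w : Fin n}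
    (hv : s.Needy v) (hw : w ∉ s.S) (hvw : w ≠ v) :
    Shape S₀ J (Function.update f w (some v)) ((s.addArc v w).moveToS {w}) := by
  classical
  have hS : s.S ⊆ ((s.addArc v w).moveToS {w}).S := Finset.subset_union_left
  have hwS : w ∈ ((s.addArc v w).moveToS {w}).S :=
    Finset.mem_union_right _ (Finset.mem_singleton_self _)
  have hact : s.active ⊆ ((s.addArc v w).moveToS {w}).active :=
    active_subset_moveToS (s.addArc v w) {w}
  have hvS : v ∈ s.S := h.mem_S v hv.1
  have hva : v ∈ ((s.addArc v w).moveToS {w}).active := State.mem_active.2 (Or.inl (hS hvS))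
  have hwa : w ∈ ((s.addArc v w).moveToS {w}).active := State.mem_active.2 (Or.inl hwS)
  have hfw : f w = none := by
    by_contra hne
    obtain ⟨v', hv'⟩ := Option.ne_none_iff_exists'.1 hne
    exact hw (h.owner w v' hv').1
  have houtT : (s.addArc v w).outT = Function.update s.outT v (s.outT v + 1) := by
    simp [State.addArc, hv.1]
  refine ⟨h.sub_S.trans hS, fun x hx => hS (h.mem_S x hx), outT_le_out_addArc h.outT_le v w,
    h.J_le.trans le_sup_left, h.notMem_of_J, h.deg_J, ?_, ?_, ?_, ?_, ?_, ?_, ?_, ?_⟩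
  · change isolate s.F _ = isolate J (s.S ∪ _)
    rw [h.F_eq, isolate_isolate]
  · intro x hx y hxy
    rcases hxy with hxy | hxy
    · exact h.J_of_notMem_active x (fun h => hx (hact h)) y hxy
    · rw [SimpleGraph.edge_adj] at hxy
      rcases hxy.1 with ⟨rfl, rfl⟩ | ⟨rfl, rfl⟩
      · exact absurd hva hx
      · exact absurd hwa hx
  · intro x y hx hy hxy
    rcases hxy with hxy | hxy
    · exact h.J_of_notMem_S x y (fun h => hx (hS h)) (fun h => hy (hS h)) hxy
    · rw [SimpleGraph.edge_adj] at hxy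
      rcases hxy.1 with ⟨rfl, rfl⟩ | ⟨rfl, rfl⟩
      · exact absurd hwS hy
      · exact absurd hwS hx
  · intro x hx
    change Function.update s.out v (s.out v + 1) x ≤ deg J x
    rw [Function.update_of_ne]
    · exact h.out_le x fun h => hx (hact h)
    · rintro rfl
      exact hx hva
  · intro w' v' hf
    rw [Function.update_apply] at hf
    split_ifs at hf with hww
    · obtain rfl : v = v' := Option.some.inj hf
      subst hww
      refine ⟨hwS, fun h' => hw (h.sub_S h'), Or.inr ?_, hv.1⟩
      rw [SimpleGraph.edge_adj]
      exact ⟨Or.inl ⟨rfl, rfl⟩, hvw.symm⟩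
    · obtain ⟨h1, h2, h3, h4⟩ := h.owner w' v' hf
      exact ⟨hS h1, h2, Or.inl h3, h4⟩
  · intro x
    change _ = min ((s.addArc v w).outT x) 10
    rw [houtT, Function.update_apply]
    have hx := h.card_owned x
    split_ifs with hxv
    · subst hxv
      have hset : {w' | Function.update f w (some x) w' = some x} =
          insert w {w' | f w' = some x} := by
        ext w'
        simp only [Set.mem_ofPred_eq, Set.mem_insert_iff, Function.update_apply]
        split_ifs with hww
        · simp [hww]
        · simp [hww]
      rw [hset, Set.ncard_insert_of_notMem (by simp [hfw]) (Set.toFinite _), hx]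
      have := hv.2
      omega
    · rw [← hx]
      congr 1
      ext w'
      simp only [Set.mem_ofPred_eq, Function.update_apply]
      split_ifs with hww
      · subst hww
        simp [hfw, Ne.symm hxv]
      · rfl
  · intro x hx
    rcases Finset.mem_union.1 hx with hx | hx
    · rcases h.cover x hx with h1 | h1 | h1
      · exact Or.inl h1
      · exact Or.inr (Or.inl h1)
      · right; right
        rw [Function.update_apply]
        split_ifs
        · simp
        · exact h1
    · right; right
      rw [Finset.mem_singleton] at hx
      simp [hx]
  · intro hp
    refine le_trans ?_ (h.ends hp)
    exact Nat.cast_le.2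
      (Set.ncard_le_ncard (fun v hv => ⟨fun h => hv.1 (hS h), hv.2⟩) (Set.toFinite _))

theorem Shape.not_adj_of_available {S₀ : Finset (Fin n)} {J : SimpleGraph (Fin n)}
    {f : Fin n → Option (Fin n)} {s : State n} (h : Shape S₀ J f s) {u v : Fin n}
    (huv : s.Available u v) : u ≠ v ∧ ¬ J.Adj u v := by
  obtain ⟨hu, hv, hr, -⟩ := huv
  refine ⟨fun he => hr (he ▸ SimpleGraph.Reachable.refl u), fun hJ => hr ?_⟩
  have : s.F.Adj u v := by
    rw [h.F_eq]
    exact ⟨hJ, hu.1, hv.1⟩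
  exact this.reachable

/-- Two paths of the family are joined in the first phase. -/
theorem Shape.join {S₀ : Finset (Fin n)} {J : SimpleGraph (Fin n)}
    {f : Fin n → Option (Fin n)} {s : State n} (h : Shape S₀ J f s) {u v : Fin n}
    (hp : s.phase = Phase.one) (huv : s.Available u v) :
    Shape S₀ (J ⊔ SimpleGraph.edge u v) f
      { s.addArc u v with F := s.F ⊔ SimpleGraph.edge u v } := by
  obtain ⟨hne, hJuv⟩ := h.not_adj_of_available huv
  obtain ⟨hu, hv, hr, hdu, hdv, -⟩ := huv
  have htu : ¬ s.Troublesome u := fun ht => hu.1 (h.mem_S u ht)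
  have houtT : (s.addArc u v).outT = s.outT := by simp [State.addArc, htu]
  have hact : ∀ x, x ∈ s.active ↔ x ∈ s.S := fun x => by
    rw [State.mem_active]
    simp [hp]
  have hact' : ∀ x, x ∈ ({ s.addArc u v with F := s.F ⊔ SimpleGraph.edge u v } :
      State n).active ↔ x ∈ s.S := fun x => by
    rw [State.mem_active]
    simp [State.addArc, hp]
  refine ⟨h.sub_S, h.mem_S, outT_le_out_addArc h.outT_le u v, sup_le_sup_right h.J_le _,
    ?_, ?_, ?_, ?_, ?_, ?_, ?_, ?_, h.cover, fun h' => absurd hp h'⟩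
  · intro x y hxy
    rcases hxy with hxy | hxy
    · exact h.notMem_of_J x y hxy
    · rw [SimpleGraph.edge_adj] at hxy
      rcases hxy.1 with ⟨rfl, rfl⟩ | ⟨rfl, rfl⟩
      · exact fun h' => hu.1 (h.sub_S h')
      · exact fun h' => hv.1 (h.sub_S h')
  · intro x
    have h1 := deg_sup_le J (SimpleGraph.edge u v) x
    have h2 := deg_edge_le u v x
    by_cases hxu : x = u
    · subst hxu
      have := deg_mono h.J_le x
      omega
    by_cases hxv : x = v
    · subst hxv
      have := deg_mono h.J_le x
      omega
    · rw [deg_edge_eq_zero hxu hxv] at h1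
      have := h.deg_J x
      omega
  · change s.F ⊔ _ = isolate (J ⊔ _) s.S
    rw [h.F_eq]
    ext x y
    simp only [SimpleGraph.sup_adj, isolate, SimpleGraph.edge_adj]
    constructor
    · rintro (⟨h1, h2, h3⟩ | ⟨h1 | h1, h2⟩)
      · exact ⟨Or.inl h1, h2, h3⟩
      · obtain ⟨rfl, rfl⟩ := h1
        exact ⟨Or.inr ⟨Or.inl ⟨rfl, rfl⟩, h2⟩, hu.1, hv.1⟩
      · obtain ⟨rfl, rfl⟩ := h1
        exact ⟨Or.inr ⟨Or.inr ⟨rfl, rfl⟩, h2⟩, hv.1, hu.1⟩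
    · rintro ⟨h1 | h1, h2, h3⟩
      · exact Or.inl ⟨h1, h2, h3⟩
      · exact Or.inr h1
  · intro x hx y hxy
    rw [hact', ← hact] at hx
    exact hxy.imp (h.J_of_notMem_active x hx y) id
  · intro x y hx hy hxy
    exact hxy.imp (h.J_of_notMem_S x y hx hy) id
  · intro x hx
    rw [hact', ← hact] at hx
    change Function.update s.out u (s.out u + 1) x ≤ _
    have hx' := h.out_le x hx
    rw [Function.update_apply]
    split_ifs with hxu
    · subst hxu
      rw [deg_sup_edge_self hne hJuv]
      omega
    · exact hx'.trans (deg_mono le_sup_left x)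
  · intro w' v' hf
    obtain ⟨h1, h2, h3, h4⟩ := h.owner w' v' hf
    exact ⟨h1, h2, Or.inl h3, h4⟩
  · intro x
    change _ = min ((s.addArc u v).outT x) 10
    rw [houtT]
    exact h.card_owned x

/-- If no two paths are available, then the endpoints `v` of paths with `d_M v ≤ 1` span a clique of
Breaker, except for the pairs of endpoints of the same path. As they are not troublesome, there
are few of them. -/
theorem Shape.ncard_ends_le {S₀ : Finset (Fin n)} {J : SimpleGraph (Fin n)}
    {f : Fin n → Option (Fin n)} {s : State n} (h : Shape S₀ J f s) (hp : s.phase = Phase.one)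
    (huv : ∀ u v, ¬ s.Available u v) :
    ({v | v ∉ s.S ∧ deg J v ≤ 1}.ncard : ℝ) ≤ n / √(Real.log n) + 2 := by
  set A := {v | v ∉ s.S ∧ deg J v ≤ 1}
  rcases A.eq_empty_or_nonempty with hA | ⟨u, hu⟩
  · rw [hA, Set.ncard_empty]
    push_cast
    positivity
  have hFJ : s.F ≤ J := by
    rw [h.F_eq]
    exact isolate_le _ _
  have hMJ : ∀ x, x ∉ s.S → deg s.M x ≤ deg J x := by
    intro x hx
    refine Set.ncard_le_ncard (fun y hy => h.J_of_notMem_active x ?_ y hy) (Set.toFinite _)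
    rw [State.mem_active]
    simp [hx, hp]
  have hsub : A ⊆ {v | s.F.Reachable u v ∧ deg s.F v ≤ 1} ∪ s.B.neighborSet u := by
    intro v hv
    by_cases hr : s.F.Reachable u v
    · exact Or.inl ⟨hr, (deg_mono hFJ v).trans hv.2⟩
    · right
      by_contra hB
      exact huv u v ⟨⟨hu.1, (deg_mono hFJ u).trans hu.2⟩, ⟨hv.1, (deg_mono hFJ v).trans hv.2⟩, hr,
        (hMJ u hu.1).trans hu.2, (hMJ v hv.1).trans hv.2, hB⟩
  have h1 := (Set.ncard_le_ncard hsub (Set.toFinite _)).trans (Set.ncard_union_le _ _)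
  have h2 := card_reachable_ends_le (F := s.F) (fun v => (deg_mono hFJ v).trans (h.deg_J v)) u
  have h3 : (deg s.B u : ℝ) ≤ n / √(Real.log n) := by
    by_contra hlt
    exact hu.1 (h.mem_S u (not_le.1 hlt))
  have h4 : A.ncard ≤ deg s.B u + 2 := by
    unfold deg
    omega
  have h5 : (A.ncard : ℝ) ≤ deg s.B u + 2 := by exact_mod_cast h4
  linarith

theorem Shape.toPhaseTwo {S₀ : Finset (Fin n)} {J : SimpleGraph (Fin n)}
    {f : Fin n → Option (Fin n)} {s : State n} (h : Shape S₀ J f s) (hp : s.phase = Phase.one)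
    (huv : ∀ u v, ¬ s.Available u v) (X : Finset (Fin n)) :
    Shape S₀ J f { s with phase := Phase.two, P := X } := by
  have hact : ∀ x, x ∉ ({ s with phase := Phase.two, P := X } : State n).active → x ∉ s.active := by
    intro x hx hx'
    rw [State.mem_active] at hx hx'
    exact hx (Or.inl (hx'.resolve_right fun h => h.1 hp))
  exact ⟨h.sub_S, h.mem_S, h.outT_le, h.J_le, h.notMem_of_J, h.deg_J, h.F_eq,
    fun x hx => h.J_of_notMem_active x (hact x hx), h.J_of_notMem_S,
    fun x hx => h.out_le x (hact x hx), h.owner, h.card_owned, h.cover,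
    fun _ => h.ncard_ends_le hp huv⟩

theorem shape_init (S₀ : Finset (Fin n)) :
    Shape S₀ ⊥ (fun _ => none) (State.init S₀) where
  sub_S := subset_rfl
  mem_S v hv := by
    unfold State.Troublesome at hv
    rw [State.init, deg_bot, Nat.cast_zero] at hv
    exact absurd hv (not_lt.2 (by positivity))
  outT_le _ := le_rfl
  J_le := le_rfl
  notMem_of_J _ _ h := h.elim
  deg_J v := by simp [deg_bot]
  F_eq := by
    ext x y
    simp [State.init, isolate]
  J_of_notMem_active _ _ _ h := h
  J_of_notMem_S _ _ _ _ h := h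
  out_le _ _ := Nat.zero_le _
  owner _ _ h := by simp at h
  card_owned v := by simp [State.init]
  cover v hv := Or.inl hv
  ends h := absurd rfl h

end Shape

/-! ### Counting rounds, troublesome vertices and active vertices -/

section Count

variable {n : ℕ}

/-- The inequalities between the number `n` of vertices, the bias `b` and the size `m` of `S₀` that
the argument needs; they hold for large `n`, if `b ≤ n / ln n - 10000 n / (ln n) ^ (3 / 2)` and
`m = ⌈2000 n / √(ln n)⌉`. -/
structure Large (n b m : ℕ) : Prop where
  le_μ : 1000 ≤ (n : ℝ) / √(Real.log n)
  μ_le : 1000000 * ((n : ℝ) / √(Real.log n)) ≤ n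
  b_mul_le : (b : ℝ) * n ≤ ((n : ℝ) / √(Real.log n)) ^ 2
  b_log_le : (b : ℝ) * Real.log n + 10000 * ((n : ℝ) / √(Real.log n)) ≤ n
  le_m : 2000 * ((n : ℝ) / √(Real.log n)) ≤ m
  m_le : (m : ℝ) ≤ 2000 * ((n : ℝ) / √(Real.log n)) + 1

theorem Large.b_le {b m : ℕ} (h : Large n b m) : (b : ℝ) ≤ (n : ℝ) / √(Real.log n) := by
  have h1 := h.le_μ
  have h2 := h.μ_le
  have h3 := h.b_mul_le
  nlinarith

/-- The number of rounds that have been played is bounded in terms of the position. The first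
summand counts the rounds in which paths were joined, `o` the rounds in which a booster was chosen,
and the sums the random choices and the choices from needy vertices. A booster closes a cycle on
`V(P_i)`, and the path must grow before the next one is chosen. -/
structure Count (k o : ℕ) (J : SimpleGraph (Fin n)) (s : State n) : Prop where
  rounds : k ≤ J.edgeSet.ncard + o + ∑ v ∈ s.active, min (s.out v) 10 + ∑ v, min (s.outT v) 10
  boost_one : s.phase = Phase.one → o = 0
  boost_cycle : s.phase = Phase.two → HasCycleOn s.M s.P → o ≤ s.P.card
  boost_noCycle : s.phase = Phase.two → ¬ HasCycleOn s.M s.P → o + 1 ≤ s.P.card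
  meets : s.phase = Phase.two → ∃ x ∈ s.P, x ∈ s.S

theorem HasCycleOn.mono {G H : SimpleGraph (Fin n)} (h : G ≤ H) {X : Finset (Fin n)}
    (hG : HasCycleOn G X) : HasCycleOn H X := by
  obtain ⟨u, p, hp, hX⟩ := hG
  exact ⟨u, p.mapLe h, hp.mapLe h, by simpa using hX⟩

theorem HasPathOn.mono {G H : SimpleGraph (Fin n)} (h : G ≤ H) {X : Finset (Fin n)}
    {u v : Fin n} (hG : HasPathOn G X u v) : HasPathOn H X u v := by
  obtain ⟨p, hp, hX⟩ := hG
  exact ⟨p.mapLe h, hp.mapLe h, by simpa using hX⟩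

/-- The number of troublesome vertices. -/
noncomputable def State.numTrouble (s : State n) : ℕ := {v | s.Troublesome v}.ncard

theorem numTrouble_mul_le (s : State n) :
    (s.numTrouble : ℝ) * (n / √(Real.log n)) ≤ 2 * s.B.edgeSet.ncard := by
  classical
  have h1 : s.numTrouble = (Finset.univ.filter fun v => s.Troublesome v).card := by
    unfold State.numTrouble
    rw [← Set.ncard_coe_finset]
    simp
  have h2 : ((Finset.univ.filter fun v => s.Troublesome v).card : ℝ) * (n / √(Real.log n)) ≤
      ∑ v ∈ Finset.univ.filter fun v => s.Troublesome v, (deg s.B v : ℝ) := by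
    rw [← nsmul_eq_mul]
    exact Finset.card_nsmul_le_sum _ _ _ fun v hv => (Finset.mem_filter.1 hv).2.le
  have h3 : ∑ v ∈ Finset.univ.filter fun v => s.Troublesome v, (deg s.B v : ℝ) ≤
      ∑ v, (deg s.B v : ℝ) :=
    Finset.sum_le_sum_of_subset_of_nonneg (Finset.subset_univ _) fun _ _ _ => by positivity
  have h4 : ∑ v, (deg s.B v : ℝ) = 2 * s.B.edgeSet.ncard := by exact_mod_cast sum_deg_eq s.B
  rw [h1]
  linarith

theorem Large.numTrouble_mul_le {b m : ℕ} (hL : Large n b m) {s : State n} {k : ℕ}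
    (hB : s.B.edgeSet.ncard ≤ b * k) :
    (s.numTrouble : ℝ) * n ≤ 2 * (n / √(Real.log n)) * k := by
  have h1 := MakerBreaker.numTrouble_mul_le s
  have h2 : (s.B.edgeSet.ncard : ℝ) ≤ b * k := by exact_mod_cast hB
  have h3 := hL.b_mul_le
  have hμ : 0 < (n : ℝ) / √(Real.log n) := by linarith [hL.le_μ]
  have hn : (0 : ℝ) ≤ n := by positivity
  have hk : (0 : ℝ) ≤ k := by positivity
  set μ := (n : ℝ) / √(Real.log n)
  have h4 : (s.numTrouble : ℝ) * μ * n ≤ 2 * (b * k) * n :=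
    mul_le_mul_of_nonneg_right (by linarith) hn
  have h5 : (b : ℝ) * n * k ≤ μ ^ 2 * k := by gcongr
  have h6 : (s.numTrouble : ℝ) * n * μ ≤ 2 * μ * k * μ := by nlinarith
  exact le_of_mul_le_mul_right h6 hμ

theorem Shape.card_owned_le {S₀ : Finset (Fin n)} {J : SimpleGraph (Fin n)}
    {f : Fin n → Option (Fin n)} {s : State n} (h : Shape S₀ J f s) :
    {w | f w ≠ none}.ncard ≤ 10 * s.numTrouble := by
  classical
  have h1 : {w | f w ≠ none} ⊆ ⋃ v ∈ (Set.toFinite {v | s.Troublesome v}).toFinset,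
      {w | f w = some v} := by
    intro w hw
    obtain ⟨v, hv⟩ := Option.ne_none_iff_exists'.1 hw
    simp only [Set.mem_iUnion]
    exact ⟨v, by simpa using (h.owner w v hv).2.2.2, hv⟩
  refine (Set.ncard_le_ncard h1 (Set.toFinite _)).trans ?_
  refine (Finset.set_ncard_biUnion_le _ _).trans ?_
  refine (Finset.sum_le_card_nsmul _ _ 10 fun v _ => ?_).trans ?_
  · rw [h.card_owned]
    exact min_le_right _ _
  · rw [smul_eq_mul, mul_comm, State.numTrouble, Set.ncard_eq_toFinset_card _ (Set.toFinite _)]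

theorem Shape.sum_outT_le {S₀ : Finset (Fin n)} {J : SimpleGraph (Fin n)}
    {f : Fin n → Option (Fin n)} {s : State n} (h : Shape S₀ J f s) :
    ∑ v, min (s.outT v) 10 ≤ 10 * s.numTrouble := by
  classical
  have h1 : ∀ v, v ∉ (Set.toFinite {v | s.Troublesome v}).toFinset → min (s.outT v) 10 = 0 := by
    intro v hv
    rw [← h.card_owned, Set.ncard_eq_zero (Set.toFinite _), Set.eq_empty_iff_forall_notMem]
    intro w hw
    exact hv (by simpa using (h.owner w v hw).2.2.2)
  rw [← Finset.sum_subset (Finset.subset_univ (Set.toFinite {v | s.Troublesome v}).toFinset)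
    fun v _ hv => h1 v hv]
  refine (Finset.sum_le_card_nsmul _ _ 10 fun v _ => min_le_right _ _).trans ?_
  rw [smul_eq_mul, mul_comm, State.numTrouble, Set.ncard_eq_toFinset_card _ (Set.toFinite _)]

theorem Shape.card_sdiff_le {S₀ : Finset (Fin n)} {J : SimpleGraph (Fin n)}
    {f : Fin n → Option (Fin n)} {s : State n} (h : Shape S₀ J f s) :
    (s.S \ S₀).card ≤ 11 * s.numTrouble := by
  have h1 : ((s.S \ S₀ : Finset (Fin n)) : Set (Fin n)) ⊆
      {v | s.Troublesome v} ∪ {w | f w ≠ none} := by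
    intro v hv
    simp only [Finset.coe_sdiff, Set.mem_sdiff, Finset.mem_coe] at hv
    rcases h.cover v hv.1 with h1 | h1 | h1
    · exact absurd h1 hv.2
    · exact Or.inl h1
    · exact Or.inr h1
  have h2 := (Set.ncard_le_ncard h1 (Set.toFinite _)).trans (Set.ncard_union_le _ _)
  rw [Set.ncard_coe_finset] at h2
  have h3 := h.card_owned_le
  unfold State.numTrouble at h3 ⊢
  omega

/-- An endpoint of a path of the family is an endpoint of a path at the end of the first phase, or
one of its neighbours on such a path has been moved to `S_i`. -/
theorem Shape.card_active_sdiff_le {S₀ : Finset (Fin n)} {J : SimpleGraph (Fin n)}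
    {f : Fin n → Option (Fin n)} {s : State n} (h : Shape S₀ J f s) :
    ((s.active \ S₀).card : ℝ) ≤ 33 * s.numTrouble + n / √(Real.log n) + 2 := by
  classical
  have h1 := h.card_sdiff_le
  by_cases hp : s.phase = Phase.one
  · have h2 : s.active = s.S := by
      ext v
      rw [State.mem_active]
      simp [hp]
    have h3 : ((s.S \ S₀).card : ℝ) ≤ 11 * s.numTrouble := by exact_mod_cast h1
    rw [h2]
    have : 0 ≤ (n : ℝ) / √(Real.log n) := by positivity
    have : (0 : ℝ) ≤ s.numTrouble := by positivity
    linarith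
  · have h2 : ((s.active \ S₀ : Finset (Fin n)) : Set (Fin n)) ⊆ (s.S \ S₀ : Finset (Fin n)) ∪
        ({v | v ∉ s.S ∧ deg J v ≤ 1} ∪ ⋃ y ∈ s.S \ S₀, J.neighborSet y) := by
      intro v hv
      simp only [Finset.coe_sdiff, Set.mem_sdiff, Finset.mem_coe, State.mem_active] at hv
      obtain ⟨hv | ⟨-, hvS, hd⟩, hv₀⟩ := hv
      · exact Or.inl (by simp [hv, hv₀])
      · right
        by_cases hJ : deg J v ≤ 1
        · exact Or.inl ⟨hvS, hJ⟩
        · right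
          have h3 : ¬ J.neighborSet v ⊆ s.F.neighborSet v := by
            intro hsub
            have := Set.ncard_le_ncard hsub (Set.toFinite _)
            unfold deg at hd hJ
            omega
          obtain ⟨y, hy, hyF⟩ := Set.not_subset.1 h3
          have hyS : y ∈ s.S := by
            by_contra hyS
            refine hyF ?_
            rw [SimpleGraph.mem_neighborSet, h.F_eq]
            exact ⟨hy, hvS, hyS⟩
          simp only [Set.mem_iUnion]
          have hyv : J.Adj y v := SimpleGraph.Adj.symm hy
          exact ⟨y, Finset.mem_sdiff.2 ⟨hyS, h.notMem_of_J y v hyv⟩, hyv⟩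
    have h3 := (Set.ncard_le_ncard h2 (Set.toFinite _)).trans (Set.ncard_union_le _ _)
    have h4 := Set.ncard_union_le {v | v ∉ s.S ∧ deg J v ≤ 1} (⋃ y ∈ s.S \ S₀, J.neighborSet y)
    have h5 : (⋃ y ∈ s.S \ S₀, J.neighborSet y).ncard ≤ 2 * (s.S \ S₀).card := by
      refine (Finset.set_ncard_biUnion_le _ _).trans ?_
      refine (Finset.sum_le_card_nsmul _ _ 2 fun v _ => h.deg_J v).trans ?_
      rw [smul_eq_mul, mul_comm]
    rw [Set.ncard_coe_finset, Set.ncard_coe_finset] at h3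
    have h6 : (s.active \ S₀).card ≤ 33 * s.numTrouble + {v | v ∉ s.S ∧ deg J v ≤ 1}.ncard := by
      omega
    have h7 := h.ends hp
    have h8 : ((s.active \ S₀).card : ℝ) ≤
        33 * s.numTrouble + {v | v ∉ s.S ∧ deg J v ≤ 1}.ncard := by exact_mod_cast h6
    linarith

theorem Shape.card_active_le {S₀ : Finset (Fin n)} {J : SimpleGraph (Fin n)}
    {f : Fin n → Option (Fin n)} {s : State n} (h : Shape S₀ J f s) :
    (s.active.card : ℝ) ≤ S₀.card + 33 * s.numTrouble + n / √(Real.log n) + 2 := by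
  have h1 := h.card_active_sdiff_le
  have h2 : s.active.card ≤ (s.active \ S₀).card + S₀.card := by
    rw [← Finset.card_sdiff_add_card_inter s.active S₀]
    gcongr
    exact Finset.inter_subset_right
  have h3 : (s.active.card : ℝ) ≤ (s.active \ S₀).card + S₀.card := by exact_mod_cast h2
  linarith

theorem ncard_edgeSet_le {J : SimpleGraph (Fin n)} (h : ∀ v, deg J v ≤ 2) :
    J.edgeSet.ncard ≤ n := by
  have h1 := sum_deg_eq J
  have h2 := Finset.sum_le_card_nsmul Finset.univ (fun v => deg J v) 2 fun v _ => h v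
  rw [Finset.card_univ, Fintype.card_fin, smul_eq_mul] at h2
  omega

/-- The phases take at most about `2 n` rounds: at most `n` joins, at most `n` boosters, and the
other rounds are few. Their number is bounded in terms of the number of troublesome vertices, and
hence by a small multiple of `k`. -/
theorem Count.le {b : ℕ} {S₀ : Finset (Fin n)} (hL : Large n b S₀.card) {k o : ℕ}
    {J : SimpleGraph (Fin n)} {f : Fin n → Option (Fin n)} {s : State n} (h : Shape S₀ J f s)
    (hc : Count k o J s) (hp : s.phase = Phase.one ∨ s.phase = Phase.two)
    (hB : s.B.edgeSet.ncard ≤ b * k) : ((k : ℝ) + 1) ≤ 2.1 * n := by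
  have h1 := hc.rounds
  have h2 := ncard_edgeSet_le h.deg_J
  have h3 : o ≤ n := by
    rcases hp with hp | hp
    · rw [hc.boost_one hp]
      exact Nat.zero_le _
    · have hPn : s.P.card ≤ n := by simpa using s.P.card_le_univ
      by_cases hcyc : HasCycleOn s.M s.P
      · exact (hc.boost_cycle hp hcyc).trans hPn
      · have := hc.boost_noCycle hp hcyc
        omega
  have h4 : ∑ v ∈ s.active, min (s.out v) 10 ≤ 10 * s.active.card := by
    refine (Finset.sum_le_card_nsmul _ _ 10 fun v _ => min_le_right _ _).trans ?_
    rw [smul_eq_mul, mul_comm]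
  have h5 := h.sum_outT_le
  have h6 := h.card_active_le
  have h7 : (k : ℝ) ≤ n + n + 10 * s.active.card + 10 * s.numTrouble := by
    have : k ≤ n + n + 10 * s.active.card + 10 * s.numTrouble := by omega
    exact_mod_cast this
  have h8 := hL.numTrouble_mul_le hB
  have h9 := hL.le_μ
  have h10 := hL.μ_le
  have h11 := hL.m_le
  set μ := (n : ℝ) / √(Real.log n)
  have hn : (0 : ℝ) < n := by linarith
  have hk : (0 : ℝ) ≤ k := by positivity
  have h12 : 1000000 * ((s.numTrouble : ℝ) * n) ≤ 2 * k * n := by nlinarith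
  have h13 : 1000000 * (s.numTrouble : ℝ) ≤ 2 * k := by
    refine le_of_mul_le_mul_right ?_ hn
    linarith
  linarith

theorem Large.numTrouble_le {b m : ℕ} (hL : Large n b m) {s : State n} {k : ℕ}
    (hB : s.B.edgeSet.ncard ≤ b * (k + 1)) (hk : ((k : ℝ) + 1) ≤ 2.1 * n) :
    (s.numTrouble : ℝ) ≤ 4.2 * (n / √(Real.log n)) := by
  have h1 := hL.numTrouble_mul_le hB
  have h9 := hL.le_μ
  have h10 := hL.μ_le
  set μ := (n : ℝ) / √(Real.log n)
  have hn : (0 : ℝ) < n := by linarith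
  refine le_of_mul_le_mul_right ?_ hn
  push_cast at h1
  nlinarith

end Count

/-! ### The turns of Breaker and the moves of Maker -/

section Moves

variable {n : ℕ}

/-- A bound on the number of needy vertices: there are at most `4.2 n / √(ln n)` troublesome
vertices. -/
noncomputable def needyBound (n : ℕ) : ℕ := ⌈4.2 * ((n : ℝ) / √(Real.log n))⌉₊

/-- The properties of the position after `k` rounds, while the first two phases last. -/
def Inv (b : ℕ) (S₀ : Finset (Fin n)) (k : ℕ) (s : State n) : Prop :=
  (∃ J f o, Shape S₀ J f s ∧ Count k o J s) ∧ s.B.edgeSet.ncard ≤ b * k ∧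
    (s.phase = Phase.one ∨ s.phase = Phase.two) ∧
    ∀ T : Finset (Fin n), (∀ x ∈ T, s.Needy x) → excess b s T ≤
      dangerBound (n / √(Real.log n)) b (needyBound n) (needyBound n) T.card

/-- The properties of the position between Breaker's turn and Maker's move after `k` rounds. -/
structure Mid (b : ℕ) (S₀ : Finset (Fin n)) (k : ℕ) (s : State n) : Prop where
  shape : ∃ J f o, Shape S₀ J f s ∧ Count k o J s
  card_B : s.B.edgeSet.ncard ≤ b * (k + 1)
  le : ((k : ℝ) + 1) ≤ 2.1 * n
  phase : s.phase = Phase.one ∨ s.phase = Phase.two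
  excess_le : ∀ T : Finset (Fin n), (∀ x ∈ T, s.Needy x) → excess b s T ≤
      dangerBound (n / √(Real.log n)) b (needyBound n) (needyBound n) T.card + b
  path : s.phase = Phase.two → IsPathSet s.M s.P
  maximal : s.phase = Phase.two → ∀ Y, IsPathSet s.M Y → s.P ⊆ Y → Y.card ≤ s.P.card

theorem Large.card_needy_le {b m : ℕ} (hL : Large n b m) {s : State n} {k : ℕ}
    (hB : s.B.edgeSet.ncard ≤ b * (k + 1)) (hk : ((k : ℝ) + 1) ≤ 2.1 * n) :
    {x | s.Needy x}.ncard ≤ needyBound n := by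
  have h1 := hL.numTrouble_le hB hk
  have h2 : {x | s.Needy x}.ncard ≤ s.numTrouble :=
    Set.ncard_le_ncard (fun x hx => hx.1) (Set.toFinite _)
  refine h2.trans ?_
  exact_mod_cast h1.trans (Nat.le_ceil _)

theorem inv_init (b : ℕ) (S₀ : Finset (Fin n)) : Inv b S₀ 0 (State.init S₀) := by
  refine ⟨⟨⊥, _, 0, shape_init S₀, ⟨Nat.zero_le _, fun _ => rfl, ?_, ?_, ?_⟩⟩, ?_, Or.inl rfl, ?_⟩
  · intro h
    cases h
  · intro h
    cases h
  · intro h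
    cases h
  · simp [State.init]
  · intro T hT
    have : T = ∅ := by
      rw [Finset.eq_empty_iff_forall_notMem]
      intro x hx
      have := (shape_init S₀).mem_S x (hT x hx).1
      have h1 := (hT x hx).1
      unfold State.Troublesome at h1
      rw [State.init, deg_bot, Nat.cast_zero] at h1
      exact absurd h1 (not_lt.2 (by positivity))
    subst this
    simp [excess, meet_empty, dangerBound]

/-- Breaker's turn. In the second phase, the path is replaced by a longest one. -/
theorem Inv.afterBreaker {b : ℕ} {S₀ : Finset (Fin n)} (hL : Large n b S₀.card) {k : ℕ}
    {s : State n} (h : Inv b S₀ k s) {E : SimpleGraph (Fin n)} (hE : E.edgeSet.ncard ≤ b)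
    {X : Finset (Fin n)}
    (hX : s.phase = Phase.two → IsLongestPathSet s.M (fun Y => s.P ⊆ Y) X) :
    Mid b S₀ k { s.afterBreaker E with P := X } := by
  obtain ⟨⟨J, f, o, hs, hc⟩, hB, hp, hd⟩ := h
  have hk := hc.le hL hs hp hB
  have hB' : ({ s.afterBreaker E with P := X } : State n).B.edgeSet.ncard ≤ b * (k + 1) := by
    change (s.B ⊔ E).edgeSet.ncard ≤ _
    rw [SimpleGraph.edgeSet_sup]
    have := Set.ncard_union_le s.B.edgeSet E.edgeSet
    rw [mul_add]
    omega
  refine ⟨⟨J, f, o, hs.afterBreaker E X, ?_⟩, hB', hk, hp, ?_, fun h => (hX h).1, ?_⟩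
  · refine ⟨hc.rounds.trans ?_, hc.boost_one, ?_, ?_, ?_⟩
    · change _ ≤ J.edgeSet.ncard + o + ∑ v ∈ (s.afterBreaker E).active, min (s.out v) 10 +
        ∑ v, min (s.outT v) 10
      have := Finset.sum_le_sum_of_subset (f := fun v => min (s.out v) 10)
        (active_subset_afterBreaker s E)
      omega
    · intro h2 hcyc
      obtain ⟨-, hPX, -⟩ := hX h2
      have h3 := Finset.card_le_card hPX
      by_cases hcyc' : HasCycleOn s.M s.P
      · exact (hc.boost_cycle h2 hcyc').trans h3
      · have := hc.boost_noCycle h2 hcyc'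
        change _ ≤ X.card
        omega
    · intro h2 hcyc
      obtain ⟨-, hPX, -⟩ := hX h2
      have h3 := Finset.card_le_card hPX
      by_cases hcyc' : HasCycleOn s.M s.P
      · have h4 := hc.boost_cycle h2 hcyc'
        have h5 : s.P.card ≠ X.card := by
          intro h5
          rw [Finset.eq_of_subset_of_card_le hPX h5.ge] at hcyc'
          exact hcyc hcyc'
        change _ ≤ X.card
        omega
      · exact (hc.boost_noCycle h2 hcyc').trans h3
    · intro h2
      obtain ⟨x, hx, hxS⟩ := hc.meets h2
      exact ⟨x, (hX h2).2.1 hx, afterBreaker_S_subset s E hxS⟩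
  · intro T hT
    refine excess_le_of_breaker (s := s) (s' := { s.afterBreaker E with P := X }) (E := E)
      rfl hE rfl hd hT ?_
    refine le_trans ?_ (hL.card_needy_le hB' hk)
    rw [← Set.ncard_coe_finset]
    exact Set.ncard_le_ncard (fun x hx => hT x hx) (Set.toFinite _)
  · intro h2 Y hY hXY
    exact (hX h2).2.2 Y hY ((hX h2).2.1.trans hXY)

/-- The change to the second phase. -/
theorem Mid.toPhaseTwo {b : ℕ} {S₀ : Finset (Fin n)} {k : ℕ} {s : State n} (h : Mid b S₀ k s)
    (hp : s.phase = Phase.one) (huv : ∀ u v, ¬ s.Available u v) {X : Finset (Fin n)}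
    (hX : IsLongestPathSet s.M (fun Y => ∃ x ∈ Y, x ∈ s.S) X) :
    Mid b S₀ k { s with phase := Phase.two, P := X } := by
  obtain ⟨J, f, o, hs, hc⟩ := h.shape
  have ho := hc.boost_one hp
  subst ho
  have hact : s.active ⊆ ({ s with phase := Phase.two, P := X } : State n).active := by
    intro v hv
    rw [State.mem_active] at hv ⊢
    exact Or.inl (hv.resolve_right fun h => h.1 hp)
  have hX1 : 0 + 1 ≤ X.card := by
    obtain ⟨x, hx, -⟩ := hX.2.1
    exact Finset.card_pos.2 ⟨x, hx⟩
  refine ⟨⟨J, f, 0, hs.toPhaseTwo hp huv X, ?_⟩, h.card_B, h.le, Or.inr rfl, h.excess_le,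
    fun _ => hX.1, ?_⟩
  · refine ⟨hc.rounds.trans ?_, fun _ => rfl, fun _ _ => Nat.zero_le _, fun _ _ => hX1,
      fun _ => hX.2.1⟩
    have := Finset.sum_le_sum_of_subset (f := fun v => min (s.out v) 10) hact
    change _ ≤ J.edgeSet.ncard + 0 +
      ∑ v ∈ ({ s with phase := Phase.two, P := X } : State n).active, min (s.out v) 10 +
        ∑ v, min (s.outT v) 10
    omega
  · intro _ Y hY hXY
    obtain ⟨x, hx, hxS⟩ := hX.2.1
    exact hX.2.2 Y hY ⟨x, hXY hx, hxS⟩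

theorem sum_min_lt {ι : Type*} {t : Finset ι} {g g' : ι → ℕ} (h : ∀ i ∈ t, g i ≤ g' i) {j : ι}
    (hj : j ∈ t) (hlt : g j < 10) (hj' : g j + 1 ≤ g' j) :
    ∑ i ∈ t, min (g i) 10 + 1 ≤ ∑ i ∈ t, min (g' i) 10 := by
  refine Nat.succ_le_of_lt (Finset.sum_lt_sum (fun i hi => min_le_min_right _ (h i hi)) ⟨j, hj, ?_⟩)
  omega

theorem sum_min_le {ι : Type*} {t t' : Finset ι} (ht : t ⊆ t') {g g' : ι → ℕ}
    (h : ∀ i, g i ≤ g' i) : ∑ i ∈ t, min (g i) 10 ≤ ∑ i ∈ t', min (g' i) 10 :=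
  (Finset.sum_le_sum fun i _ => min_le_min_right _ (h i)).trans (Finset.sum_le_sum_of_subset ht)

/-- A move of Maker that changes neither the number of boosters nor the path. -/
theorem Count.of_move {k k' o : ℕ} {J J' : SimpleGraph (Fin n)} {s s' : State n}
    (hc : Count k o J s) (hphase : s'.phase = s.phase) (hM : s.M ≤ s'.M) (hP : s'.P = s.P)
    (hS : s.S ⊆ s'.S)
    (hk : k' ≤ J'.edgeSet.ncard + o + ∑ v ∈ s'.active, min (s'.out v) 10 +
      ∑ v, min (s'.outT v) 10) : Count k' o J' s' := by
  refine ⟨hk, fun h => hc.boost_one (hphase ▸ h), fun h _ => ?_, fun h hn => ?_, fun h => ?_⟩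
  · rw [hphase] at h
    rw [hP]
    by_cases hcyc : HasCycleOn s.M s.P
    · exact hc.boost_cycle h hcyc
    · have := hc.boost_noCycle h hcyc
      omega
  · rw [hP] at hn ⊢
    exact hc.boost_noCycle (hphase ▸ h) fun h => hn (h.mono hM)
  · obtain ⟨x, hx, hxS⟩ := hc.meets (hphase ▸ h)
    exact ⟨x, hP ▸ hx, hS hxS⟩

/-- Without needy vertices there is nothing to prove about their danger. -/
theorem excess_le_of_forall_not_needy {b : ℕ} {s : State n} (h : ∀ v, ¬ s.Needy v)
    (T : Finset (Fin n)) (hT : ∀ x ∈ T, s.Needy x) : excess b s T ≤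
      dangerBound (n / √(Real.log n)) b (needyBound n) (needyBound n) T.card := by
  have : T = ∅ := Finset.eq_empty_iff_forall_notMem.2 fun x hx => h x (hT x hx)
  subst this
  simp [excess, meet_empty, dangerBound]

theorem not_needy_addArc {s : State n} (h : ∀ x, ¬ s.Needy x) (v w x : Fin n) :
    ¬ (s.addArc v w).Needy x :=
  fun hx => h x ⟨hx.1, (le_outT_addArc s v w x).trans_lt hx.2⟩

/-- Case 2 of the strategy. -/
theorem Mid.needy {b : ℕ} {S₀ : Finset (Fin n)} (hL : Large n b S₀.card) {k : ℕ} {s : State n}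
    (h : Mid b S₀ k s) {v w : Fin n} (hv : s.Needy v)
    (hmax : ∀ x, s.Needy x → s.danger b x ≤ s.danger b v) (hw : w ∉ s.S) (hvw : w ≠ v) :
    Inv b S₀ (k + 1) ((s.addArc v w).moveToS {w}) := by
  obtain ⟨J, f, o, hs, hc⟩ := h.shape
  have houtT : (s.addArc v w).outT = Function.update s.outT v (s.outT v + 1) := by
    simp [State.addArc, hv.1]
  refine ⟨⟨J, _, o, hs.needy hv hw hvw, hc.of_move rfl le_sup_left rfl Finset.subset_union_left ?_⟩,
    h.card_B, h.phase, fun T hT => ?_⟩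
  · have h1 := hc.rounds
    have h2 := sum_min_le (t := s.active) (t' := ((s.addArc v w).moveToS {w}).active)
      (active_subset_moveToS (s.addArc v w) {w}) (le_out_addArc s v w)
    have h3 := sum_min_lt (t := Finset.univ) (fun x _ => le_outT_addArc s v w x)
      (Finset.mem_univ v) hv.2 (by simp [houtT])
    change k + 1 ≤ J.edgeSet.ncard + o +
      ∑ v' ∈ ((s.addArc v w).moveToS {w}).active, min ((s.addArc v w).out v') 10 +
        ∑ x, min ((s.addArc v w).outT x) 10
    omega
  · exact excess_le_of_maker (s' := (s.addArc v w).moveToS {w}) hv hmax rfl houtT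
      (hL.card_needy_le h.card_B h.le) h.excess_le hT

/-- A random choice. -/
theorem Mid.addArc {b : ℕ} {S₀ : Finset (Fin n)} {k : ℕ} {s : State n} (h : Mid b S₀ k s)
    (hn : ∀ x, ¬ s.Needy x) {v w : Fin n} (hv : v ∈ s.active) (hout : s.out v < 10)
    (hw : w ∈ S₀) : Inv b S₀ (k + 1) (s.addArc v w) := by
  obtain ⟨J, f, o, hs, hc⟩ := h.shape
  refine ⟨⟨J, f, o, hs.addArc hv hw (hn v), hc.of_move rfl le_sup_left rfl subset_rfl ?_⟩,
    h.card_B, h.phase, fun T hT => ?_⟩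
  · have h1 := hc.rounds
    have h2 := sum_min_le (subset_refl Finset.univ) (le_outT_addArc s v w)
    have h3 := sum_min_lt (t := s.active) (fun x _ => le_out_addArc s v w x)
      hv hout (by simp [State.addArc])
    change k + 1 ≤ J.edgeSet.ncard + o + ∑ v' ∈ s.active, min ((s.addArc v w).out v') 10 +
        ∑ x, min ((s.addArc v w).outT x) 10
    omega
  · exact excess_le_of_forall_not_needy (not_needy_addArc hn v w) T hT

/-- Two paths are joined. -/
theorem Mid.join {b : ℕ} {S₀ : Finset (Fin n)} {k : ℕ} {s : State n} (h : Mid b S₀ k s)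
    (hn : ∀ x, ¬ s.Needy x) {u v : Fin n} (hp : s.phase = Phase.one) (huv : s.Available u v) :
    Inv b S₀ (k + 1) { s.addArc u v with F := s.F ⊔ SimpleGraph.edge u v } := by
  obtain ⟨J, f, o, hs, hc⟩ := h.shape
  obtain ⟨hne, hJuv⟩ := hs.not_adj_of_available huv
  refine ⟨⟨_, f, o, hs.join hp huv, hc.of_move rfl le_sup_left rfl subset_rfl ?_⟩,
    h.card_B, h.phase, fun T hT => ?_⟩
  · have h1 := hc.rounds
    have hact : s.active ⊆
        ({ s.addArc u v with F := s.F ⊔ SimpleGraph.edge u v } : State n).active := by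
      intro x hx
      rw [State.mem_active] at hx ⊢
      exact Or.inl (hx.resolve_right fun h => h.1 hp)
    have h2 := sum_min_le (subset_refl Finset.univ) (le_outT_addArc s u v)
    have h3 := sum_min_le hact (le_out_addArc s u v)
    have h4 : J.edgeSet.ncard + 1 ≤ (J ⊔ SimpleGraph.edge u v).edgeSet.ncard := by
      rw [SimpleGraph.edgeSet_sup, SimpleGraph.edgeSet_edge_of_ne hne, Set.union_singleton,
        Set.ncard_insert_of_notMem (by simpa using hJuv) (Set.toFinite _)]
    change k + 1 ≤ (J ⊔ SimpleGraph.edge u v).edgeSet.ncard + o +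
      ∑ v' ∈ ({ s.addArc u v with F := s.F ⊔ SimpleGraph.edge u v } : State n).active,
        min ((s.addArc u v).out v') 10 + ∑ x, min ((s.addArc u v).outT x) 10
    omega
  · exact excess_le_of_forall_not_needy (s := s.addArc u v) (not_needy_addArc hn u v) T hT

/-- A booster is chosen. -/
theorem Mid.boost {b : ℕ} {S₀ : Finset (Fin n)} {k : ℕ} {s : State n} (h : Mid b S₀ k s)
    (hn : ∀ x, ¬ s.Needy x) (hp : s.phase = Phase.two) (hcyc : ¬ HasCycleOn s.M s.P)
    (hP : 3 ≤ s.P.card) {u v : Fin n} (huv : s.Booster S₀ u v) :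
    Inv b S₀ (k + 1) (s.addArc u v) := by
  obtain ⟨J, f, o, hs, hc⟩ := h.shape
  obtain ⟨hu, hv, hne, hpath, -⟩ := huv
  have hua : u ∈ s.active := State.mem_active.2 (Or.inl (hs.sub_S hu))
  have hcyc' : HasCycleOn (s.addArc u v).M s.P := by
    refine hasCycleOn_of_hasPathOn (hpath.mono le_sup_left) (Or.inr ?_) hP
    rw [SimpleGraph.edge_adj]
    exact ⟨Or.inl ⟨rfl, rfl⟩, hne⟩
  have ho := hc.boost_noCycle hp hcyc
  have h1 := hc.rounds
  have h2 := sum_min_le (subset_refl Finset.univ) (le_outT_addArc s u v)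
  have h3 := sum_min_le (subset_refl s.active) (le_out_addArc s u v)
  refine ⟨⟨J, f, o + 1, hs.addArc hua hv (hn u), ⟨?_, ?_, ?_, ?_, hc.meets⟩⟩,
    h.card_B, h.phase, fun T hT => ?_⟩
  · change k + 1 ≤ J.edgeSet.ncard + (o + 1) + ∑ v' ∈ s.active, min ((s.addArc u v).out v') 10 +
        ∑ x, min ((s.addArc u v).outT x) 10
    omega
  · intro h1
    have : s.phase = Phase.one := h1
    rw [hp] at this
    cases this
  · exact fun _ _ => ho
  · exact fun _ h => absurd hcyc' h
  · exact excess_le_of_forall_not_needy (not_needy_addArc hn u v) T hT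

theorem Mid.card_active_le {b : ℕ} {S₀ : Finset (Fin n)} (hL : Large n b S₀.card) {k : ℕ}
    {s : State n} (h : Mid b S₀ k s) : (s.active.card : ℝ) ≤ 2140 * (n / √(Real.log n)) := by
  obtain ⟨J, f, o, hs, hc⟩ := h.shape
  have h1 := hs.card_active_le
  have h2 := hL.numTrouble_le h.card_B h.le
  have h3 := hL.m_le
  have h4 := hL.le_μ
  linarith

/-- In Case 2, Maker can choose an edge: the danger of a needy vertex `v` is bounded, hence so is
its degree in Breaker's graph. -/
theorem Mid.exists_needy_move {b : ℕ} {S₀ : Finset (Fin n)} (hL : Large n b S₀.card) {k : ℕ}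
    {s : State n} (h : Mid b S₀ k s) {v : Fin n} (hv : s.Needy v) :
    ∃ w, w ∉ s.S ∧ w ≠ v ∧ ¬ s.M.Adj v w ∧ ¬ s.B.Adj v w := by
  obtain ⟨J, f, o, hs, hc⟩ := h.shape
  have hμ := hL.le_μ
  have hμn := hL.μ_le
  have hbμ := hL.b_le
  have hlog := hL.b_log_le
  have hact := h.card_active_le hL
  have hK : (needyBound n : ℝ) ≤ 5 * (n / √(Real.log n)) := by
    have := Nat.ceil_lt_add_one (a := 4.2 * ((n : ℝ) / √(Real.log n))) (by linarith)
    unfold needyBound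
    linarith
  have hK1 : 1 ≤ needyBound n := Nat.ceil_pos.2 (by linarith)
  have hKn : needyBound n ≤ n := by
    have : (needyBound n : ℝ) ≤ n := by linarith
    exact_mod_cast this
  have h1 := h.excess_le {v} (by simpa using hv)
  rw [Finset.card_singleton] at h1
  have h2 := dangerBound_one_le (μ := n / √(Real.log n)) (b := b) (by positivity) hKn hK1
  have h3 : (b : ℝ) * s.outT v ≤ b * 9 := by
    have : (s.outT v : ℝ) ≤ 9 := by exact_mod_cast Nat.le_of_lt_succ hv.2
    gcongr
  rw [excess, meet_singleton, Finset.sum_singleton] at h1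
  have hdeg : (deg s.B v : ℝ) ≤ n - 9978 * (n / √(Real.log n)) := by linarith
  by_contra hcon
  push Not at hcon
  have hsub : (Set.univ : Set (Fin n)) ⊆
      (s.active : Set (Fin n)) ∪ ({v} ∪ (s.B.neighborSet v ∪ J.neighborSet v)) := by
    intro w _
    by_cases hwa : w ∈ s.active
    · exact Or.inl hwa
    right
    by_cases hwv : w = v
    · exact Or.inl hwv
    right
    by_cases hB : s.B.Adj v w
    · exact Or.inl hB
    right
    have hwS : w ∉ s.S := fun h => hwa (State.mem_active.2 (Or.inl h))
    by_cases hM : s.M.Adj v w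
    · exact (hs.J_of_notMem_active w hwa v hM.symm).symm
    · exact absurd (hcon w hwS hwv hM) hB
  have h4 := Set.ncard_le_ncard hsub (Set.toFinite _)
  rw [Set.ncard_univ, Nat.card_eq_fintype_card, Fintype.card_fin] at h4
  have h5 := Set.ncard_union_le (s.active : Set (Fin n))
    ({v} ∪ (s.B.neighborSet v ∪ J.neighborSet v))
  have h6 := Set.ncard_union_le {v} (s.B.neighborSet v ∪ J.neighborSet v)
  have h7 := Set.ncard_union_le (s.B.neighborSet v) (J.neighborSet v)
  have h8 := hs.deg_J v
  rw [Set.ncard_coe_finset] at h5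
  rw [Set.ncard_singleton] at h6
  have h9 : n ≤ s.active.card + deg s.B v + 3 := by
    unfold deg at h8 ⊢
    omega
  have h10 : (n : ℝ) ≤ s.active.card + deg s.B v + 3 := by exact_mod_cast h9
  linarith

/-- A vertex that is not troublesome has many options for a random choice. -/
theorem Large.le_card_options {b : ℕ} {S₀ : Finset (Fin n)} (hL : Large n b S₀.card)
    {s : State n} {v : Fin n} (hv : ¬ s.Troublesome v) :
    (0.999 : ℝ) * S₀.card ≤ (s.options S₀ v).card := by
  classical
  have hμ := hL.le_μ
  have hm := hL.le_m
  unfold State.Troublesome at hv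
  rw [not_lt] at hv
  have hsub : (S₀ : Set (Fin n)) ⊆
      (s.options S₀ v : Set (Fin n)) ∪ ({v} ∪ s.B.neighborSet v) := by
    intro w hw
    by_cases hwv : w = v
    · exact Or.inr (Or.inl hwv)
    by_cases hB : s.B.Adj v w
    · exact Or.inr (Or.inr hB)
    · left
      rw [Finset.mem_coe, State.options, Finset.mem_filter]
      exact ⟨hw, hwv, hB⟩
  have h1 := (Set.ncard_le_ncard hsub (Set.toFinite _)).trans (Set.ncard_union_le _ _)
  have h2 := Set.ncard_union_le {v} (s.B.neighborSet v)
  rw [Set.ncard_singleton] at h2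
  rw [Set.ncard_coe_finset, Set.ncard_coe_finset] at h1
  have h3 : S₀.card ≤ (s.options S₀ v).card + 1 + deg s.B v := by
    unfold deg
    omega
  have h4 : (S₀.card : ℝ) ≤ (s.options S₀ v).card + 1 + deg s.B v := by exact_mod_cast h3
  linarith

/-- Random choices are made only from vertices that are not troublesome. -/
theorem Shape.not_troublesome {S₀ : Finset (Fin n)} {J : SimpleGraph (Fin n)}
    {f : Fin n → Option (Fin n)} {s : State n} (h : Shape S₀ J f s) {v : Fin n}
    (hn : ¬ s.Needy v) (hout : s.out v < 10) : ¬ s.Troublesome v :=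
  fun hT => hn ⟨hT, (h.outT_le v).trans_lt hout⟩

end Moves

/-! ### Boosters -/

section Booster

variable {n : ℕ}

/-- `l` is the list of vertices of a path in Maker's graph with vertex set `V(P_i)`. -/
def State.IsOn (s : State n) (l : List (Fin n)) : Prop :=
  IsPathList s.M l ∧ ∀ x, x ∈ l ↔ x ∈ s.P

theorem State.IsOn.rot {s : State n} {S : Set (Fin n)} {l l' : List (Fin n)} (h : s.IsOn l)
    (hr : Rot s.M S l l') : s.IsOn l' :=
  ⟨hr.isPathList h.1, fun x => (hr.perm.mem_iff).trans (h.2 x)⟩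

theorem State.IsOn.reverse {s : State n} {l : List (Fin n)} (h : s.IsOn l) : s.IsOn l.reverse :=
  ⟨h.1.reverse, fun x => List.mem_reverse.trans (h.2 x)⟩

theorem State.IsOn.length {s : State n} {l : List (Fin n)} (h : s.IsOn l) :
    l.length = s.P.card := by
  rw [← List.toFinset_card_of_nodup h.1.1]
  congr 1
  ext x
  rw [List.mem_toFinset, h.2]

/-- If the path cannot be extended, the neighbours of its end lie on it. -/
theorem mem_of_adj_head {s : State n}
    (hmax : ∀ Y, IsPathSet s.M Y → s.P ⊆ Y → Y.card ≤ s.P.card) {v x : Fin n}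
    {l : List (Fin n)} (h : s.IsOn (v :: l)) (hvx : s.M.Adj v x) : x ∈ s.P := by
  by_contra hx
  have h1 : IsPathSet s.M (insert x s.P) := by
    rw [isPathSet_iff]
    refine ⟨x :: v :: l, ⟨?_, ?_⟩, by simp, ?_⟩
    · refine List.nodup_cons.2 ⟨fun hxl => hx ((h.2 x).1 hxl), h.1.1⟩
    · exact List.isChain_cons_cons.2 ⟨hvx.symm, h.1.2⟩
    · intro y
      rw [List.mem_cons, h.2, Finset.mem_insert]
  have h2 := hmax _ h1 (Finset.subset_insert _ _)
  rw [Finset.card_insert_of_notMem hx] at h2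
  omega

/-- After the first phase, a vertex that is not active is an inner vertex of a path of the family.
-/
theorem two_le_deg_of_notMem_active {s : State n} (hp : s.phase = Phase.two) {v : Fin n}
    (hv : v ∉ s.active) : v ∉ s.S ∧ 2 ≤ deg s.F v := by
  rw [State.mem_active, not_or] at hv
  refine ⟨hv.1, ?_⟩
  by_contra hlt
  exact hv.2 ⟨by rw [hp]; simp, hv.1, by omega⟩

theorem deg_ge_three {G : SimpleGraph (Fin n)} {x a b c : Fin n} (ha : G.Adj x a)
    (hb : G.Adj x b) (hc : G.Adj x c) (hab : a ≠ b) (hac : a ≠ c) (hbc : b ≠ c) :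
    3 ≤ deg G x := by
  classical
  have h : (({a, b, c} : Finset (Fin n)) : Set (Fin n)) ⊆ G.neighborSet x := by
    intro y hy
    simp only [Finset.coe_insert, Finset.coe_singleton, Set.mem_insert_iff,
      Set.mem_singleton_iff] at hy
    rcases hy with rfl | rfl | rfl
    · exact ha
    · exact hb
    · exact hc
  have h1 := Set.ncard_le_ncard h (Set.toFinite _)
  rw [Set.ncard_coe_finset, Finset.card_eq_three.2 ⟨a, b, c, hab, hac, hbc, rfl⟩] at h1
  exact h1

/-- An inner vertex of a path of the family has no neighbour in `S_i`. -/
theorem Shape.mem_active_of_adj {S₀ : Finset (Fin n)} {J : SimpleGraph (Fin n)}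
    {f : Fin n → Option (Fin n)} {s : State n} (h : Shape S₀ J f s) (hp : s.phase = Phase.two)
    {x y : Fin n} (hx : x ∈ s.S) (hxy : s.M.Adj x y) : y ∈ s.active := by
  by_contra hy
  obtain ⟨hyS, hd⟩ := two_le_deg_of_notMem_active hp hy
  have h1 : J.Adj y x := h.J_of_notMem_active y hy x hxy.symm
  have h2 : insert x (s.F.neighborSet y) ⊆ J.neighborSet y := by
    rintro z (rfl | hz)
    · exact h1
    · rw [SimpleGraph.mem_neighborSet, h.F_eq] at hz
      exact hz.1
  have h3 : x ∉ s.F.neighborSet y := by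
    intro hz
    rw [SimpleGraph.mem_neighborSet, h.F_eq] at hz
    exact hz.2.2 hx
  have h4 := Set.ncard_le_ncard h2 (Set.toFinite _)
  rw [Set.ncard_insert_of_notMem h3 (Set.toFinite _)] at h4
  have h5 := h.deg_J y
  unfold deg at h5 hd
  omega

/-- One rotation makes the end of the path active: if it is an inner vertex of a path of the family,
then it has a neighbour on that path by which one can rotate. -/
theorem Shape.exists_active_head {S₀ : Finset (Fin n)} {J : SimpleGraph (Fin n)}
    {f : Fin n → Option (Fin n)} {s : State n} (h : Shape S₀ J f s) (hp : s.phase = Phase.two)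
    (hmax : ∀ Y, IsPathSet s.M Y → s.P ⊆ Y → Y.card ≤ s.P.card)
    (hmeets : ∃ x ∈ s.P, x ∈ s.S) (hcyc : ¬ HasCycleOn s.M s.P) {l : List (Fin n)}
    (hl : s.IsOn l) :
    ∃ v t, s.IsOn (v :: t) ∧ v ∈ s.active ∧ (v :: t).getLast? = l.getLast? := by
  obtain ⟨x₀, hx₀, hx₀S⟩ := hmeets
  have hx₀l := (hl.2 x₀).2 hx₀
  obtain ⟨v, t, rfl⟩ := List.exists_cons_of_ne_nil (List.ne_nil_of_mem hx₀l)
  by_cases hv : v ∈ s.active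
  · exact ⟨v, t, hl, hv, rfl⟩
  obtain ⟨hvS, hd⟩ := two_le_deg_of_notMem_active hp hv
  obtain ⟨p, t, rfl⟩ : ∃ p t', t = p :: t' := by
    refine List.exists_cons_of_ne_nil ?_
    rintro rfl
    rw [List.mem_singleton] at hx₀l
    exact hvS (hx₀l ▸ hx₀S)
  obtain ⟨z, hz, hzp⟩ : ∃ z ∈ s.F.neighborSet v, z ≠ p :=
    Set.exists_ne_of_one_lt_ncard (show 1 < (s.F.neighborSet v).ncard from hd) p
  have hFz : J.Adj v z ∧ v ∉ s.S ∧ z ∉ s.S := by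
    rw [SimpleGraph.mem_neighborSet, h.F_eq] at hz
    exact hz
  have hvz : s.M.Adj v z := h.J_le hFz.1
  have hzt : z ∈ t := by
    have := (hl.2 z).2 (mem_of_adj_head hmax hl hvz)
    simp only [List.mem_cons] at this
    rcases this with h1 | h1 | h1
    · exact absurd h1.symm hvz.ne
    · exact absurd h1 hzp
    · exact h1
  obtain ⟨q, t, rfl⟩ := List.append_of_mem hzt
  cases t with
  | nil =>
    refine absurd ?_ hcyc
    refine hasCycleOn_of_hasPathOn (u := v) (v := z)
      (hasPathOn_iff.2 ⟨_, hl.1, rfl, ?_, hl.2⟩) hvz ?_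
    · rw [← List.cons_append, ← List.cons_append, List.getLast?_append]
      simp
    · rw [← hl.length]
      simp
  | cons a t =>
    have hr : Rot s.M Set.univ (v :: p :: (q ++ z :: a :: t))
        ((v :: p :: q).reverse ++ z :: a :: t) :=
      Rot.step v z (p :: q) (a :: t) Rot.refl (Set.mem_univ _) hvz
    obtain ⟨y, r, hy, hlast⟩ := exists_head_reverse v (p :: q)
    rw [hy] at hr
    refine ⟨y, r ++ z :: a :: t, hl.rot hr, ?_, hr.getLast?⟩
    -- Otherwise `a`, `y` and `v` are three neighbours of `z` on a path of the family.
    by_contra hya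
    have hyS : y ∉ s.S := (two_le_deg_of_notMem_active hp hya).1
    have hc := hl.1.2
    rw [← List.cons_append, ← List.cons_append, List.isChain_append] at hc
    have hyz : s.M.Adj y z := hc.2.2 y hlast z (by simp)
    have hza : s.M.Adj z a := (List.isChain_cons_cons.1 hc.2.1).1
    have hJzy : J.Adj z y := h.J_of_notMem_S z y hFz.2.2 hyS hyz.symm
    have hnd := hl.1.1
    rw [← List.cons_append, ← List.cons_append, List.nodup_append] at hnd
    have hya' : y ∈ v :: p :: q := List.mem_of_getLast? hlast
    have hay : a ≠ y := (hnd.2.2 y hya' a (by simp)).symm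
    have hav : a ≠ v := (hnd.2.2 v (by simp) a (by simp)).symm
    have hyv : y ≠ v := by
      rintro rfl
      have hmem : y ∈ p :: q := by
        rw [List.getLast?_cons_cons] at hlast
        exact List.mem_of_getLast? hlast
      exact (List.nodup_cons.1 hnd.1).1 hmem
    have hzv : J.Adj z v := hFz.1.symm
    have hzact : z ∉ s.active := by
      intro hz'
      rw [State.mem_active] at hz'
      rcases hz' with hz' | ⟨-, -, hz'⟩
      · exact hFz.2.2 hz'
      · unfold deg at hz'
        rw [Set.ncard_le_one (Set.toFinite _)] at hz'
        refine hyv (hz' y ?_ v ?_)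
        · rw [SimpleGraph.mem_neighborSet, h.F_eq]
          exact ⟨hJzy, hFz.2.2, hyS⟩
        · rw [SimpleGraph.mem_neighborSet, h.F_eq]
          exact ⟨hzv, hFz.2.2, hvS⟩
    have := deg_ge_three (h.J_of_notMem_active z hzact a hza) hJzy hzv hay hav hyv
    have := h.deg_J z
    omega

/-- Many ends arise by rotations, if small sets of vertices that are not troublesome expand into
`S₀`. The troublesome vertices expand as well, since the vertices to which the ten edges from each
of them lead are all different; these are not in `S₀`. -/
theorem Shape.card_rotEnds {S₀ : Finset (Fin n)} {J : SimpleGraph (Fin n)}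
    {f : Fin n → Option (Fin n)} {s : State n} (h : Shape S₀ J f s) (hp : s.phase = Phase.two)
    (hmax : ∀ Y, IsPathSet s.M Y → s.P ⊆ Y → Y.card ≤ s.P.card)
    (hn : ∀ v, ¬ s.Needy v) {r : ℝ}
    (hexp : ∀ W : Finset (Fin n), W.Nonempty → W ⊆ s.active → (∀ v ∈ W, ¬ s.Troublesome v) →
      (W.card : ℝ) ≤ r → 3 * W.card < {x | x ∈ S₀ ∧ ∃ v ∈ W, s.M.Adj v x}.ncard)
    {v : Fin n} {t : List (Fin n)} (hl : s.IsOn (v :: t)) (hv : v ∈ s.active) :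
    ∃ W : Finset (Fin n), W ⊆ s.active ∧ r < W.card ∧
      ∀ w ∈ W, ¬ s.Troublesome w ∧ w ∈ rotEnds s.M s.S (v :: t) := by
  classical
  set R := rotEnds s.M s.S (v :: t)
  have hRact : ∀ w ∈ R, w ∈ s.active := fun w hw =>
    rotEnds_induction (P := fun w => w ∈ s.active) hl.1.2 (by simpa using hv)
      (fun x hx y hxy => h.mem_active_of_adj hp hx hxy) hw
  have hN : ∀ w ∈ R, ∀ x ∈ s.S, s.M.Adj w x → x ∈ rotHull s.M s.S (v :: t) := by
    rintro w hw x hx hwx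
    have hw' := hw
    obtain ⟨t', ht'⟩ := hw'
    exact mem_rotHull_of_adj hl.1.1 hw hx hwx
      ((hl.2 x).2 (mem_of_adj_head hmax (hl.rot ht') hwx))
  set W := Finset.univ.filter fun w => w ∈ R ∧ ¬ s.Troublesome w
  set T := Finset.univ.filter fun w => w ∈ R ∧ s.Troublesome w
  have hRcard : R.ncard = W.card + T.card := by
    have : R = ((W ∪ T : Finset (Fin n)) : Set (Fin n)) := by
      ext w
      simp only [W, T, Finset.coe_union, Finset.coe_filter, Finset.mem_univ, true_and,
        Set.mem_union, Set.mem_ofPred_eq]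
      tauto
    rw [this, Set.ncard_coe_finset, Finset.card_union_of_disjoint]
    rw [Finset.disjoint_left]
    intro w hw hw'
    exact (Finset.mem_filter.1 hw).2.2 (Finset.mem_filter.1 hw').2.2
  have hA : (T.biUnion fun w => Finset.univ.filter fun x => f x = some w).card = 10 * T.card := by
    rw [Finset.card_biUnion, Finset.sum_const_nat (m := 10), mul_comm]
    · intro w hw
      have h1 := h.card_owned w
      rw [← Set.ncard_coe_finset]
      simp only [Finset.coe_filter, Finset.mem_univ, true_and]
      rw [h1]
      have h2 : ¬ s.outT w < 10 := fun hlt => hn w ⟨(Finset.mem_filter.1 hw).2.2, hlt⟩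
      omega
    · intro w _ w' _ hww
      rw [Function.onFun, Finset.disjoint_left]
      intro x hx hx'
      have h1 := (Finset.mem_filter.1 hx).2
      have h2 := (Finset.mem_filter.1 hx').2
      rw [h1] at h2
      exact hww (Option.some.inj h2)
  have hunion : ((T.biUnion fun w => Finset.univ.filter fun x => f x = some w : Finset (Fin n)) :
      Set (Fin n)) ∪ {x | x ∈ S₀ ∧ ∃ w ∈ W, s.M.Adj w x} ⊆ rotHull s.M s.S (v :: t) := by
    rintro x (hx | ⟨hx, w, hw, hwx⟩)
    · rw [Finset.mem_coe, Finset.mem_biUnion] at hx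
      obtain ⟨w, hw, hx⟩ := hx
      obtain ⟨h1, h2, h3, h4⟩ := h.owner x w (Finset.mem_filter.1 hx).2
      exact hN w (Finset.mem_filter.1 hw).2.1 x h1 h3
    · exact hN w (Finset.mem_filter.1 hw).2.1 x (h.sub_S hx) hwx
  have hdisj : Disjoint ((T.biUnion fun w => Finset.univ.filter fun x => f x = some w :
      Finset (Fin n)) : Set (Fin n)) {x | x ∈ S₀ ∧ ∃ w ∈ W, s.M.Adj w x} := by
    rw [Set.disjoint_left]
    rintro x hx ⟨hx₀, -⟩
    rw [Finset.mem_coe, Finset.mem_biUnion] at hx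
    obtain ⟨w, hw, hx⟩ := hx
    exact (h.owner x w (Finset.mem_filter.1 hx).2).2.1 hx₀
  have h1 := Set.ncard_le_ncard hunion (Set.toFinite _)
  rw [Set.ncard_union_eq hdisj (Set.toFinite _) (Set.toFinite _), Set.ncard_coe_finset, hA] at h1
  have h2 := h1.trans (card_rotHull_le s.M s.S (v :: t))
  change _ ≤ 3 * R.ncard at h2
  rw [hRcard] at h2
  have hR1 : 0 < R.ncard := by
    rw [Set.ncard_pos (Set.toFinite _)]
    exact ⟨v, t, Rot.refl⟩
  have hWact : W ⊆ s.active := fun w hw => hRact w (Finset.mem_filter.1 hw).2.1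
  refine ⟨W, hWact, ?_, fun w hw =>
    ⟨(Finset.mem_filter.1 hw).2.2, (Finset.mem_filter.1 hw).2.1⟩⟩
  by_contra hr
  have hWne : W.Nonempty := by
    rw [← Finset.card_pos]
    omega
  have h3 := hexp W hWne hWact (fun w hw => (Finset.mem_filter.1 hw).2.2) (not_lt.1 hr)
  omega

/-- If small sets of vertices that are not troublesome expand into `S₀`, then there is a booster:
rotations of both ends of the path produce so many pairs of endpoints in `S₀` that Breaker cannot
have chosen all of the edges between them. -/
theorem Mid.exists_booster {b : ℕ} {S₀ : Finset (Fin n)} (hL : Large n b S₀.card) {k : ℕ}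
    {s : State n} (h : Mid b S₀ k s) (hp : s.phase = Phase.two) (hn : ∀ v, ¬ s.Needy v)
    (hcyc : ¬ HasCycleOn s.M s.P)
    (hexp : ∀ W : Finset (Fin n), W.Nonempty → W ⊆ s.active → (∀ v ∈ W, ¬ s.Troublesome v) →
      (W.card : ℝ) ≤ 0.08 * S₀.card → 3 * W.card < {x | x ∈ S₀ ∧ ∃ v ∈ W, s.M.Adj v x}.ncard) :
    3 ≤ s.P.card ∧ ∃ u v, s.Booster S₀ u v := by
  classical
  obtain ⟨J, f, o, hs, hc⟩ := h.shape
  have hmax := h.maximal hp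
  have hmeets := hc.meets hp
  have hμ := hL.le_μ
  have hm := hL.le_m
  have hT := hL.numTrouble_le h.card_B h.le
  have hA := hs.card_active_sdiff_le
  have key : ∀ l, s.IsOn l → ∃ (W : Finset (Fin n)), W ⊆ S₀ ∧ 20 * ((n : ℝ) / √(Real.log n)) ≤
      W.card ∧ ∀ w ∈ W, ¬ s.Troublesome w ∧ ∃ t, s.IsOn (w :: t) ∧
        (w :: t).getLast? = l.getLast? := by
    intro l hl
    obtain ⟨v, t, hvt, hv, hlast⟩ := hs.exists_active_head hp hmax hmeets hcyc hl
    obtain ⟨W, hWa, hW, hW'⟩ := hs.card_rotEnds hp hmax hn hexp hvt hv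
    refine ⟨W ∩ S₀, Finset.inter_subset_right, ?_, ?_⟩
    · have h1 : W.card ≤ (W ∩ S₀).card + (s.active \ S₀).card := by
        rw [← Finset.card_sdiff_add_card_inter W S₀, add_comm]
        gcongr
      have h2 : (W.card : ℝ) ≤ (W ∩ S₀).card + (s.active \ S₀).card := by exact_mod_cast h1
      linarith
    · intro w hw
      obtain ⟨h1, t', ht'⟩ := hW' w (Finset.mem_inter.1 hw).1
      exact ⟨h1, t', hvt.rot ht', ht'.getLast?.trans hlast⟩
  obtain ⟨l₀, hl₀, -, hl₀P⟩ := isPathSet_iff.1 (h.path hp)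
  obtain ⟨W₁, hW₁, hW₁c, hW₁'⟩ := key l₀ ⟨hl₀, hl₀P⟩
  constructor
  · have hsub : W₁ ⊆ s.P := by
      intro w hw
      obtain ⟨-, t, ht, -⟩ := hW₁' w hw
      exact (ht.2 w).1 List.mem_cons_self
    have h1 : (W₁.card : ℝ) ≤ s.P.card := by exact_mod_cast Finset.card_le_card hsub
    have h2 : (3 : ℝ) ≤ s.P.card := by linarith
    exact_mod_cast h2
  · have hne : W₁.Nonempty := by
      rw [← Finset.card_pos]
      have : (0 : ℝ) < W₁.card := by linarith
      exact_mod_cast this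
    obtain ⟨u, hu⟩ := hne
    obtain ⟨hut, t, hon, -⟩ := hW₁' u hu
    obtain ⟨W₂, hW₂, hW₂c, hW₂'⟩ := key _ hon.reverse
    have hex : ¬ (W₂ : Set (Fin n)) ⊆ {u} ∪ s.B.neighborSet u := by
      intro hsub
      have h1 := (Set.ncard_le_ncard hsub (Set.toFinite _)).trans (Set.ncard_union_le _ _)
      rw [Set.ncard_singleton, Set.ncard_coe_finset] at h1
      have h2 : (W₂.card : ℝ) ≤ 1 + deg s.B u := by exact_mod_cast h1
      unfold State.Troublesome at hut
      linarith
    obtain ⟨v, hv, hvu⟩ := Set.not_subset.1 hex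
    obtain ⟨-, t', hon', hlast⟩ := hW₂' v hv
    refine ⟨v, u, hW₂ hv, hW₁ hu, fun h => hvu (Or.inl h), ?_, fun h => hvu (Or.inr h.symm)⟩
    refine hasPathOn_iff.2 ⟨v :: t', hon'.1, rfl, ?_, hon'.2⟩
    rw [hlast, List.getLast?_reverse]
    rfl

end Booster

/-! ### The potential of a position -/

section Potential

variable {n : ℕ}

open Classical in
/-- A bound on the conditional probability that, when ten edges have been chosen from `v`, the
vertex is not troublesome and all its neighbours in `S₀` lie in `X`, if a random choice lies in
`X` with probability at most `q`. At least eight of the ten choices are random. -/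
noncomputable def weight (S₀ X : Finset (Fin n)) (q : ℝ) (s : State n) (v : Fin n) : ℝ :=
  if s.Troublesome v ∨ ∃ x ∈ S₀, s.M.Adj v x ∧ x ∉ X then 0 else q ^ min 8 (10 - s.out v)

/-- The generating function, at `t`, of the number of active vertices all of whose neighbours in
`S₀` will lie in `X`, normalised such that it cannot increase when a vertex becomes active. -/
noncomputable def pot (S₀ X : Finset (Fin n)) (q t : ℝ) (s : State n) : ℝ :=
  Real.exp (-(t * q ^ 8 * s.active.card)) * ∏ v ∈ s.active, (1 + t * weight S₀ X q s v)

theorem weight_nonneg {S₀ X : Finset (Fin n)} {q : ℝ} (hq : 0 ≤ q) (s : State n) (v : Fin n) :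
    0 ≤ weight S₀ X q s v := by
  unfold weight
  split_ifs
  · exact le_rfl
  · positivity

theorem weight_le_pow {S₀ X : Finset (Fin n)} {q : ℝ} (hq : 0 ≤ q) (s : State n) (v : Fin n) :
    weight S₀ X q s v ≤ q ^ min 8 (10 - s.out v) := by
  unfold weight
  split_ifs
  · positivity
  · exact le_rfl

theorem pot_nonneg {S₀ X : Finset (Fin n)} {q t : ℝ} (hq : 0 ≤ q) (ht : 0 ≤ t) (s : State n) :
    0 ≤ pot S₀ X q t s :=
  mul_nonneg (Real.exp_pos _).le (Finset.prod_nonneg fun v _ => by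
    have := mul_nonneg ht (weight_nonneg (S₀ := S₀) (X := X) hq s v)
    linarith)

theorem weight_mono {S₀ X : Finset (Fin n)} {q : ℝ} (hq : 0 ≤ q) (hq1 : q ≤ 1) {s s' : State n}
    (hB : s.B ≤ s'.B) (hM : s.M ≤ s'.M) {v : Fin n}
    (hv : s'.Troublesome v ∨ min 8 (10 - s.out v) ≤ min 8 (10 - s'.out v)) :
    weight S₀ X q s' v ≤ weight S₀ X q s v := by
  by_cases h' : s'.Troublesome v ∨ ∃ x ∈ S₀, s'.M.Adj v x ∧ x ∉ X
  · have : weight S₀ X q s' v = 0 := if_pos h'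
    rw [this]
    exact weight_nonneg hq s v
  · have h : ¬ (s.Troublesome v ∨ ∃ x ∈ S₀, s.M.Adj v x ∧ x ∉ X) := by
      rintro (h | ⟨x, hx, hvx, hxX⟩)
      · exact h' (Or.inl (State.Troublesome.mono hB h))
      · exact h' (Or.inr ⟨x, hx, hM hvx, hxX⟩)
    unfold weight
    rw [if_neg h', if_neg h]
    exact pow_le_pow_of_le_one hq hq1 (hv.resolve_left fun h => h' (Or.inl h))

theorem pot_mono {S₀ X : Finset (Fin n)} {q t : ℝ} (hq : 0 ≤ q) (hq1 : q ≤ 1) (ht : 0 ≤ t)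
    {s s' : State n} (hB : s.B ≤ s'.B) (hM : s.M ≤ s'.M) (hact : s.active ⊆ s'.active)
    (hold : ∀ v ∈ s.active, s'.Troublesome v ∨ min 8 (10 - s.out v) ≤ min 8 (10 - s'.out v))
    (hnew : ∀ v, v ∉ s.active → v ∈ s'.active → s'.out v ≤ 2) :
    pot S₀ X q t s' ≤ pot S₀ X q t s := by
  have hfac : ∀ v, 0 ≤ 1 + t * weight S₀ X q s' v := fun v => by
    have := mul_nonneg ht (weight_nonneg (S₀ := S₀) (X := X) hq s' v)
    linarith
  have h1 : ∏ v ∈ s'.active \ s.active, (1 + t * weight S₀ X q s' v) ≤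
      Real.exp (t * q ^ 8) ^ (s'.active \ s.active).card := by
    rw [← Finset.prod_const]
    refine Finset.prod_le_prod (fun v _ => hfac v) fun v hv => ?_
    obtain ⟨hv', hv⟩ := Finset.mem_sdiff.1 hv
    have h2 := weight_le_pow (S₀ := S₀) (X := X) hq s' v
    have h3 : min 8 (10 - s'.out v) = 8 := by
      have := hnew v hv hv'
      omega
    rw [h3] at h2
    have h4 := Real.add_one_le_exp (t * q ^ 8)
    have h5 := mul_le_mul_of_nonneg_left h2 ht
    linarith
  have h2 : ∏ v ∈ s.active, (1 + t * weight S₀ X q s' v) ≤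
      ∏ v ∈ s.active, (1 + t * weight S₀ X q s v) := by
    refine Finset.prod_le_prod (fun v _ => hfac v) fun v hv => ?_
    have := mul_le_mul_of_nonneg_left
      (weight_mono (S₀ := S₀) (X := X) hq hq1 hB hM (hold v hv)) ht
    linarith
  have h3 : s'.active.card = (s'.active \ s.active).card + s.active.card := by
    rw [Finset.card_sdiff_add_card_eq_card hact]
  unfold pot
  rw [← Finset.prod_sdiff hact, h3]
  have h4 : Real.exp (-(t * q ^ 8 * ((((s'.active \ s.active).card + s.active.card : ℕ)) : ℝ))) *
      Real.exp (t * q ^ 8) ^ (s'.active \ s.active).card =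
      Real.exp (-(t * q ^ 8 * s.active.card)) := by
    rw [← Real.exp_nat_mul, ← Real.exp_add]
    congr 1
    push_cast
    ring
  rw [← h4, mul_assoc, mul_assoc]
  refine mul_le_mul_of_nonneg_left ?_ (Real.exp_pos _).le
  refine (mul_le_mul_of_nonneg_right h1 (Finset.prod_nonneg fun v _ => hfac v)).trans ?_
  exact mul_le_mul_of_nonneg_left h2 (by positivity)

/-- The weight of `v` does not increase on average by a random choice from `v`. -/
theorem sum_weight_le {S₀ X : Finset (Fin n)} {q : ℝ} (hq : 0 < q) (hq1 : q ≤ 1) {s : State n}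
    {v : Fin n} (hX : (X.card : ℝ) ≤ q * (s.options S₀ v).card) :
    ∑ w ∈ s.options S₀ v, weight S₀ X q (s.addArc v w) v ≤
      (s.options S₀ v).card * weight S₀ X q s v := by
  classical
  have h1 : ∀ w ∈ s.options S₀ v, weight S₀ X q (s.addArc v w) v ≤
      if w ∈ X then weight S₀ X q s v / q else 0 := by
    intro w hw
    obtain ⟨hwS, hwv, -⟩ := Finset.mem_filter.1 hw
    have hadj : (s.addArc v w).M.Adj v w := by
      right
      rw [SimpleGraph.edge_adj]
      exact ⟨Or.inl ⟨rfl, rfl⟩, hwv.symm⟩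
    split_ifs with hwX
    · by_cases h : s.Troublesome v ∨ ∃ x ∈ S₀, s.M.Adj v x ∧ x ∉ X
      · have h' : (s.addArc v w).Troublesome v ∨
            ∃ x ∈ S₀, (s.addArc v w).M.Adj v x ∧ x ∉ X := by
          rcases h with h | ⟨x, hx, hvx, hxX⟩
          · exact Or.inl h
          · exact Or.inr ⟨x, hx, Or.inl hvx, hxX⟩
        have h0 : weight S₀ X q (s.addArc v w) v = 0 := if_pos h'
        have h0' : weight S₀ X q s v = 0 := if_pos h
        rw [h0, h0', zero_div]
      · have h0 : weight S₀ X q s v = q ^ min 8 (10 - s.out v) := if_neg h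
        rw [h0, le_div_iff₀ hq]
        refine (mul_le_mul_of_nonneg_right (weight_le_pow hq.le _ v) hq.le).trans ?_
        rw [← pow_succ]
        refine pow_le_pow_of_le_one hq.le hq1 ?_
        have : (s.addArc v w).out v = s.out v + 1 := by simp [State.addArc]
        rw [this]
        omega
    · exact (if_pos (Or.inr ⟨w, hwS, hadj, hwX⟩) : weight S₀ X q (s.addArc v w) v = 0).le
  refine (Finset.sum_le_sum h1).trans ?_
  rw [← Finset.sum_filter, Finset.sum_const, nsmul_eq_mul]
  have h2 : ((Finset.filter (fun w => w ∈ X) (s.options S₀ v)).card : ℝ) ≤ X.card := by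
    exact_mod_cast Finset.card_le_card fun w hw => (Finset.mem_filter.1 hw).2
  have h3 := weight_nonneg (S₀ := S₀) (X := X) hq.le s v
  rw [mul_div_assoc', div_le_iff₀ hq]
  have h4 := mul_le_mul_of_nonneg_right (h2.trans hX) h3
  linarith

/-- The potential does not increase on average by a random choice. -/
theorem sum_pot_le {S₀ X : Finset (Fin n)} {q t : ℝ} (hq : 0 < q) (hq1 : q ≤ 1) (ht : 0 ≤ t)
    {s : State n} {v : Fin n} (hv : v ∈ s.active)
    (hX : (X.card : ℝ) ≤ q * (s.options S₀ v).card) :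
    ∑ w ∈ s.options S₀ v, pot S₀ X q t (s.addArc v w) ≤
      (s.options S₀ v).card * pot S₀ X q t s := by
  classical
  set A := Real.exp (-(t * q ^ 8 * s.active.card)) *
    ∏ x ∈ s.active.erase v, (1 + t * weight S₀ X q s x)
  have hA : 0 ≤ A := mul_nonneg (Real.exp_pos _).le (Finset.prod_nonneg fun x _ => by
    have := mul_nonneg ht (weight_nonneg (S₀ := S₀) (X := X) hq.le s x)
    linarith)
  have h0 : pot S₀ X q t s = A * (1 + t * weight S₀ X q s v) := by
    unfold pot
    rw [← Finset.prod_erase_mul _ _ hv]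
    simp only [A]
    ring
  have h1 : ∀ w ∈ s.options S₀ v, pot S₀ X q t (s.addArc v w) ≤
      A * (1 + t * weight S₀ X q (s.addArc v w) v) := by
    intro w _
    have hact : (s.addArc v w).active = s.active := rfl
    unfold pot
    rw [hact, ← Finset.prod_erase_mul _ _ hv, ← mul_assoc]
    refine mul_le_mul_of_nonneg_right ?_ ?_
    · refine mul_le_mul_of_nonneg_left ?_ (Real.exp_pos _).le
      refine Finset.prod_le_prod (fun x _ => ?_) fun x hx => ?_
      · have := mul_nonneg ht (weight_nonneg (S₀ := S₀) (X := X) hq.le (s.addArc v w) x)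
        linarith
      · have hxv : x ≠ v := Finset.ne_of_mem_erase hx
        have h2 : weight S₀ X q (s.addArc v w) x ≤ weight S₀ X q s x := by
          refine weight_mono (s := s) (s' := s.addArc v w) hq.le hq1 le_rfl le_sup_left (Or.inr ?_)
          have : (s.addArc v w).out x = s.out x := by simp [State.addArc, hxv]
          rw [this]
        have := mul_le_mul_of_nonneg_left h2 ht
        linarith
    · have := mul_nonneg ht (weight_nonneg (S₀ := S₀) (X := X) hq.le (s.addArc v w) v)
      linarith
  refine (Finset.sum_le_sum h1).trans ?_
  rw [← Finset.mul_sum, Finset.sum_add_distrib, ← Finset.mul_sum, Finset.sum_const, nsmul_eq_mul,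
    mul_one, h0]
  have h2 := mul_le_mul_of_nonneg_left (sum_weight_le (v := v) hq hq1 hX) ht
  have h3 : (s.options S₀ v).card + t * ∑ w ∈ s.options S₀ v, weight S₀ X q (s.addArc v w) v ≤
      (s.options S₀ v).card * (1 + t * weight S₀ X q s v) := by linarith
  calc A * ((s.options S₀ v).card + t * ∑ w ∈ s.options S₀ v, weight S₀ X q (s.addArc v w) v)
      ≤ A * ((s.options S₀ v).card * (1 + t * weight S₀ X q s v)) :=
        mul_le_mul_of_nonneg_left h3 hA
    _ = _ := by ring

/-- A lower bound on the potential of a position in which all neighbours in `S₀` of the vertices of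
`W` lie in `X`. -/
theorem le_pot {S₀ X W : Finset (Fin n)} {q t : ℝ} (hq : 0 ≤ q) (ht : 0 ≤ t) {s : State n}
    (hW : W ⊆ s.active) (hT : ∀ v ∈ W, ¬ s.Troublesome v) (hout : ∀ v ∈ W, 10 ≤ s.out v)
    (hX : ∀ v ∈ W, ∀ x ∈ S₀, s.M.Adj v x → x ∈ X) {L : ℝ} (hL : (s.active.card : ℝ) ≤ L) :
    Real.exp (-(t * q ^ 8 * L)) * t ^ W.card ≤ pot S₀ X q t s := by
  have h1 : t ^ W.card ≤ ∏ v ∈ s.active, (1 + t * weight S₀ X q s v) := by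
    rw [← Finset.prod_sdiff hW, ← one_mul (t ^ W.card), ← Finset.prod_const]
    have hone : ∀ v, 1 ≤ 1 + t * weight S₀ X q s v := fun v => by
      have := mul_nonneg ht (weight_nonneg (S₀ := S₀) (X := X) hq s v)
      linarith
    have hprod : 1 ≤ ∏ v ∈ s.active \ W, (1 + t * weight S₀ X q s v) :=
      Finset.one_le_prod fun v _ => hone v
    refine mul_le_mul hprod (Finset.prod_le_prod (fun _ _ => ht) fun v hv => ?_)
      (Finset.prod_nonneg fun _ _ => ht) (by linarith)
    have h2 : weight S₀ X q s v = 1 := by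
      unfold weight
      rw [if_neg]
      · have : min 8 (10 - s.out v) = 0 := by
          have := hout v hv
          omega
        rw [this, pow_zero]
      · rintro (h | ⟨x, hx, hvx, hxX⟩)
        · exact hT v hv h
        · exact hxX (hX v hv x hx hvx)
    rw [h2]
    linarith
  unfold pot
  refine mul_le_mul (Real.exp_le_exp.2 ?_) h1 (by positivity) (Real.exp_pos _).le
  have : t * q ^ 8 * s.active.card ≤ t * q ^ 8 * L := by gcongr
  linarith

theorem pot_init_le {S₀ X : Finset (Fin n)} {q t : ℝ} (hq : 0 ≤ q) (ht : 0 ≤ t) :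
    pot S₀ X q t (State.init S₀) ≤ 1 := by
  unfold pot
  have h1 : ∏ v ∈ (State.init S₀).active, (1 + t * weight S₀ X q (State.init S₀) v) ≤
      Real.exp (t * q ^ 8) ^ (State.init S₀).active.card := by
    rw [← Finset.prod_const]
    refine Finset.prod_le_prod (fun v _ => ?_) fun v hv => ?_
    · have := mul_nonneg ht (weight_nonneg (S₀ := S₀) (X := X) hq (State.init S₀) v)
      linarith
    · have h2 := weight_le_pow (S₀ := S₀) (X := X) hq (State.init S₀) v
      have h3 : min 8 (10 - (State.init S₀).out v) = 8 := by simp [State.init]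
      rw [h3] at h2
      have h4 := Real.add_one_le_exp (t * q ^ 8)
      have h5 := mul_le_mul_of_nonneg_left h2 ht
      linarith
  refine (mul_le_mul_of_nonneg_left h1 (Real.exp_pos _).le).trans ?_
  rw [← Real.exp_nat_mul, ← Real.exp_add]
  refine Real.exp_le_one_iff.2 (le_of_eq ?_)
  ring

/-- The bound on the probability that a random choice lies in a set of `3 w` vertices, if `S₀` has
`m` vertices: by `Large.le_card_options` there are at least `0.999 m` options. -/
noncomputable def hitProb (m w : ℕ) : ℝ := 3 * w / (0.999 * m)

/-- The argument of the generating function that is used for sets of `w` vertices. It minimises the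
bound `exp (t q ^ 8 L) / t ^ w` that Markov's inequality gives, where `L = 2140 n / √(ln n)`
bounds the number of active vertices. -/
noncomputable def tilt (n m w : ℕ) : ℝ :=
  w / (2140 * (n / √(Real.log n)) * hitProb m w ^ 8)

/-- The value that the potential reaches if there is a set of `w` vertices that does not expand. -/
noncomputable def threshold (n m w : ℕ) : ℝ := Real.exp (-w) * tilt n m w ^ w

/-- The total potential of a position: the sum over the sizes `w` of a set that does not expand, and
over the sets `X ⊆ S₀` of `3 w` vertices that may contain all its neighbours in `S₀`. -/
noncomputable def total (S₀ : Finset (Fin n)) (s : State n) : ℝ :=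
  ∑ w ∈ Finset.Icc 1 ⌊0.08 * (S₀.card : ℝ)⌋₊, ∑ X ∈ S₀.powersetCard (3 * w),
    pot S₀ X (hitProb S₀.card w) (tilt n S₀.card w) s / threshold n S₀.card w

theorem hitProb_nonneg (m w : ℕ) : 0 ≤ hitProb m w := by
  unfold hitProb
  positivity

theorem tilt_nonneg (n m w : ℕ) : 0 ≤ tilt n m w := by
  unfold tilt
  have := hitProb_nonneg m w
  positivity

theorem threshold_nonneg (n m w : ℕ) : 0 ≤ threshold n m w := by
  unfold threshold
  have := tilt_nonneg n m w
  positivity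

theorem hitProb_pos {m w : ℕ} (hw : w ∈ Finset.Icc 1 ⌊0.08 * (m : ℝ)⌋₊) : 0 < hitProb m w := by
  obtain ⟨h1, h2⟩ := Finset.mem_Icc.1 hw
  have h3 : (0 : ℝ) < w := by exact_mod_cast h1
  have h4 : (w : ℝ) ≤ 0.08 * m := (Nat.le_floor_iff (by positivity)).1 h2
  have h5 : (0 : ℝ) < m := by linarith
  unfold hitProb
  positivity

theorem hitProb_le_one {m w : ℕ} (hw : w ∈ Finset.Icc 1 ⌊0.08 * (m : ℝ)⌋₊) : hitProb m w ≤ 1 := by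
  obtain ⟨h1, h2⟩ := Finset.mem_Icc.1 hw
  have h4 : (w : ℝ) ≤ 0.08 * m := (Nat.le_floor_iff (by positivity)).1 h2
  have h5 : (0 : ℝ) ≤ m := by positivity
  unfold hitProb
  refine div_le_one_of_le₀ ?_ (by positivity)
  linarith

theorem total_mono {S₀ : Finset (Fin n)} {s s' : State n}
    (hB : s.B ≤ s'.B) (hM : s.M ≤ s'.M) (hact : s.active ⊆ s'.active)
    (hold : ∀ v ∈ s.active, s'.Troublesome v ∨ min 8 (10 - s.out v) ≤ min 8 (10 - s'.out v))
    (hnew : ∀ v, v ∉ s.active → v ∈ s'.active → s'.out v ≤ 2) :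
    total S₀ s' ≤ total S₀ s :=
  Finset.sum_le_sum fun _ hw => Finset.sum_le_sum fun _ _ =>
    div_le_div_of_nonneg_right (pot_mono (hitProb_nonneg _ _) (hitProb_le_one hw)
      (tilt_nonneg _ _ _) hB hM hact hold hnew) (threshold_nonneg _ _ _)

theorem sum_total_le {S₀ : Finset (Fin n)} {s : State n} {v : Fin n} (hv : v ∈ s.active)
    (hO : (0.999 : ℝ) * S₀.card ≤ (s.options S₀ v).card) :
    ∑ w ∈ s.options S₀ v, total S₀ (s.addArc v w) ≤
      (s.options S₀ v).card * total S₀ s := by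
  unfold total
  rw [Finset.sum_comm, Finset.mul_sum]
  refine Finset.sum_le_sum fun w hw => ?_
  rw [Finset.sum_comm, Finset.mul_sum]
  refine Finset.sum_le_sum fun X hX => ?_
  rw [← Finset.sum_div, ← mul_div_assoc]
  refine div_le_div_of_nonneg_right ?_ (threshold_nonneg _ _ _)
  refine sum_pot_le (hitProb_pos hw) (hitProb_le_one hw) (tilt_nonneg _ _ _) hv ?_
  rw [(Finset.mem_powersetCard.1 hX).2]
  refine le_trans ?_ (mul_le_mul_of_nonneg_left hO (hitProb_nonneg _ _))
  obtain ⟨h1, h2⟩ := Finset.mem_Icc.1 hw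
  have h3 : (0 : ℝ) < w := by exact_mod_cast h1
  have h4 : (w : ℝ) ≤ 0.08 * S₀.card := (Nat.le_floor_iff (by positivity)).1 h2
  have h5 : (0 : ℝ) < S₀.card := by linarith
  unfold hitProb
  rw [div_mul_cancel₀ _ (by positivity)]
  push_cast
  exact le_rfl

theorem tilt_mul {m w : ℕ} (hn : 0 < (n : ℝ) / √(Real.log n))
    (hw : w ∈ Finset.Icc 1 ⌊0.08 * (m : ℝ)⌋₊) :
    tilt n m w * hitProb m w ^ 8 * (2140 * (n / √(Real.log n))) = w := by
  have := hitProb_pos hw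
  unfold tilt
  generalize (n : ℝ) / √(Real.log n) = μ at hn
  field_simp

/-- If the total potential is less than `1` and ten edges have been chosen from every active vertex,
then small sets of vertices that are not troublesome expand into `S₀`. -/
theorem expands_of_total_lt_one {S₀ : Finset (Fin n)} {s : State n}
    (hμ : 0 < (n : ℝ) / √(Real.log n))
    (hact : (s.active.card : ℝ) ≤ 2140 * (n / √(Real.log n))) (hZ : total S₀ s < 1)
    (hout : ∀ v ∈ s.active, 10 ≤ s.out v) (W : Finset (Fin n)) (hW : W.Nonempty)
    (hWa : W ⊆ s.active) (hT : ∀ v ∈ W, ¬ s.Troublesome v) (hWc : (W.card : ℝ) ≤ 0.08 * S₀.card) :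
    3 * W.card < {x | x ∈ S₀ ∧ ∃ v ∈ W, s.M.Adj v x}.ncard := by
  classical
  by_contra hlt
  rw [not_lt] at hlt
  have hset : {x | x ∈ S₀ ∧ ∃ v ∈ W, s.M.Adj v x} =
      ((S₀.filter fun x => ∃ v ∈ W, s.M.Adj v x : Finset (Fin n)) : Set (Fin n)) := by
    ext x
    simp
  rw [hset, Set.ncard_coe_finset] at hlt
  have hm : 3 * W.card ≤ S₀.card := by
    have h0 : (0 : ℝ) ≤ S₀.card := by positivity
    have : (3 * W.card : ℝ) ≤ S₀.card := by linarith
    exact_mod_cast this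
  obtain ⟨X, hNX, hXS, hXc⟩ := Finset.exists_subsuperset_card_eq (Finset.filter_subset _ _) hlt hm
  have hw : W.card ∈ Finset.Icc 1 ⌊0.08 * (S₀.card : ℝ)⌋₊ :=
    Finset.mem_Icc.2 ⟨hW.card_pos, Nat.le_floor hWc⟩
  set q := hitProb S₀.card W.card
  set t := tilt n S₀.card W.card
  have h1 := le_pot (X := X) (q := q) (t := t) (hitProb_nonneg _ _) (tilt_nonneg _ _ _) hWa hT
    (fun v hv => hout v (hWa hv))
    (fun v hv x hx hvx => hNX (Finset.mem_filter.2 ⟨hx, v, hv, hvx⟩)) hact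
  rw [tilt_mul hμ hw] at h1
  have ht : 0 < t := by
    have := hitProb_pos hw
    have hW' : (0 : ℝ) < W.card := by exact_mod_cast hW.card_pos
    simp only [t, tilt]
    positivity
  have h2 : 1 ≤ pot S₀ X q t s / threshold n S₀.card W.card := by
    rw [one_le_div (by unfold threshold; positivity)]
    exact h1
  have hnn : ∀ w X, 0 ≤ pot S₀ X (hitProb S₀.card w) (tilt n S₀.card w) s /
      threshold n S₀.card w := fun _ _ =>
    div_nonneg (pot_nonneg (hitProb_nonneg _ _) (tilt_nonneg _ _ _) s) (threshold_nonneg _ _ _)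
  have h3 : 1 ≤ total S₀ s :=
    (h2.trans (Finset.single_le_sum (f := fun X => pot S₀ X q t s / threshold n S₀.card W.card)
      (fun X _ => hnn _ X) (Finset.mem_powersetCard.2 ⟨hXS, hXc⟩))).trans
      (Finset.single_le_sum (f := fun w => ∑ X ∈ S₀.powersetCard (3 * w),
        pot S₀ X (hitProb S₀.card w) (tilt n S₀.card w) s / threshold n S₀.card w)
        (fun w _ => Finset.sum_nonneg fun X _ => hnn w X) hw)
  linarith

theorem total_init_le (S₀ : Finset (Fin n)) : total S₀ (State.init S₀) ≤
    ∑ w ∈ Finset.Icc 1 ⌊0.08 * (S₀.card : ℝ)⌋₊,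
      (S₀.card.choose (3 * w) : ℝ) / threshold n S₀.card w := by
  refine Finset.sum_le_sum fun w _ => ?_
  rw [← Finset.sum_div, ← Finset.card_powersetCard, ← nsmul_one]
  exact div_le_div_of_nonneg_right (Finset.sum_le_card_nsmul _ _ _ fun X _ =>
    pot_init_le (hitProb_nonneg _ _) (tilt_nonneg _ _ _)) (threshold_nonneg _ _ _)

/-- With `(m choose 3w) ≤ (e m / 3w) ^ 3w`, eight random choices from each of the `w` vertices beat
the number of choices of the set `X` and of the `w` vertices among at most `1.07 m`, where
`3 · 1.07 · e⁴ / 0.999⁸ ≤ 177`. -/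
theorem choose_div_threshold_le {m w : ℕ} (hμ : 0 < (n : ℝ) / √(Real.log n))
    (hm : 2000 * ((n : ℝ) / √(Real.log n)) ≤ m) (hw : w ∈ Finset.Icc 1 ⌊0.08 * (m : ℝ)⌋₊) :
    (m.choose (3 * w) : ℝ) / threshold n m w ≤ (177 * (3 * w / m) ^ 4) ^ w := by
  obtain ⟨h1, h2⟩ := Finset.mem_Icc.1 hw
  have h3 : (0 : ℝ) < w := by exact_mod_cast h1
  have h4 : (w : ℝ) ≤ 0.08 * m := (Nat.le_floor_iff (by positivity)).1 h2
  have hm0 : (0 : ℝ) < m := by linarith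
  have hq := hitProb_pos hw
  generalize hμ' : (n : ℝ) / √(Real.log n) = μ at hμ hm
  have hchoose : (m.choose (3 * w) : ℝ) ≤ ((Real.exp 1 * m / (3 * w)) ^ 3) ^ w := by
    have h5 := Nat.choose_le_pow_div (α := ℝ) (3 * w) m
    have h6 := Real.pow_div_factorial_le_exp (3 * w : ℝ) (by positivity) (3 * w)
    rw [← pow_mul, div_pow, mul_pow, ← Real.exp_nat_mul]
    push_cast at h5 h6 ⊢
    rw [mul_one]
    refine h5.trans ?_
    rw [div_le_div_iff₀ (by positivity) (by positivity)]
    rw [div_le_iff₀ (by positivity)] at h6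
    have := mul_le_mul_of_nonneg_left h6 (show (0 : ℝ) ≤ (m : ℝ) ^ (3 * w) by positivity)
    linarith
  have hthr : threshold n m w = (tilt n m w / Real.exp 1) ^ w := by
    unfold threshold
    rw [div_pow, ← Real.exp_nat_mul, mul_one, Real.exp_neg]
    ring
  have htilt : 0 < tilt n m w := by
    unfold tilt
    rw [hμ']
    positivity
  rw [hthr]
  refine (div_le_div_of_nonneg_right hchoose (by positivity)).trans ?_
  rw [← div_pow]
  refine pow_le_pow_left₀ (by positivity) ?_ w
  have heq : (Real.exp 1 * m / (3 * w)) ^ 3 / (tilt n m w / Real.exp 1) =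
      (Real.exp 1 ^ 4 * 3 / 0.999 ^ 8) * (2140 * μ / m) * (3 * w / m) ^ 4 := by
    unfold tilt hitProb
    rw [hμ']
    field_simp
  rw [heq]
  refine mul_le_mul_of_nonneg_right ?_ (by positivity)
  have h5 : 2140 * μ / m ≤ 1.07 := by
    rw [div_le_iff₀ hm0]
    linarith
  have h6 : Real.exp 1 ^ 4 ≤ 2.7182818286 ^ 4 :=
    pow_le_pow_left₀ (Real.exp_pos 1).le Real.exp_one_lt_d9.le 4
  calc Real.exp 1 ^ 4 * 3 / 0.999 ^ 8 * (2140 * μ / m)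
      ≤ 2.7182818286 ^ 4 * 3 / 0.999 ^ 8 * 1.07 := by gcongr
    _ ≤ 177 := by norm_num

/-- The total potential at the start is small: for `w ≤ 0.08 m` the terms of its bound decrease
geometrically with `w`, since `177 · 0.24⁴ ≤ 0.6`. -/
theorem exists_total_init_le : ∃ c : ℝ, ∀ (n : ℕ) (S₀ : Finset (Fin n)),
    0 < (n : ℝ) / √(Real.log n) → 2000 * ((n : ℝ) / √(Real.log n)) ≤ S₀.card →
      total S₀ (State.init S₀) ≤ c / (S₀.card : ℝ) ^ 4 := by
  have hsum : Summable fun w : ℕ => (w : ℝ) ^ 4 * (0.6 : ℝ) ^ w :=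
    summable_pow_mul_geometric_of_norm_lt_one 4 (by norm_num)
  refine ⟨23895 * ∑' w : ℕ, (w : ℝ) ^ 4 * (0.6 : ℝ) ^ w, fun n S₀ hμ hm => ?_⟩
  have hm0 : (0 : ℝ) < S₀.card := by linarith
  refine (total_init_le S₀).trans ?_
  have h1 : ∀ w ∈ Finset.Icc 1 ⌊0.08 * (S₀.card : ℝ)⌋₊,
      (S₀.card.choose (3 * w) : ℝ) / threshold n S₀.card w ≤
        23895 / (S₀.card : ℝ) ^ 4 * ((w : ℝ) ^ 4 * (0.6 : ℝ) ^ w) := by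
    intro w hw
    refine (choose_div_threshold_le hμ hm hw).trans ?_
    obtain ⟨h1, h2⟩ := Finset.mem_Icc.1 hw
    have h4 : (w : ℝ) ≤ 0.08 * S₀.card := (Nat.le_floor_iff (by positivity)).1 h2
    obtain ⟨w, rfl⟩ : ∃ w', w = w' + 1 := ⟨w - 1, by omega⟩
    set x : ℝ := 3 * ((w + 1 : ℕ) : ℝ) / S₀.card
    have hx0 : 0 ≤ x := by positivity
    have hx : x ≤ 0.24 := by
      rw [div_le_iff₀ hm0]
      linarith
    have h5 : 177 * x ^ 4 ≤ 0.6 := by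
      have : x ^ 4 ≤ 0.24 ^ 4 := pow_le_pow_left₀ hx0 hx 4
      norm_num at this ⊢
      linarith
    rw [pow_succ]
    have h6 : (177 * x ^ 4) ^ w ≤ 0.6 ^ w := pow_le_pow_left₀ (by positivity) h5 w
    refine (mul_le_mul_of_nonneg_right h6 (by positivity)).trans (le_of_eq ?_)
    simp only [x]
    rw [pow_succ]
    field_simp
    ring
  refine (Finset.sum_le_sum h1).trans ?_
  rw [← Finset.mul_sum, mul_div_right_comm]
  refine mul_le_mul_of_nonneg_left ?_ (by positivity)
  exact hsum.sum_le_tsum _ fun w _ => by positivity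

end Potential

/-! ### The supermartingale -/

section Supermartingale

variable {n : ℕ}

open Classical in
/-- A bound on the conditional probability that the strategy fails, given the position `s` after
`k` rounds. The invariant can be lost only when the total potential has reached `1`; from then on
the bound is the trivial one, until the second phase ends. -/
noncomputable def risk (b : ℕ) (S₀ : Finset (Fin n)) (k : ℕ) (s : State n) : ℝ≥0∞ :=
  if s.phase = Phase.ended then 0
  else if Inv b S₀ k s then min 1 (ENNReal.ofReal (total S₀ s)) else 1

theorem risk_le_one (b : ℕ) (S₀ : Finset (Fin n)) (k : ℕ) (s : State n) :
    risk b S₀ k s ≤ 1 := by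
  unfold risk
  split_ifs
  · exact zero_le_one
  · exact min_le_left _ _
  · exact le_rfl

theorem risk_le_of_inv {b : ℕ} {S₀ : Finset (Fin n)} {k : ℕ} {s : State n} (h : Inv b S₀ k s) :
    risk b S₀ k s ≤ ENNReal.ofReal (total S₀ s) := by
  unfold risk
  rw [if_pos h]
  split_ifs
  · exact zero_le
  · exact min_le_right _ _

theorem risk_of_ended {b : ℕ} {S₀ : Finset (Fin n)} {k : ℕ} {s : State n}
    (h : s.phase = Phase.ended) : risk b S₀ k s = 0 := if_pos h

theorem risk_of_failed {b : ℕ} {S₀ : Finset (Fin n)} {k : ℕ} {s : State n}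
    (h : s.phase = Phase.failed) : risk b S₀ k s = 1 := by
  unfold risk
  rw [if_neg (by rw [h]; simp), if_neg]
  rintro ⟨-, -, hp, -⟩
  rw [h] at hp
  rcases hp with hp | hp <;> cases hp

theorem Shape.out_le_two {S₀ : Finset (Fin n)} {J : SimpleGraph (Fin n)}
    {f : Fin n → Option (Fin n)} {s : State n} (h : Shape S₀ J f s) {v : Fin n}
    (hv : v ∉ s.active) : s.out v ≤ 2 := (h.out_le v hv).trans (h.deg_J v)

/-- A random choice does not increase the risk on average. -/
theorem Mid.expect_randomMove_le {b : ℕ} {S₀ : Finset (Fin n)} (hL : Large n b S₀.card) {k : ℕ}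
    {s : State n} (h : Mid b S₀ k s) (hn : ∀ x, ¬ s.Needy x) {v : Fin n} (hv : v ∈ s.active)
    (hout : s.out v < 10) :
    expect (s.randomMove S₀ v) (risk b S₀ (k + 1)) ≤ ENNReal.ofReal (total S₀ s) := by
  classical
  obtain ⟨J, f, o, hs, hc⟩ := h.shape
  have hO := hL.le_card_options (hs.not_troublesome (hn v) hout)
  have hm : (0 : ℝ) < S₀.card := by linarith [hL.le_m, hL.le_μ]
  have hO' : (0 : ℝ) < (s.options S₀ v).card := by linarith
  have hne : (s.options S₀ v).Nonempty := by
    rw [← Finset.card_pos]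
    exact_mod_cast hO'
  have hnn : ∀ s' : State n, 0 ≤ total S₀ s' := fun s' =>
    Finset.sum_nonneg fun w _ => Finset.sum_nonneg fun X _ =>
      div_nonneg (pot_nonneg (hitProb_nonneg _ _) (tilt_nonneg _ _ _) s') (threshold_nonneg _ _ _)
  unfold State.randomMove
  rw [dif_pos hne, expect_map, expect_uniformOfFinset]
  have h1 : ∑ w ∈ s.options S₀ v, (risk b S₀ (k + 1) ∘ s.addArc v) w ≤
      ENNReal.ofReal ((s.options S₀ v).card * total S₀ s) := by
    refine (Finset.sum_le_sum fun w hw =>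
      risk_le_of_inv (h.addArc hn hv hout (Finset.mem_filter.1 hw).1)).trans ?_
    rw [← ENNReal.ofReal_sum_of_nonneg fun w _ => hnn _]
    exact ENNReal.ofReal_le_ofReal (sum_total_le hv hO)
  rw [ENNReal.ofReal_mul hO'.le, ENNReal.ofReal_natCast] at h1
  refine (mul_le_mul_right h1 _).trans ?_
  rw [← mul_assoc, ENNReal.inv_mul_cancel (by exact_mod_cast hO'.ne') (ENNReal.natCast_ne_top _),
    one_mul]

/-- As long as the total potential is less than `1`, Maker's move does not increase the risk on
average; in particular, the rules for a missing edge do not apply. -/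
theorem MakerMove.expect_risk_le {b : ℕ} {S₀ : Finset (Fin n)} (hL : Large n b S₀.card) {k : ℕ}
    {s : State n} {μ : PMF (State n)} (hμ : MakerMove b S₀ s μ) (h : Mid b S₀ k s)
    (hZ : total S₀ s < 1) :
    expect μ (risk b S₀ (k + 1)) ≤ ENNReal.ofReal (total S₀ s) := by
  have hμ0 : 0 < (n : ℝ) / √(Real.log n) := by linarith [hL.le_μ]
  induction hμ with
  | needy s v w hv hmax hw =>
    rw [expect_pure]
    refine (risk_le_of_inv (h.needy hL hv hmax hw.1 hw.2.1)).trans (ENNReal.ofReal_le_ofReal ?_)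
    obtain ⟨J, f, o, hs, hc⟩ := h.shape
    have hout : ∀ x, x ≠ v → ((s.addArc v w).moveToS {w}).out x = s.out x := by
      intro x hx
      simp [State.addArc, State.moveToS, hx]
    refine total_mono le_rfl le_sup_left (active_subset_moveToS (s.addArc v w) {w})
      (fun x _ => ?_) fun x hx _ => ?_
    · by_cases hxv : x = v
      · subst hxv
        exact Or.inl hv.1
      · rw [hout x hxv]
        exact Or.inr le_rfl
    · rw [hout x]
      · exact hs.out_le_two hx
      · rintro rfl
        exact hx (State.mem_active.2 (Or.inl (hs.mem_S x hv.1)))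
  | needyFail s v hv hmax hw =>
    obtain ⟨w, hw'⟩ := h.exists_needy_move hL hv
    exact absurd hw' (hw w)
  | random s v hn hv hout =>
    exact h.expect_randomMove_le hL hn (State.mem_active.2 (Or.inl hv)) hout
  | join s u v hp hset huv =>
    rw [expect_pure]
    refine (risk_le_of_inv (h.join hset.1 hp huv)).trans (ENNReal.ofReal_le_ofReal ?_)
    have hact : ({ s.addArc u v with F := s.F ⊔ SimpleGraph.edge u v } : State n).active =
        s.active := by
      ext x
      rw [State.mem_active, State.mem_active]
      simp [State.addArc, hp]
    refine total_mono le_rfl le_sup_left hact.ge (fun x hx => Or.inr ?_)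
      fun x hx hx' => absurd (hact ▸ hx') hx
    have hxu : x ≠ u := by
      rintro rfl
      rw [State.mem_active] at hx
      exact huv.1.1 (hx.resolve_right fun h => h.1 hp)
    simp [State.addArc, hxu]
  | toPhaseTwo s X μ hp hset huv hX hμ ih =>
    obtain ⟨J, f, o, hs, hc⟩ := h.shape
    have h1 : total S₀ { s with phase := Phase.two, P := X } ≤ total S₀ s := by
      refine total_mono le_rfl le_rfl ?_ (fun x _ => Or.inr le_rfl)
        fun x hx _ => hs.out_le_two hx
      intro v hv
      rw [State.mem_active] at hv ⊢
      exact Or.inl (hv.resolve_right fun h => h.1 hp)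
    exact (ih (h.toPhaseTwo hp huv hX) (h1.trans_lt hZ)).trans (ENNReal.ofReal_le_ofReal h1)
  | randomEndpoint s v hp hset hv hout =>
    refine h.expect_randomMove_le hL hset.1 (State.mem_active.2 (Or.inr ⟨?_, hv⟩)) hout
    rw [hp]
    simp
  | boost s u v hp hset he hcyc huv =>
    have hout : ∀ v ∈ s.active, 10 ≤ s.out v := by
      intro v hv
      rw [State.mem_active] at hv
      exact hv.elim (hset.2 v) fun hv => he v hv.2
    have hP := (h.exists_booster hL hp hset.1 hcyc fun W hW hWa hT hWc =>
      expands_of_total_lt_one hμ0 (h.card_active_le hL) hZ hout W hW hWa hT hWc).1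
    rw [expect_pure]
    refine (risk_le_of_inv (h.boost hset.1 hp hcyc hP huv)).trans (ENNReal.ofReal_le_ofReal ?_)
    refine total_mono (s' := s.addArc u v) le_rfl le_sup_left (subset_refl s.active)
      (fun x hx => Or.inr ?_) fun x hx hx' => absurd hx' hx
    have := hout x hx
    omega
  | boostFail s hp hset he hcyc huv =>
    have hout : ∀ v ∈ s.active, 10 ≤ s.out v := by
      intro v hv
      rw [State.mem_active] at hv
      exact hv.elim (hset.2 v) fun hv => he v hv.2
    obtain ⟨-, u, v, h1⟩ := h.exists_booster hL hp hset.1 hcyc fun W hW hWa hT hWc =>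
      expands_of_total_lt_one hμ0 (h.card_active_le hL) hZ hout W hW hWa hT hWc
    exact absurd h1 (huv u v)
  | finish s hp hset he hcyc =>
    rw [expect_pure, risk_of_ended rfl]
    exact zero_le

theorem Inv.total_afterBreaker_le {b : ℕ} {S₀ : Finset (Fin n)} {k : ℕ} {s : State n}
    (h : Inv b S₀ k s) (E : SimpleGraph (Fin n)) (X : Finset (Fin n)) :
    total S₀ { s.afterBreaker E with P := X } ≤ total S₀ s := by
  obtain ⟨⟨J, f, o, hs, hc⟩, -⟩ := h
  exact total_mono (s' := { s.afterBreaker E with P := X }) (show s.B ≤ s.B ⊔ E from le_sup_left)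
    le_rfl (active_subset_afterBreaker s E) (fun x _ => Or.inr le_rfl)
    fun x hx _ => hs.out_le_two hx

/-- The risk is a supermartingale. -/
theorem Round.expect_risk_le {b : ℕ} {S₀ : Finset (Fin n)} (hL : Large n b S₀.card) {k : ℕ}
    {s : State n} {μ : PMF (State n)} (h : Round b S₀ s μ) :
    expect μ (risk b S₀ (k + 1)) ≤ risk b S₀ k s := by
  have hone : expect μ (risk b S₀ (k + 1)) ≤ 1 :=
    (expect_mono μ fun s' _ => risk_le_one b S₀ (k + 1) s').trans (expect_const μ 1).le
  by_cases hend : s.phase = Phase.ended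
  · cases h with
    | phaseOne E μ hp => rw [hend] at hp; cases hp
    | phaseTwo E X μ hp => rw [hend] at hp; cases hp
    | _ => rw [expect_pure, risk_of_ended hend]; exact zero_le
  by_cases hI : Inv b S₀ k s
  · have hrisk : risk b S₀ k s = min 1 (ENNReal.ofReal (total S₀ s)) := by
      unfold risk
      rw [if_neg hend, if_pos hI]
    rw [hrisk]
    refine le_min hone ?_
    rcases le_or_gt 1 (total S₀ s) with hZ | hZ
    · exact hone.trans (ENNReal.one_le_ofReal.2 hZ)
    cases h with
    | phaseOne E μ hp hE hb hμ =>
      have h1 := hI.afterBreaker hL hb (X := s.P) fun h => by rw [hp] at h; cases h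
      have h2 := hI.total_afterBreaker_le E s.P
      exact (hμ.expect_risk_le hL h1 (h2.trans_lt hZ)).trans (ENNReal.ofReal_le_ofReal h2)
    | phaseTwo E X μ hp hE hb hX hμ =>
      have h1 := hI.afterBreaker hL hb fun _ => hX
      have h2 := hI.total_afterBreaker_le E X
      exact (hμ.expect_risk_le hL h1 (h2.trans_lt hZ)).trans (ENNReal.ofReal_le_ofReal h2)
    | _ =>
      rename_i hp
      rcases hp with hp | hp
      · exact absurd hp hend
      · obtain ⟨-, -, hp', -⟩ := hI
        rw [hp] at hp'
        rcases hp' with hp' | hp' <;> cases hp'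
  · have hrisk : risk b S₀ k s = 1 := by
      unfold risk
      rw [if_neg hend, if_neg hI]
    rw [hrisk]
    exact hone

/-- The bound on the conditional probability of failure, given the history. -/
noncomputable def historyRisk (b : ℕ) (S₀ : Finset (Fin n)) (k : ℕ) : List (State n) → ℝ≥0∞
  | [] => 0
  | s :: _ => risk b S₀ k s

theorem expect_historyRisk_le {b : ℕ} {S₀ : Finset (Fin n)} (hL : Large n b S₀.card)
    {σ : List (State n) → PMF (State n)} (hσ : IsPlay b S₀ σ) (k : ℕ) :
    expect (historyLaw S₀ σ k) (historyRisk b S₀ k) ≤ risk b S₀ 0 (State.init S₀) := by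
  induction k with
  | zero =>
    change expect (PMF.pure _) _ ≤ _
    rw [expect_pure]
    exact le_rfl
  | succ k ih =>
    refine le_trans ?_ ih
    change expect (PMF.bind _ _) _ ≤ _
    rw [expect_bind]
    refine expect_mono _ fun h hh => ?_
    rw [expect_map]
    cases h with
    | nil =>
      -- A history is never empty.
      exfalso
      clear ih
      cases k with
      | zero =>
        change _ ∈ (PMF.pure _).support at hh
        rw [PMF.mem_support_pure_iff] at hh
        cases hh
      | succ k =>
        change _ ∈ (PMF.bind _ _).support at hh
        rw [PMF.mem_support_bind_iff] at hh
        obtain ⟨h', -, hh⟩ := hh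
        rw [PMF.mem_support_map_iff] at hh
        obtain ⟨s, -, hs⟩ := hh
        cases hs
    | cons s h => exact (hσ k s h hh).expect_risk_le hL

/-- Once the strategy has failed, the position does not change any more. -/
theorem head_failed {b : ℕ} {S₀ : Finset (Fin n)} {σ : List (State n) → PMF (State n)}
    (hσ : IsPlay b S₀ σ) (k : ℕ) : ∀ h ∈ (historyLaw S₀ σ k).support,
      (∃ s ∈ h, s.phase = Phase.failed) → ∃ s t, h = s :: t ∧ s.phase = Phase.failed := by
  induction k with
  | zero =>
    intro h hh hf
    change _ ∈ (PMF.pure _).support at hh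
    rw [PMF.mem_support_pure_iff] at hh
    subst hh
    obtain ⟨s, hs, hsf⟩ := hf
    rw [List.mem_singleton] at hs
    exact ⟨s, [], by rw [hs], hsf⟩
  | succ k ih =>
    intro h hh hf
    change _ ∈ (PMF.bind _ _).support at hh
    rw [PMF.mem_support_bind_iff] at hh
    obtain ⟨h', hh', hh⟩ := hh
    rw [PMF.mem_support_map_iff] at hh
    obtain ⟨s, hs, rfl⟩ := hh
    obtain ⟨x, hx, hxf⟩ := hf
    refine ⟨s, h', rfl, ?_⟩
    rcases List.mem_cons.1 hx with rfl | hx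
    · exact hxf
    · obtain ⟨y, t, rfl, hy⟩ := ih h' hh' ⟨x, hx, hxf⟩
      have hround := hσ k y t hh'
      generalize hμ : σ (y :: t) = μ at hround hs
      cases hround with
      | phaseOne E μ hp => rw [hy] at hp; cases hp
      | phaseTwo E X μ hp => rw [hy] at hp; cases hp
      | _ =>
        rw [PMF.mem_support_pure_iff] at hs
        rw [hs]
        exact hy

/-- The probability that the strategy has not failed. -/
theorem one_sub_risk_le {b : ℕ} {S₀ : Finset (Fin n)} (hL : Large n b S₀.card)
    {σ : List (State n) → PMF (State n)} (hσ : IsPlay b S₀ σ) (k : ℕ) :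
    1 - risk b S₀ 0 (State.init S₀) ≤ (historyLaw S₀ σ k).toOuterMeasure
      {h | ∀ s ∈ h, s.phase ≠ Phase.failed} := by
  classical
  rw [tsub_le_iff_right]
  refine le_trans ?_ (add_le_add le_rfl (expect_historyRisk_le hL hσ k))
  rw [PMF.toOuterMeasure_apply, ← (historyLaw S₀ σ k).tsum_coe, expect, ← ENNReal.tsum_add]
  refine ENNReal.tsum_le_tsum fun h => ?_
  by_cases hh : h ∈ (historyLaw S₀ σ k).support
  · by_cases hf : ∃ s ∈ h, s.phase = Phase.failed
    · obtain ⟨s, t, rfl, hs⟩ := head_failed hσ k h hh hf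
      rw [historyRisk, risk_of_failed hs, mul_one]
      exact le_add_self
    · push Not at hf
      rw [Set.indicator_of_mem (show h ∈ {h | ∀ s ∈ h, s.phase ≠ Phase.failed} from hf)]
      exact le_self_add
  · rw [PMF.mem_support_iff, not_not] at hh
    rw [hh]
    exact zero_le

end Supermartingale

/-! ### Asymptotics -/

theorem eventually_le_div_sqrt_log (c : ℝ) :
    ∀ᶠ n : ℕ in Filter.atTop, c ≤ (n : ℝ) / √(Real.log n) ∧
      1000000 * ((n : ℝ) / √(Real.log n)) ≤ n ∧ 1 < n := by
  have hlog : Filter.Tendsto (fun n : ℕ => Real.log n) Filter.atTop Filter.atTop :=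
    Real.tendsto_log_atTop.comp tendsto_natCast_atTop_atTop
  have hsqrt : Filter.Tendsto (fun n : ℕ => √(Real.log n)) Filter.atTop Filter.atTop :=
    Real.tendsto_sqrt_atTop.comp hlog
  have hs : Filter.Tendsto (fun n : ℕ => √(n : ℝ)) Filter.atTop Filter.atTop :=
    Real.tendsto_sqrt_atTop.comp tendsto_natCast_atTop_atTop
  filter_upwards [hsqrt.eventually_ge_atTop 1000000, hs.eventually_ge_atTop c,
    Filter.eventually_gt_atTop 1] with n h1 h2 h3
  have h4 : (0 : ℝ) < √(Real.log n) := by linarith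
  have hn : (0 : ℝ) < n := by exact_mod_cast (by omega : 0 < n)
  refine ⟨?_, ?_, h3⟩
  · rw [le_div_iff₀ h4]
    have h5 : √(Real.log n) ≤ √(n : ℝ) := Real.sqrt_le_sqrt (Real.log_le_self hn.le)
    have h6 := Real.mul_self_sqrt hn.le
    calc c * √(Real.log n) ≤ √(n : ℝ) * √(n : ℝ) :=
          mul_le_mul h2 h5 h4.le (Real.sqrt_nonneg _)
      _ = n := h6
  · rw [← mul_div_assoc, div_le_iff₀ h4]
    nlinarith

theorem large_of_le {n b m : ℕ} (h1 : 1000 ≤ (n : ℝ) / √(Real.log n))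
    (h2 : 1000000 * ((n : ℝ) / √(Real.log n)) ≤ n) (hn : 1 < n)
    (hb : (b : ℝ) ≤ n / Real.log n - 10000 * n / (Real.log n) ^ (3 / 2 : ℝ))
    (hm : m = ⌈2000 * (n : ℝ) / √(Real.log n)⌉₊) : Large n b m := by
  have hn' : (1 : ℝ) < n := by exact_mod_cast hn
  have hlog : 0 < Real.log n := Real.log_pos hn'
  have hsq : √(Real.log n) ^ 2 = Real.log n := Real.sq_sqrt hlog.le
  have hs : 0 < √(Real.log n) := Real.sqrt_pos.2 hlog
  have hpow : (Real.log n) ^ (3 / 2 : ℝ) = Real.log n * √(Real.log n) := by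
    rw [show (3 / 2 : ℝ) = 1 + 1 / 2 by norm_num, Real.rpow_add hlog, Real.rpow_one,
      Real.sqrt_eq_rpow]
  rw [hpow] at hb
  have hceil : (2000 : ℝ) * n / √(Real.log n) = 2000 * (n / √(Real.log n)) := by ring
  refine ⟨h1, h2, ?_, ?_, ?_, ?_⟩
  · have h3 : (b : ℝ) ≤ n / Real.log n := by
      refine hb.trans (sub_le_self _ (by positivity))
    rw [div_pow, hsq]
    calc (b : ℝ) * n ≤ n / Real.log n * n := by gcongr
      _ = (n : ℝ) ^ 2 / Real.log n := by ring
  · have h3 := mul_le_mul_of_nonneg_right hb hlog.le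
    have h4 : ((n : ℝ) / Real.log n - 10000 * n / (Real.log n * √(Real.log n))) * Real.log n =
        n - 10000 * (n / √(Real.log n)) := by
      field_simp
    linarith
  · rw [hm, ← hceil]
    exact Nat.le_ceil _
  · rw [hm, ← hceil]
    exact (Nat.ceil_lt_add_one (by positivity)).le

end MakerBreaker

theorem theorem3 :
    ∃ C : ℝ, 0 < C ∧ ∀ ε : ℝ, 0 < ε → ∃ N : ℕ, ∀ n : ℕ, N ≤ n → ∀ b : ℕ,
      (b : ℝ) ≤ n / Real.log n - C * n / (Real.log n) ^ (3 / 2 : ℝ) →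
      ∀ S₀ : Finset (Fin n), S₀.card = ⌈2000 * (n : ℝ) / √(Real.log n)⌉₊ →
      ∀ σ : List (MakerBreaker.State n) → PMF (MakerBreaker.State n),
        MakerBreaker.IsPlay b S₀ σ →
        ∀ k : ℕ, 1 - ENNReal.ofReal ε ≤
          (MakerBreaker.historyLaw S₀ σ k).toOuterMeasure
            {h | ∀ s ∈ h, s.phase ≠ MakerBreaker.Phase.failed} := by
  obtain ⟨c, hc⟩ := MakerBreaker.exists_total_init_le
  refine ⟨10000, by norm_num, fun ε hε => ?_⟩
  obtain ⟨N, hN⟩ := Filter.eventually_atTop.1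
    (MakerBreaker.eventually_le_div_sqrt_log (max 1000 (c / ε)))
  refine ⟨N, fun n hn b hb S₀ hS₀ σ hσ k => ?_⟩
  obtain ⟨h1, h2, h3⟩ := hN n hn
  have hL : MakerBreaker.Large n b S₀.card :=
    MakerBreaker.large_of_le ((le_max_left _ _).trans h1) h2 h3 hb hS₀
  refine le_trans (tsub_le_tsub_left ?_ 1) (MakerBreaker.one_sub_risk_le hL hσ k)
  refine (MakerBreaker.risk_le_of_inv (MakerBreaker.inv_init b S₀)).trans
    (ENNReal.ofReal_le_ofReal ?_)
  have hμ := hL.le_μ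
  have hm := hL.le_m
  refine (hc n S₀ (by linarith) hm).trans ?_
  have h4 : c / ε ≤ n / √(Real.log n) := (le_max_right _ _).trans h1
  have hm1 : (1 : ℝ) ≤ S₀.card := by linarith
  rw [div_le_iff₀ (by positivity)]
  rw [div_le_iff₀ hε] at h4
  have h5 : (S₀.card : ℝ) ≤ (S₀.card : ℝ) ^ 4 := le_self_pow₀ hm1 (by norm_num)
  nlinarith
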